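/- Let $N\ge 2$, $0<s<1<p<N$. For an open set $U\subset\mathbb{R}^N$ let $X_0^{s,p}(U)=\{u\in W^{1,p}(\mathbb{R}^N): u|_U\in W^{1,p}_0(U),\ u=0 \text{ a.e. in }\mathbb{R}^N\setminus U\}$, where $W^{1,p}_0(U)$ is the closure of $C_c^\infty(U)$ in $W^{1,p}(U)$. Let $\Omega\subset\mathbb{R}^N$ be a bounded open set and let $V,g\in L^q(\Omega)$ for some $q\in(\frac{N}{sp},\infty)$, with $V\ge 0$ and $g>0$ a.e. in $\Omega$. For a measurable set $A\subset\Omega$ put $X_0^{s,p}(A)=\{u\in X_0^{s,p}(\Omega): u=0\text{ a.e. outside }A\}$ (for $A=\Omega$ this is the space above). A real number $\lambda$ is an eigenvalue on $A$, with eigenfunction $u\in X_0^{s,p}(A)\setminus\{0\}$, if $$\int_{A}|\nabla u|^{p-2}\nabla u\cdot\nabla v\,dx+\iint_{\mathbb{R}^N\times\mathbb{R}^N}\frac{|u(x)-u(y)|^{p-2}(u(x)-u(y))(v(x)-v(y))}{|x-y|^{N+ps}}\,dx\,dy+\int_{A}V|u|^{p-2}uv\,dx=\lambda\int_{A}g|u|^{p-2}uv\,dx$$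 for all $v\in X_0^{s,p}(A)$. The first eigenvalue $\lambda_1(A)$ is the least positive eigenvalue on $A$. Let $u$ be an eigenfunction on $\Omega$ for an eigenvalue $\nu$ that is not the first eigenvalue $\lambda_1(\Omega)$, and let $\Omega_+=\{x\in\Omega:u(x)>0\}$, $\Omega_-=\{x\in\Omega:u(x)<0\}$. Then the first eigenvalues $\lambda_1(\Omega_+)$ and $\lambda_1(\Omega_-)$ exist, and $$\nu>\lambda_1(\Omega_+)\qquad\text{and}\qquad \nu>\lambda_1(\Omega_-).$$ If $u$ is continuous in $\Omega$, so that $\Omega_\pm$ are open, the same holds when $\lambda_1(\Omega_\pm)$ is defined with the space $X_0^{s,p}(U)$, $U=\Omega_\pm$, of the open set (the one built on $W_0^{1,p}(U)$). Moreover, there is a constant $C=C(N,p,s)>0$, independent of $\Omega,V,g,q,\nu,u$, such that $$\nu\ \ge\ \frac{C}{\|g\|_{L^{N/(ps)}(\Omega)}}\,|\Omega_+|^{-\frac{p-ps}{N}}\qquad\text{and}\qquad \nu\ \ge\ \frac{C}{\|g\|_{L^{N/(ps)}(\Omega)}}\,|\Omega_-|^{-\frac{p-ps}{N}}.$$ 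-/

import Mathlib

open MeasureTheory Filter Topology
open scoped ENNReal ContDiff

namespace MixedEigen

/-- Euclidean space of dimension `N`. -/
abbrev RN (N : ℕ) : Type := EuclideanSpace ℝ (Fin N)

/-- `φ ∈ C_c^∞(U)`, extended by zero to the whole space. -/
structure IsTestFunction {N : ℕ} (U : Set (RN N)) (φ : RN N → ℝ) : Prop where
  smooth : ContDiff ℝ ∞ φ
  compact : HasCompactSupport φ
  support_subset : tsupport φ ⊆ U

/-- `G` is the weak gradient of `u` in the open set `U`. -/
def HasWeakGradient {N : ℕ} (U : Set (RN N)) (u : RN N → ℝ) (G : RN N → RN N) : Prop :=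
  ∀ φ : RN N → ℝ, IsTestFunction U φ → ∀ e : RN N,
    ∫ x in U, u x * fderiv ℝ φ x e = - ∫ x in U, φ x * inner ℝ (G x) e

/-- `u ∈ W^{1,p}(U)`, with weak gradient `G`. -/
structure MemW1p {N : ℕ} (U : Set (RN N)) (p : ℝ) (u : RN N → ℝ) (G : RN N → RN N) :
    Prop where
  memLp : MemLp u (ENNReal.ofReal p) (volume.restrict U)
  memLp_grad : MemLp G (ENNReal.ofReal p) (volume.restrict U)
  weakGradient : HasWeakGradient U u G

/-- `u|_U ∈ W_0^{1,p}(U)`, with weak gradient `G`: membership in the closure of `C_c^∞(U)`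
in the norm of `W^{1,p}(U)`. -/
structure MemW01p {N : ℕ} (U : Set (RN N)) (p : ℝ) (u : RN N → ℝ) (G : RN N → RN N) :
    Prop where
  memW1p : MemW1p U p u G
  approx : ∃ φ : ℕ → RN N → ℝ, (∀ n, IsTestFunction U (φ n)) ∧
    Tendsto (fun n => eLpNorm (fun x => φ n x - u x) (ENNReal.ofReal p) (volume.restrict U))
      atTop (𝓝 0) ∧
    Tendsto (fun n => eLpNorm (fun x => gradient (φ n) x - G x) (ENNReal.ofReal p)
      (volume.restrict U)) atTop (𝓝 0)

/-- The space `X_0^{s,p}(Ω)` for an open set `Ω`: functions `u ∈ W^{1,p}(ℝ^N)` with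
`u|_Ω ∈ W_0^{1,p}(Ω)` and `u = 0` in `ℝ^N ∖ Ω`. An element is recorded as a pair `(u, ∇u)`. -/
def spaceX0 {N : ℕ} (Ω : Set (RN N)) (p : ℝ) : Set ((RN N → ℝ) × (RN N → RN N)) :=
  {w | MemW1p Set.univ p w.1 w.2 ∧ MemW01p Ω p w.1 w.2 ∧ ∀ᵐ x, x ∉ Ω → w.1 x = 0}

/-- The space `X_0^{s,p}(A)` for a measurable subset `A` of the open set `Ω` (given up to null
sets): the functions of `X_0^{s,p}(Ω)` that vanish a.e. outside `A`. -/
def spaceX0On {N : ℕ} (Ω A : Set (RN N)) (p : ℝ) : Set ((RN N → ℝ) × (RN N → RN N)) :=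
  {w | w ∈ spaceX0 Ω p ∧ ∀ᵐ x, x ∉ A → w.1 x = 0}

theorem spaceX0On_self {N : ℕ} (Ω : Set (RN N)) (p : ℝ) :
    spaceX0On Ω Ω p = spaceX0 Ω p := by
  ext w
  exact ⟨fun h => h.1, fun h => ⟨h, h.2.2⟩⟩

/-- The left-hand side of the weak formulation on `A`, at `w = (u, ∇u)` and `z = (v, ∇v)`. -/
noncomputable def weakForm {N : ℕ} (A : Set (RN N)) (s p : ℝ) (V g : RN N → ℝ) (lam : ℝ)
    (w z : (RN N → ℝ) × (RN N → RN N)) : ℝ :=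
  (∫ x in A, ‖w.2 x‖ ^ (p - 2) * inner ℝ (w.2 x) (z.2 x))
    + (∫ y : RN N × RN N,
        |w.1 y.1 - w.1 y.2| ^ (p - 2) * (w.1 y.1 - w.1 y.2) * (z.1 y.1 - z.1 y.2)
          / ‖y.1 - y.2‖ ^ ((N : ℝ) + p * s))
    + (∫ x in A, V x * |w.1 x| ^ (p - 2) * w.1 x * z.1 x)
    - lam * ∫ x in A, g x * |w.1 x| ^ (p - 2) * w.1 x * z.1 x

/-- `u` is an eigenfunction for the eigenvalue `lam` of the problem on `A`, where `T` is the
solution and test space belonging to `A`. -/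
def IsEigenfunction {N : ℕ} (T : Set ((RN N → ℝ) × (RN N → RN N))) (A : Set (RN N))
    (s p : ℝ) (V g : RN N → ℝ) (lam : ℝ) (u : RN N → ℝ) : Prop :=
  ∃ G : RN N → RN N, (u, G) ∈ T ∧ ¬ (u =ᵐ[volume] 0) ∧
    ∀ z ∈ T, weakForm A s p V g lam (u, G) z = 0

/-- `lam` is the first eigenvalue of the problem on `A` with solution space `T`: the least
positive eigenvalue. -/
def IsFirstEigenvalue {N : ℕ} (T : Set ((RN N → ℝ) × (RN N → RN N))) (A : Set (RN N))
    (s p : ℝ) (V g : RN N → ℝ) (lam : ℝ) : Prop :=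
  IsLeast {μ : ℝ | 0 < μ ∧ ∃ u, IsEigenfunction T A s p V g μ u} lam

/-- The positivity set of `u` in `Ω`. -/
def posSet {N : ℕ} (Ω : Set (RN N)) (u : RN N → ℝ) : Set (RN N) := {x | x ∈ Ω ∧ 0 < u x}

/-- The negativity set of `u` in `Ω`. -/
def negSet {N : ℕ} (Ω : Set (RN N)) (u : RN N → ℝ) : Set (RN N) := {x | x ∈ Ω ∧ u x < 0}

end MixedEigen

/-! Test the equation of `u` with its positive part `u⁺`. The local terms become exactly the local
energies of `u⁺`, while in the double integral `|a-b|^(p-2)(a-b)(a⁺-b⁺) ≥ |a⁺-b⁺|^p`, strictly when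
`b < 0 < a`. So if `u` changes sign, the Rayleigh quotient of `u⁺` is strictly smaller than `ν`
(`Admissible.opEnergy_posPair_lt`). The first eigenvalue on `Ω₊` is the minimum of that quotient
over a space containing `u⁺`, hence lies below `ν`. The negative part is the same statement for
`-u`.

Two facts carry this. One is that an eigenfunction of constant sign belongs to the first eigenvalue
(`Admissible.isFirstEigenvalue_of_nonneg`). Testing with `|φ|^p (u+ε)^(1-p)` and applying Picone's
inequality, local and discrete, bounds `lam ∫ g |φ|^p (u/(u+ε))^(p-1)` plus a nonnegative nonlocal
defect by the energy of `φ`. As `ε → 0` the defect blows up at pairs with `u(x) = 0`, `φ(x) ≠ 0`,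
`u(y) > 0`; by Fatou almost no such pairs exist. This is the strong maximum principle; it comes from
the nonlocal term alone and needs no connectedness of `Ω`. Once `u > 0`, the limit `ε → 0` is the
Rayleigh inequality for test functions, and density extends it to the whole space.

The other fact is that the minimum is attained (`Admissible.exists_minimizer`). By Rellich's theorem
a minimizing sequence has a subsequence converging in `L^p`, hence also in the weighted norm;
midpoints then almost satisfy the constraint, and uniform convexity of the energy makes the
gradients Cauchy in `L^p`. No weak topology enters, and the argument works in any closed subspace
(`IsEnergySpace`), so for both versions of the space on `Ω₊`. For continuous `u` it remains to see
that `u⁺` is a limit of test functions supported in the open set `Ω₊`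
(`MemX.posPair_of_continuousOn`).

The lower bound is Hölder's inequality with `g ∈ L^(N/(ps))`, Hölder's inequality on `Ω₊`, and
Sobolev's inequality: `∫ g (u⁺)^p ≤ C ‖g‖ |Ω₊|^((p-ps)/N) ∫ |∇u⁺|^p`, where the last integral is
less than `ν ∫ g (u⁺)^p`. Everything else only uses that `V` and `g` lie in `L^(N/p)`. -/

namespace MixedEigen

/-! ### The p-energy over a general measure -/

section Energy

variable {α F : Type*} [MeasurableSpace α] {μ : Measure α} [NormedAddCommGroup F] {p : ℝ}

/-- The energy `∫ ‖f‖^p`. -/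
noncomputable def pEnergy (p : ℝ) (μ : Measure α) (f : α → F) : ℝ := ∫ x, ‖f x‖ ^ p ∂μ

theorem integrable_norm_rpow_of_memLp (hp : 1 < p) {f : α → F}
    (hf : MemLp f (ENNReal.ofReal p) μ) : Integrable (fun x => ‖f x‖ ^ p) μ := by
  have := hf.integrable_norm_rpow (by simp; linarith) ENNReal.ofReal_ne_top
  rwa [ENNReal.toReal_ofReal (by linarith)] at this

theorem pEnergy_nonneg (f : α → F) : 0 ≤ pEnergy p μ f :=
  integral_nonneg fun _ => by positivity

theorem pEnergy_eq_zero_iff (hp : 1 < p) {f : α → F} (hf : MemLp f (ENNReal.ofReal p) μ) :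
    pEnergy p μ f = 0 ↔ f =ᵐ[μ] 0 := by
  rw [pEnergy, integral_eq_zero_iff_of_nonneg (fun _ => by positivity)
    (integrable_norm_rpow_of_memLp hp hf)]
  refine ⟨fun h => ?_, fun h => ?_⟩ <;> filter_upwards [h] with x hx
  · simpa [Real.rpow_eq_zero (norm_nonneg _) (by linarith : p ≠ 0)] using hx
  · simp [hx, Real.zero_rpow (by linarith : p ≠ 0)]

theorem pEnergy_eq_toReal_rpow (hp : 1 < p) {f : α → F}
    (hf : AEStronglyMeasurable f μ) :
    pEnergy p μ f = (eLpNorm f (ENNReal.ofReal p) μ).toReal ^ p := by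
  rw [pEnergy, integral_eq_lintegral_of_nonneg_ae (.of_forall fun _ => by positivity)
    (hf.norm.aemeasurable.pow_const _).aestronglyMeasurable,
    eLpNorm_eq_lintegral_rpow_enorm_toReal (by simp; linarith) ENNReal.ofReal_ne_top,
    ENNReal.toReal_rpow, ← ENNReal.rpow_mul, ENNReal.toReal_ofReal (by linarith),
    one_div_mul_cancel (by linarith), ENNReal.rpow_one]
  congr 1
  refine lintegral_congr fun x => ?_
  rw [← ENNReal.ofReal_rpow_of_nonneg (norm_nonneg _) (by linarith), ofReal_norm]

theorem lintegral_enorm_rpow_eq (hp : 1 < p) (f : α → F) :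
    ∫⁻ x, ‖f x‖ₑ ^ p ∂μ = eLpNorm f (ENNReal.ofReal p) μ ^ p := by
  rw [eLpNorm_eq_lintegral_rpow_enorm_toReal (by simp; linarith) ENNReal.ofReal_ne_top,
    ← ENNReal.rpow_mul, ENNReal.toReal_ofReal (by linarith),
    one_div_mul_cancel (by linarith), ENNReal.rpow_one]

theorem tendsto_eLpNorm_of_tendsto_sub {ι : Type*} {l : Filter ι} {P : ℝ≥0∞} (hP : 1 ≤ P)
    {f : ι → α → F} {f₀ : α → F} (hf : ∀ i, AEStronglyMeasurable (f i) μ)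
    (hf₀ : MemLp f₀ P μ) (h : Tendsto (fun i => eLpNorm (f i - f₀) P μ) l (𝓝 0)) :
    Tendsto (fun i => eLpNorm (f i) P μ) l (𝓝 (eLpNorm f₀ P μ)) := by
  refine tendsto_of_tendsto_of_tendsto_of_le_of_le
    (g := fun i => eLpNorm f₀ P μ - eLpNorm (f i - f₀) P μ)
    (h := fun i => eLpNorm f₀ P μ + eLpNorm (f i - f₀) P μ) ?_ ?_ (fun i => ?_) (fun i => ?_)
  · simpa using ENNReal.Tendsto.sub (tendsto_const_nhds (x := eLpNorm f₀ P μ)) h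
      (.inl hf₀.eLpNorm_ne_top)
  · simpa using (tendsto_const_nhds (x := eLpNorm f₀ P μ)).add h
  · refine tsub_le_iff_right.2 ?_
    have := eLpNorm_sub_le (hf i) ((hf i).sub hf₀.1) hP (μ := μ)
    simpa using this
  · have := eLpNorm_add_le hf₀.1 ((hf i).sub hf₀.1) hP (μ := μ)
    simpa using this

theorem tendsto_pEnergy (hp : 1 < p) {ι : Type*} {l : Filter ι}
    {f : ι → α → F} {f₀ : α → F} (hf : ∀ i, AEStronglyMeasurable (f i) μ)
    (hf₀ : MemLp f₀ (ENNReal.ofReal p) μ)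
    (h : Tendsto (fun i => eLpNorm (f i - f₀) (ENNReal.ofReal p) μ) l (𝓝 0)) :
    Tendsto (fun i => pEnergy p μ (f i)) l (𝓝 (pEnergy p μ f₀)) := by
  have hP : 1 ≤ ENNReal.ofReal p := by simpa using hp.le
  simp only [pEnergy_eq_toReal_rpow hp (hf _), pEnergy_eq_toReal_rpow hp hf₀.1]
  refine Tendsto.rpow_const ?_ (.inr (by linarith))
  exact (ENNReal.tendsto_toReal hf₀.eLpNorm_ne_top).comp
    (tendsto_eLpNorm_of_tendsto_sub hP hf hf₀ h)

end Energy

/-! ### The p-form, derivative of the p-energy -/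

section PForm

variable {α F : Type*} [MeasurableSpace α] {μ : Measure α} [NormedAddCommGroup F]
  [InnerProductSpace ℝ F] {p : ℝ}

/-- The form `∫ ‖f‖^(p-2) ⟨f, h⟩`. -/
noncomputable def pForm (p : ℝ) (μ : Measure α) (f h : α → F) : ℝ :=
  ∫ x, ‖f x‖ ^ (p - 2) * inner ℝ (f x) (h x) ∂μ

theorem norm_rpow_mul_inner_self (hp : 1 < p) (a : F) :
    ‖a‖ ^ (p - 2) * inner ℝ a a = ‖a‖ ^ p := by
  rcases eq_or_ne a 0 with rfl | ha
  · simp [Real.zero_rpow (by linarith : p ≠ 0)]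
  · have : 0 < ‖a‖ := norm_pos_iff.2 ha
    rw [real_inner_self_eq_norm_sq, ← Real.rpow_natCast, ← Real.rpow_add this]
    congr 1; push_cast; ring

/-- Cauchy–Schwarz. The point `a = 0` is separate because `p - 2` may be negative or zero. -/
theorem abs_norm_rpow_mul_inner_le (hp : 1 < p) (a b : F) :
    |‖a‖ ^ (p - 2) * inner ℝ a b| ≤ ‖a‖ ^ (p - 1) * ‖b‖ := by
  rcases eq_or_ne a 0 with rfl | ha
  · simp [Real.zero_rpow (by linarith : p - 1 ≠ 0)]
  · have : 0 < ‖a‖ := norm_pos_iff.2 ha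
    rw [abs_mul, abs_of_nonneg (by positivity)]
    calc _ ≤ ‖a‖ ^ (p - 2) * (‖a‖ * ‖b‖) := by gcongr; exact abs_real_inner_le_norm a b
      _ = ‖a‖ ^ (p - 1) * ‖b‖ := by
        rw [← mul_assoc]; congr 1
        nth_rewrite 2 [← Real.rpow_one ‖a‖]
        rw [← Real.rpow_add this]; congr 1; ring

/-- A crude Young inequality, replacing both factors by the larger one. It makes the forms
integrable. -/
theorem rpow_sub_one_mul_le (hp : 1 < p) {a b : ℝ} (ha : 0 ≤ a) (hb : 0 ≤ b) :
    a ^ (p - 1) * b ≤ a ^ p + b ^ p := by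
  have key : ∀ c : ℝ, 0 ≤ c → c ^ (p - 1) * c = c ^ p := fun c hc => by
    rw [← Real.rpow_add_one' hc (by linarith)]; congr 1; ring
  rcases le_total a b with h | h
  · calc _ ≤ b ^ (p - 1) * b := by gcongr
      _ = b ^ p := key b hb
      _ ≤ _ := by have := Real.rpow_nonneg ha p; linarith
  · calc _ ≤ a ^ (p - 1) * a := by gcongr
      _ = a ^ p := key a ha
      _ ≤ _ := by have := Real.rpow_nonneg hb p; linarith

theorem aestronglyMeasurable_pForm {f h : α → F}
    (hf : AEStronglyMeasurable f μ) (hh : AEStronglyMeasurable h μ) :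
    AEStronglyMeasurable (fun x => ‖f x‖ ^ (p - 2) * inner ℝ (f x) (h x)) μ :=
  (hf.norm.aemeasurable.pow_const _).aestronglyMeasurable.mul (hf.inner hh)

theorem integrable_pForm (hp : 1 < p) {f h : α → F} (hf : MemLp f (ENNReal.ofReal p) μ)
    (hh : MemLp h (ENNReal.ofReal p) μ) :
    Integrable (fun x => ‖f x‖ ^ (p - 2) * inner ℝ (f x) (h x)) μ := by
  refine ((integrable_norm_rpow_of_memLp hp hf).add
    (integrable_norm_rpow_of_memLp hp hh)).mono'
    (aestronglyMeasurable_pForm hf.1 hh.1) (.of_forall fun x => ?_)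
  exact (abs_norm_rpow_mul_inner_le hp _ _).trans
    (rpow_sub_one_mul_le hp (norm_nonneg _) (norm_nonneg _))

theorem pForm_self (hp : 1 < p) (f : α → F) : pForm p μ f f = pEnergy p μ f := by
  simp only [pForm, pEnergy, norm_rpow_mul_inner_self hp]

theorem pEnergy_smul (c : ℝ) (f : α → F) : pEnergy p μ (c • f) = |c| ^ p * pEnergy p μ f := by
  simp only [pEnergy, Pi.smul_apply, norm_smul, Real.norm_eq_abs]
  rw [← integral_const_mul]
  congr 1; ext x; rw [Real.mul_rpow (abs_nonneg _) (norm_nonneg _)]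

/-- Differentiation under the integral. For `|t| < 1` the derivative of the integrand is dominated
by `p ((‖f‖ + ‖h‖)^p + ‖h‖^p)`. This is what turns a minimizer into a solution of the weak equation.
-/
theorem hasDerivAt_pEnergy (hp : 1 < p) {f h : α → F} (hf : MemLp f (ENNReal.ofReal p) μ)
    (hh : MemLp h (ENNReal.ofReal p) μ) :
    HasDerivAt (fun t : ℝ => pEnergy p μ (f + t • h)) (p * pForm p μ f h) 0 := by
  have hd : ∀ (a b : F) (t : ℝ), HasDerivAt (fun t : ℝ => ‖a + t • b‖ ^ p)
      (p * (‖a + t • b‖ ^ (p - 2) * inner ℝ (a + t • b) b)) t := fun a b t => by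
    have h1 : HasDerivAt (fun t : ℝ => a + t • b) b t := by
      simpa using ((hasDerivAt_id t).smul_const b).const_add a
    have := (hasFDerivAt_norm_rpow (a + t • b) hp).comp_hasDerivAt t h1
    exact this.congr_deriv (mul_assoc _ _ _)
  have hF := hasDerivAt_integral_of_dominated_loc_of_deriv_le (μ := μ) (𝕜 := ℝ) (x₀ := 0)
    (s := Metric.ball 0 1) (F := fun t x => ‖f x + t • h x‖ ^ p)
    (F' := fun t x => p * (‖f x + t • h x‖ ^ (p - 2) * inner ℝ (f x + t • h x) (h x)))
    (bound := fun x => p * (‖‖f x‖ + ‖h x‖‖ ^ p + ‖h x‖ ^ p)) (Metric.ball_mem_nhds _ one_pos)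
    (.of_forall fun t => ((hf.1.add (hh.1.const_smul t)).norm.aemeasurable.pow_const
      _).aestronglyMeasurable)
    (by simpa using integrable_norm_rpow_of_memLp hp hf) ?_ ?_ ?_ ?_
  · refine hF.2.congr_deriv ?_
    rw [integral_const_mul]; simp [pForm]
  · exact (aestronglyMeasurable_pForm (hf.1.add (hh.1.const_smul (0:ℝ))) hh.1).const_mul _
  · refine .of_forall fun x t ht => ?_
    rw [norm_mul, Real.norm_eq_abs p, abs_of_pos (by linarith)]
    gcongr
    refine (abs_norm_rpow_mul_inner_le hp _ _).trans
      ((rpow_sub_one_mul_le hp (norm_nonneg _) (norm_nonneg _)).trans ?_)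
    gcongr
    rw [Real.norm_eq_abs, abs_of_nonneg (by positivity)]
    refine (norm_add_le _ _).trans ?_
    gcongr
    rw [norm_smul]
    have : ‖t‖ ≤ 1 := by simpa using (mem_ball_zero_iff.1 ht).le
    nlinarith [norm_nonneg (h x)]
  · refine Integrable.const_mul (.add ?_ (integrable_norm_rpow_of_memLp hp hh)) _
    exact integrable_norm_rpow_of_memLp hp (hf.norm.add hh.norm)
  · exact .of_forall fun x t _ => hd _ _ _

end PForm

/-! ### Uniform convexity of the p-energy -/

section UniformConvexity

variable {F : Type*} [NormedAddCommGroup F] [InnerProductSpace ℝ F] {p : ℝ}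

theorem half_add_norm_rpow_le (hp : 1 < p) (a b : F) :
    ‖(1 / 2 : ℝ) • (a + b)‖ ^ p ≤ (‖a‖ ^ p + ‖b‖ ^ p) / 2 := by
  have h1 : ‖(1 / 2 : ℝ) • (a + b)‖ ≤ (1 / 2) * ‖a‖ + (1 / 2) * ‖b‖ := by
    rw [norm_smul, ← mul_add]; norm_num; exact norm_add_le _ _
  have h2 := (convexOn_rpow hp.le).2 (norm_nonneg a) (norm_nonneg b)
    (by norm_num : (0:ℝ) ≤ 1 / 2) (by norm_num : (0:ℝ) ≤ 1 / 2) (by norm_num)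
  simp only [smul_eq_mul] at h2
  calc _ ≤ ((1 / 2) * ‖a‖ + (1 / 2) * ‖b‖) ^ p := by gcongr
    _ ≤ _ := by linarith

/-- Strict convexity of `r ↦ r^p` forces equal norms, and then equality in the triangle inequality
forces equal vectors, since inner product spaces are strictly convex. -/
theorem eq_of_half_add_norm_rpow_eq (hp : 1 < p) {a b : F}
    (h : ‖(1 / 2 : ℝ) • (a + b)‖ ^ p = (‖a‖ ^ p + ‖b‖ ^ p) / 2) : a = b := by
  have h1 : ‖(1 / 2 : ℝ) • (a + b)‖ ≤ (1 / 2) * ‖a‖ + (1 / 2) * ‖b‖ := by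
    rw [norm_smul, ← mul_add]; norm_num; exact norm_add_le _ _
  have hab : ‖a‖ = ‖b‖ := by
    by_contra hne
    have h2 := (strictConvexOn_rpow hp).2 (norm_nonneg a) (norm_nonneg b) hne
      (by norm_num : (0:ℝ) < 1 / 2) (by norm_num : (0:ℝ) < 1 / 2) (by norm_num)
    simp only [smul_eq_mul] at h2
    have h3 : ‖(1 / 2 : ℝ) • (a + b)‖ ^ p ≤ ((1 / 2) * ‖a‖ + (1 / 2) * ‖b‖) ^ p := by gcongr
    linarith
  refine eq_of_norm_eq_of_norm_add_eq hab ?_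
  rw [hab, add_self_div_two] at h
  have h4 := (Real.rpow_left_inj (norm_nonneg _) (norm_nonneg _) (by linarith)).1 h
  rw [norm_smul] at h4
  norm_num at h4
  rw [hab]; linarith

/-- A substitute for Clarkson's inequalities that treats all `p > 1` alike. By homogeneity one may
assume `‖a‖^p + ‖b‖^p = 1`. On the part of this set where `‖a-b‖^p ≥ δ`, which is compact, the
convexity defect is continuous and positive, hence bounded below. -/
theorem exists_norm_sub_rpow_le [FiniteDimensional ℝ F] (hp : 1 < p) {δ : ℝ} (hδ : 0 < δ) :
    ∃ C : ℝ, 0 < C ∧ ∀ a b : F, ‖a - b‖ ^ p ≤ δ * (‖a‖ ^ p + ‖b‖ ^ p)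
      + C * ((‖a‖ ^ p + ‖b‖ ^ p) / 2 - ‖(1 / 2 : ℝ) • (a + b)‖ ^ p) := by
  have hp0 : 0 < p := by linarith
  have : ProperSpace F := FiniteDimensional.proper ℝ F
  set D : F × F → ℝ := fun z => (‖z.1‖ ^ p + ‖z.2‖ ^ p) / 2 - ‖(1 / 2 : ℝ) • (z.1 + z.2)‖ ^ p
    with hD
  have hcn : ∀ {f : F × F → F}, Continuous f → Continuous fun z => ‖f z‖ ^ p := fun hf =>
    hf.norm.rpow_const fun _ => .inr hp0.le
  have hDc : Continuous D := (((hcn continuous_fst).add (hcn continuous_snd)).div_const _).sub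
    (hcn ((continuous_fst.add continuous_snd).const_smul _))
  set K : Set (F × F) := {z | ‖z.1‖ ^ p + ‖z.2‖ ^ p = 1} ∩ {z | δ ≤ ‖z.1 - z.2‖ ^ p}
  have hKn : ∀ z : F × F, ‖z.1‖ ^ p + ‖z.2‖ ^ p = 1 → ‖z.1‖ ≤ 1 ∧ ‖z.2‖ ≤ 1 := fun z hz => by
    have h1 := Real.rpow_nonneg (norm_nonneg z.1) p
    have h2 := Real.rpow_nonneg (norm_nonneg z.2) p
    constructor <;> by_contra! hlt <;> linarith [Real.one_lt_rpow hlt hp0]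
  have hK : IsCompact K := by
    refine Metric.isCompact_of_isClosed_isBounded ?_ ?_
    · exact (isClosed_eq ((hcn continuous_fst).add (hcn continuous_snd)) continuous_const).inter
        (isClosed_le continuous_const (hcn (continuous_fst.sub continuous_snd)))
    · refine (Metric.isBounded_closedBall (x := (0 : F × F)) (r := 1)).subset fun z hz => ?_
      rw [mem_closedBall_zero_iff, Prod.norm_def]
      exact max_le (hKn z hz.1).1 (hKn z hz.1).2
  obtain ⟨m, hm, hmK⟩ : ∃ m : ℝ, 0 < m ∧ ∀ z ∈ K, m ≤ D z := by
    rcases K.eq_empty_or_nonempty with h | h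
    · exact ⟨1, one_pos, by simp [h]⟩
    · obtain ⟨z, hz, hmin⟩ := hK.exists_isMinOn h hDc.continuousOn
      refine ⟨D z, ?_, fun y hy => hmin hy⟩
      refine lt_of_le_of_ne (sub_nonneg.2 (half_add_norm_rpow_le hp _ _)) fun h0 => ?_
      have := eq_of_half_add_norm_rpow_eq hp (sub_eq_zero.1 h0.symm).symm
      have h2 := hz.2
      simp only [Set.mem_ofPred_eq, this, sub_self, norm_zero, Real.zero_rpow hp0.ne'] at h2
      linarith
  -- On `K` the left side is at most `2^p` and the defect at least `m`; off `K` the term with `δ`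
  -- suffices.
  refine ⟨2 ^ p / m, by positivity, fun a b => ?_⟩
  have hD0 : ∀ z, 0 ≤ D z := fun z => sub_nonneg.2 (half_add_norm_rpow_le hp _ _)
  have main : ∀ z : F × F, ‖z.1‖ ^ p + ‖z.2‖ ^ p = 1 → ‖z.1 - z.2‖ ^ p ≤ δ + 2 ^ p / m * D z := by
    intro z hz
    rcases le_total δ (‖z.1 - z.2‖ ^ p) with h | h
    · have h1 : ‖z.1 - z.2‖ ≤ 2 := (norm_sub_le _ _).trans (by linarith [(hKn z hz).1, (hKn z hz).2])
      have h2 : ‖z.1 - z.2‖ ^ p ≤ 2 ^ p := by gcongr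
      have h3 : (2:ℝ) ^ p ≤ 2 ^ p / m * D z := by
        rw [div_mul_eq_mul_div, le_div_iff₀ hm]; gcongr; exact hmK z ⟨hz, h⟩
      linarith
    · have : 0 ≤ 2 ^ p / m * D z := mul_nonneg (by positivity) (hD0 z)
      linarith
  set n := ‖a‖ ^ p + ‖b‖ ^ p with hn
  have hn0 : 0 ≤ n := by positivity
  rcases hn0.eq_or_lt with h0 | hpos
  · have h1 := Real.rpow_nonneg (norm_nonneg a) p
    have h2 := Real.rpow_nonneg (norm_nonneg b) p
    have ha : ‖a‖ = 0 := (Real.rpow_eq_zero (norm_nonneg _) hp0.ne').1 (by linarith)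
    have hb : ‖b‖ = 0 := (Real.rpow_eq_zero (norm_nonneg _) hp0.ne').1 (by linarith)
    rw [norm_eq_zero] at ha hb
    simp [hn, ha, hb, Real.zero_rpow hp0.ne']
  -- The scaling that reduces a nonzero pair to the normalized case.
  · set r := n ^ (-(1 / p)) with hr
    have hr0 : 0 < r := by positivity
    have hrp : r ^ p = n⁻¹ := by
      rw [hr, ← Real.rpow_mul hn0, neg_mul, one_div_mul_cancel hp0.ne', Real.rpow_neg_one]
    have hsc : ∀ x : F, ‖r • x‖ ^ p = n⁻¹ * ‖x‖ ^ p := fun x => by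
      rw [norm_smul, Real.mul_rpow (norm_nonneg _) (norm_nonneg _), Real.norm_eq_abs,
        abs_of_pos hr0, hrp]
    have := main (r • a, r • b) (by
      simp only [hsc]; rw [← mul_add, ← hn, inv_mul_cancel₀ hpos.ne'])
    simp only [hD, ← smul_sub, ← smul_add, smul_comm (1 / 2 : ℝ) r, hsc] at this
    rw [← mul_add, ← hn] at this
    have h5 := mul_le_mul_of_nonneg_left this hn0
    rw [mul_inv_cancel_left₀ hpos.ne'] at h5
    refine h5.trans (le_of_eq ?_)
    field_simp

/-- The pointwise inequality integrated. The constant does not depend on the measure, so the same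
one serves different terms of the operator energy. -/
theorem exists_pEnergy_sub_le [FiniteDimensional ℝ F] (hp : 1 < p) {δ : ℝ} (hδ : 0 < δ) :
    ∃ C : ℝ, 0 < C ∧ ∀ {α : Type} [MeasurableSpace α] (μ : Measure α) (f h : α → F),
      MemLp f (ENNReal.ofReal p) μ → MemLp h (ENNReal.ofReal p) μ →
      pEnergy p μ (f - h) ≤ δ * (pEnergy p μ f + pEnergy p μ h)
        + C * ((pEnergy p μ f + pEnergy p μ h) / 2 - pEnergy p μ ((1 / 2 : ℝ) • (f + h))) := by
  obtain ⟨C, hC, hm⟩ := exists_norm_sub_rpow_le (F := F) hp hδ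
  refine ⟨C, hC, fun μ f h hf hh => ?_⟩
  have i1 := integrable_norm_rpow_of_memLp hp hf
  have i2 := integrable_norm_rpow_of_memLp hp hh
  have i3 := integrable_norm_rpow_of_memLp hp (hf.sub hh)
  have i4 := integrable_norm_rpow_of_memLp hp ((hf.add hh).const_smul (1 / 2 : ℝ))
  simp only [pEnergy]
  have j1 := (i1.add i2).const_mul δ
  have j2 := (((i1.add i2).div_const 2).sub i4).const_mul C
  refine (integral_mono i3 (j1.add j2) fun x => hm (f x) (h x)).trans (le_of_eq ?_)
  rw [integral_add' j1 j2, integral_const_mul, integral_const_mul,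
    integral_sub' ((i1.add i2).div_const 2) i4, integral_div, integral_add' i1 i2]

theorem pEnergy_half_add_le {α : Type*} [MeasurableSpace α] {μ : Measure α} (hp : 1 < p)
    {f h : α → F} (hf : MemLp f (ENNReal.ofReal p) μ) (hh : MemLp h (ENNReal.ofReal p) μ) :
    pEnergy p μ ((1 / 2 : ℝ) • (f + h)) ≤ (pEnergy p μ f + pEnergy p μ h) / 2 := by
  have i1 := integrable_norm_rpow_of_memLp hp hf
  have i2 := integrable_norm_rpow_of_memLp hp hh
  have i4 := integrable_norm_rpow_of_memLp hp ((hf.add hh).const_smul (1 / 2 : ℝ))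
  simp only [pEnergy]
  rw [← integral_add i1 i2, ← integral_div]
  exact integral_mono i4 ((i1.add i2).div_const _) fun x => half_add_norm_rpow_le hp _ _

end UniformConvexity

end MixedEigen

namespace MixedEigen

/-! ### Passing to the limit in `L^p` -/

section Convergence

variable {α F : Type*} [MeasurableSpace α] {μ : Measure α} [NormedAddCommGroup F] {p : ℝ}

theorem tendsto_eLpNorm_zero_of_dominated (hp : 1 < p) {H : ℕ → α → F} {b : α → ℝ}
    (hH : ∀ n, AEStronglyMeasurable (H n) μ) (hb : MemLp b (ENNReal.ofReal p) μ)
    (hle : ∀ n, ∀ᵐ x ∂μ, ‖H n x‖ ≤ b x)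
    (hlim : ∀ᵐ x ∂μ, Tendsto (fun n => H n x) atTop (𝓝 0)) :
    Tendsto (fun n => eLpNorm (H n) (ENNReal.ofReal p) μ) atTop (𝓝 0) := by
  have hp0 : 0 < p := by linarith
  have h1 : Tendsto (fun n => ∫⁻ x, ‖H n x‖ₑ ^ p ∂μ) atTop (𝓝 (∫⁻ _, 0 ∂μ)) := by
    refine tendsto_lintegral_of_dominated_convergence' (fun x => ‖b x‖ₑ ^ p)
      (fun n => (hH n).enorm.pow_const _) (fun n => ?_) ?_ ?_
    · filter_upwards [hle n] with x hx
      gcongr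
      exact enorm_le_iff_norm_le.2 (hx.trans (le_abs_self _))
    · rw [lintegral_enorm_rpow_eq hp]
      exact ENNReal.rpow_ne_top_of_nonneg hp0.le hb.eLpNorm_ne_top
    · filter_upwards [hlim] with x hx
      have := (hx.enorm).ennrpow_const p
      simpa [hp0] using this
  have h2 : ∀ n, ∫⁻ x, ‖H n x‖ₑ ^ p ∂μ = eLpNorm (H n) (ENNReal.ofReal p) μ ^ p := fun n =>
    lintegral_enorm_rpow_eq hp _
  simp only [h2, lintegral_zero] at h1
  have := h1.ennrpow_const p⁻¹
  simpa [← ENNReal.rpow_mul, hp0.ne', hp0] using this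

theorem exists_seq_tendsto_ae_of_eLpNorm (hp : 1 < p) {f : ℕ → α → F} {g : α → F}
    (hf : ∀ n, AEStronglyMeasurable (f n) μ) (hg : AEStronglyMeasurable g μ)
    (h : Tendsto (fun n => eLpNorm (f n - g) (ENNReal.ofReal p) μ) atTop (𝓝 0)) :
    ∃ ns : ℕ → ℕ, StrictMono ns ∧
      ∀ᵐ x ∂μ, Tendsto (fun i => f (ns i) x) atTop (𝓝 (g x)) :=
  (tendstoInMeasure_of_tendsto_eLpNorm (by simp; linarith) hf hg h).exists_seq_tendsto_ae

end Convergence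

/-! ### Gradients and `C^1` functions with compact support -/

section Gradient

variable {N : ℕ}

theorem gradient_comp {φ : RN N → ℝ} {F : ℝ → ℝ} {c : ℝ} {x : RN N}
    (hF : HasDerivAt F c (φ x)) (hφ : DifferentiableAt ℝ φ x) :
    gradient (fun y => F (φ y)) x = c • gradient φ x := by
  refine HasGradientAt.gradient ?_
  rw [hasGradientAt_iff_hasFDerivAt, map_smul]
  exact hF.comp_hasFDerivAt x (hasGradientAt_iff_hasFDerivAt.1 hφ.hasGradientAt)

theorem gradient_mul' {φ ψ : RN N → ℝ} {x : RN N}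
    (hφ : DifferentiableAt ℝ φ x) (hψ : DifferentiableAt ℝ ψ x) :
    gradient (fun y => φ y * ψ y) x = φ x • gradient ψ x + ψ x • gradient φ x := by
  refine HasGradientAt.gradient ?_
  rw [hasGradientAt_iff_hasFDerivAt, map_add, map_smul, map_smul]
  exact (hasGradientAt_iff_hasFDerivAt.1 hφ.hasGradientAt).mul
    (hasGradientAt_iff_hasFDerivAt.1 hψ.hasGradientAt)

theorem gradient_add' {φ ψ : RN N → ℝ} {x : RN N}
    (hφ : DifferentiableAt ℝ φ x) (hψ : DifferentiableAt ℝ ψ x) :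
    gradient (φ + ψ) x = gradient φ x + gradient ψ x := by
  refine HasGradientAt.gradient ?_
  rw [hasGradientAt_iff_hasFDerivAt, map_add]
  exact (hasGradientAt_iff_hasFDerivAt.1 hφ.hasGradientAt).add
    (hasGradientAt_iff_hasFDerivAt.1 hψ.hasGradientAt)

theorem gradient_const_smul' {φ : RN N → ℝ} {x : RN N} (c : ℝ)
    (hφ : DifferentiableAt ℝ φ x) :
    gradient (c • φ) x = c • gradient φ x := by
  refine HasGradientAt.gradient ?_
  rw [hasGradientAt_iff_hasFDerivAt, map_smul]
  exact (hasGradientAt_iff_hasFDerivAt.1 hφ.hasGradientAt).const_smul c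

theorem inner_gradient_eq (φ : RN N → ℝ) (x e : RN N) :
    inner ℝ (gradient φ x) e = fderiv ℝ φ x e := by
  simp [gradient]

theorem norm_gradient_eq (φ : RN N → ℝ) (x : RN N) : ‖gradient φ x‖ = ‖fderiv ℝ φ x‖ := by
  simp [gradient]

theorem norm_gradient_sub_eq (φ ψ : RN N → ℝ) (x y : RN N) :
    ‖gradient φ x - gradient ψ y‖ = ‖fderiv ℝ φ x - fderiv ℝ ψ y‖ := by
  simp only [gradient, ← map_sub, LinearIsometryEquiv.norm_map]

/-- `φ ∈ C_c^1(U)`, extended by zero. -/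
structure IsC1c (U : Set (RN N)) (φ : RN N → ℝ) : Prop where
  smooth : ContDiff ℝ 1 φ
  compact : HasCompactSupport φ
  support_subset : tsupport φ ⊆ U

theorem IsTestFunction.isC1c {U : Set (RN N)} {φ : RN N → ℝ} (h : IsTestFunction U φ) :
    IsC1c U φ := ⟨h.smooth.of_le (by exact_mod_cast le_top), h.compact, h.support_subset⟩

theorem gradient_eq_zero_of_notMem_tsupport {φ : RN N → ℝ} {x : RN N} (hx : x ∉ tsupport φ) :
    gradient φ x = 0 := by
  rw [← norm_eq_zero, norm_gradient_eq, fderiv_of_notMem_tsupport ℝ hx, norm_zero]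

namespace IsC1c

variable {U : Set (RN N)} {φ : RN N → ℝ}

theorem differentiable (h : IsC1c U φ) : Differentiable ℝ φ := h.smooth.differentiable one_ne_zero

theorem continuous_gradient (h : IsC1c U φ) : Continuous (gradient φ) :=
  (InnerProductSpace.toDual ℝ (RN N)).symm.continuous.comp
    (h.smooth.continuous_fderiv one_ne_zero)

theorem compact_gradient (h : IsC1c U φ) : HasCompactSupport (gradient φ) :=
  HasCompactSupport.intro h.compact fun _ hx => gradient_eq_zero_of_notMem_tsupport hx

theorem memLp (h : IsC1c U φ) (P : ℝ≥0∞) (μ : Measure (RN N)) [IsFiniteMeasureOnCompacts μ] :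
    MemLp φ P μ :=
  h.smooth.continuous.memLp_of_hasCompactSupport h.compact

theorem memLp_gradient (h : IsC1c U φ) (P : ℝ≥0∞) (μ : Measure (RN N))
    [IsFiniteMeasureOnCompacts μ] : MemLp (gradient φ) P μ :=
  h.continuous_gradient.memLp_of_hasCompactSupport h.compact_gradient

theorem aesm (h : IsC1c U φ) : AEStronglyMeasurable φ volume :=
  h.smooth.continuous.aestronglyMeasurable

theorem aesm_gradient (h : IsC1c U φ) : AEStronglyMeasurable (gradient φ) volume :=
  h.continuous_gradient.aestronglyMeasurable

theorem comp (h : IsC1c U φ) {F f : ℝ → ℝ} (hF : ∀ t, HasDerivAt F (f t) t)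
    (hf : Continuous f) (h0 : F 0 = 0) : IsC1c U fun x => F (φ x) where
  smooth := by
    have : ContDiff ℝ 1 F := contDiff_one_iff_deriv.2
      ⟨fun t => (hF t).differentiableAt, by rwa [funext fun t => (hF t).deriv]⟩
    exact this.comp h.smooth
  compact := h.compact.comp_left h0
  support_subset := (closure_mono (Function.support_comp_subset h0 φ)).trans h.support_subset

theorem mul {A : Set (RN N)} {θ : RN N → ℝ} (hθ : IsC1c A θ) (hφ : ContDiff ℝ 1 φ) :
    IsC1c A fun x => θ x * φ x where
  smooth := hθ.smooth.mul hφ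
  compact := hθ.compact.mul_right
  support_subset := (tsupport_mul_subset_left).trans hθ.support_subset

end IsC1c

end Gradient

/-! ### The closure of the test functions in `W^{1,p}(ℝ^N)` -/

section MemX

variable {N : ℕ} {Ω : Set (RN N)} {p : ℝ}

/-- The closure of `C_c^∞(Ω)` in `W^{1,p}(ℝ^N)`, as pairs of a function and its gradient. -/
structure MemX (Ω : Set (RN N)) (p : ℝ) (w : (RN N → ℝ) × (RN N → RN N)) : Prop where
  memLp : MemLp w.1 (ENNReal.ofReal p) volume
  memLp_grad : MemLp w.2 (ENNReal.ofReal p) volume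
  approx : ∀ ε : ℝ≥0∞, ε ≠ 0 → ∃ φ, IsTestFunction Ω φ ∧
    eLpNorm (φ - w.1) (ENNReal.ofReal p) volume ≤ ε ∧
    eLpNorm (gradient φ - w.2) (ENNReal.ofReal p) volume ≤ ε

/-- The closure is closed. Only measurability of the limit is assumed; its integrability follows
from one approximant at distance at most one. -/
theorem MemX.of_approx (hp : 1 < p) {w : (RN N → ℝ) × (RN N → RN N)}
    (h1 : AEStronglyMeasurable w.1 volume) (h2 : AEStronglyMeasurable w.2 volume)
    (h : ∀ ε : ℝ≥0∞, ε ≠ 0 → ∃ w', MemX Ω p w' ∧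
      eLpNorm (w'.1 - w.1) (ENNReal.ofReal p) volume ≤ ε ∧
      eLpNorm (w'.2 - w.2) (ENNReal.ofReal p) volume ≤ ε) : MemX Ω p w := by
  have hP : 1 ≤ ENNReal.ofReal p := by simpa using hp.le
  obtain ⟨w', hw', e1, e2⟩ := h 1 one_ne_zero
  refine ⟨?_, ?_, fun ε hε => ?_⟩
  · have : MemLp (w'.1 - w.1) (ENNReal.ofReal p) volume :=
      ⟨hw'.memLp.1.sub h1, e1.trans_lt ENNReal.one_lt_top⟩
    simpa using hw'.memLp.sub this
  · have : MemLp (w'.2 - w.2) (ENNReal.ofReal p) volume :=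
      ⟨hw'.memLp_grad.1.sub h2, e2.trans_lt ENNReal.one_lt_top⟩
    simpa using hw'.memLp_grad.sub this
  · have hε2 : ε / 2 ≠ 0 := by simpa using hε
    obtain ⟨w', hw', e1, e2⟩ := h (ε / 2) hε2
    obtain ⟨φ, hφ, d1, d2⟩ := hw'.approx (ε / 2) hε2
    refine ⟨φ, hφ, ?_, ?_⟩
    · rw [← sub_add_sub_cancel φ w'.1, ← ENNReal.add_halves ε]
      exact (eLpNorm_add_le (hφ.isC1c.aesm.sub hw'.memLp.1) (hw'.memLp.1.sub h1) hP).trans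
        (add_le_add d1 e1)
    · rw [← sub_add_sub_cancel (gradient φ) w'.2, ← ENNReal.add_halves ε]
      exact (eLpNorm_add_le (hφ.isC1c.aesm_gradient.sub hw'.memLp_grad.1)
        (hw'.memLp_grad.1.sub h2) hP).trans (add_le_add d2 e2)

theorem MemX.of_tendsto (hp : 1 < p) {w : (RN N → ℝ) × (RN N → RN N)}
    {w' : ℕ → (RN N → ℝ) × (RN N → RN N)} (hw' : ∀ n, MemX Ω p (w' n))
    (h1 : AEStronglyMeasurable w.1 volume) (h2 : AEStronglyMeasurable w.2 volume)
    (e1 : Tendsto (fun n => eLpNorm ((w' n).1 - w.1) (ENNReal.ofReal p) volume) atTop (𝓝 0))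
    (e2 : Tendsto (fun n => eLpNorm ((w' n).2 - w.2) (ENNReal.ofReal p) volume) atTop (𝓝 0)) :
    MemX Ω p w := by
  refine .of_approx hp h1 h2 fun ε hε => ?_
  have hε' : 0 < ε := pos_iff_ne_zero.2 hε
  obtain ⟨n, hn1, hn2⟩ := ((e1.eventually_le_const hε').and (e2.eventually_le_const hε')).exists
  exact ⟨w' n, hw' n, hn1, hn2⟩

/-- Approximation by test functions, in norm and almost everywhere. -/
theorem MemX.exists_seq (hp : 1 < p) {w : (RN N → ℝ) × (RN N → RN N)} (hw : MemX Ω p w) :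
    ∃ φ : ℕ → RN N → ℝ, (∀ n, IsTestFunction Ω (φ n)) ∧
      Tendsto (fun n => eLpNorm (φ n - w.1) (ENNReal.ofReal p) volume) atTop (𝓝 0) ∧
      Tendsto (fun n => eLpNorm (gradient (φ n) - w.2) (ENNReal.ofReal p) volume) atTop (𝓝 0) ∧
      ∀ᵐ x, Tendsto (fun n => φ n x) atTop (𝓝 (w.1 x)) := by
  have := fun n : ℕ => hw.approx (n : ℝ≥0∞)⁻¹ (by simp)
  choose φ hφ d1 d2 using this
  have t1 : Tendsto (fun n => eLpNorm (φ n - w.1) (ENNReal.ofReal p) volume) atTop (𝓝 0) :=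
    tendsto_of_tendsto_of_tendsto_of_le_of_le tendsto_const_nhds
      ENNReal.tendsto_inv_nat_nhds_zero (fun _ => zero_le) d1
  have t2 : Tendsto (fun n => eLpNorm (gradient (φ n) - w.2) (ENNReal.ofReal p) volume)
      atTop (𝓝 0) :=
    tendsto_of_tendsto_of_tendsto_of_le_of_le tendsto_const_nhds
      ENNReal.tendsto_inv_nat_nhds_zero (fun _ => zero_le) d2
  obtain ⟨ns, hns, hae⟩ := exists_seq_tendsto_ae_of_eLpNorm hp
    (fun n => (hφ n).isC1c.aesm) hw.memLp.1 t1
  exact ⟨fun n => φ (ns n), fun n => hφ _, t1.comp hns.tendsto_atTop,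
    t2.comp hns.tendsto_atTop, hae⟩

theorem IsTestFunction.memX (φ : RN N → ℝ) (hφ : IsTestFunction Ω φ) :
    MemX Ω p (φ, gradient φ) :=
  ⟨hφ.isC1c.memLp _ _, hφ.isC1c.memLp_gradient _ _, fun ε _ => ⟨φ, hφ, by simp, by simp⟩⟩

theorem IsTestFunction.add {φ ψ : RN N → ℝ} (hφ : IsTestFunction Ω φ) (hψ : IsTestFunction Ω ψ) :
    IsTestFunction Ω (φ + ψ) where
  smooth := hφ.smooth.add hψ.smooth
  compact := hφ.compact.add hψ.compact
  support_subset := (tsupport_add φ ψ).trans (Set.union_subset hφ.support_subset hψ.support_subset)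

theorem IsTestFunction.const_smul {φ : RN N → ℝ} (hφ : IsTestFunction Ω φ) (c : ℝ) :
    IsTestFunction Ω (c • φ) where
  smooth := hφ.smooth.const_smul c
  compact := hφ.compact.smul_left (f := fun _ => c)
  support_subset := (tsupport_smul_subset_right (fun _ => c) φ).trans hφ.support_subset

theorem MemX.add (hp : 1 < p) {w z : (RN N → ℝ) × (RN N → RN N)} (hw : MemX Ω p w)
    (hz : MemX Ω p z) : MemX Ω p (w + z) := by
  have hP : 1 ≤ ENNReal.ofReal p := by simpa using hp.le
  refine ⟨hw.memLp.add hz.memLp, hw.memLp_grad.add hz.memLp_grad, fun ε hε => ?_⟩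
  have hε2 : ε / 2 ≠ 0 := by simpa using hε
  obtain ⟨φ, hφ, d1, d2⟩ := hw.approx (ε / 2) hε2
  obtain ⟨ψ, hψ, e1, e2⟩ := hz.approx (ε / 2) hε2
  refine ⟨φ + ψ, hφ.add hψ, ?_, ?_⟩
  · rw [Prod.fst_add, add_sub_add_comm, ← ENNReal.add_halves ε]
    exact (eLpNorm_add_le (hφ.isC1c.aesm.sub hw.memLp.1)
      (hψ.isC1c.aesm.sub hz.memLp.1) hP).trans (add_le_add d1 e1)
  · have : gradient (φ + ψ) = gradient φ + gradient ψ :=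
      funext fun x => gradient_add' (hφ.isC1c.differentiable x) (hψ.isC1c.differentiable x)
    rw [this, Prod.snd_add, add_sub_add_comm, ← ENNReal.add_halves ε]
    exact (eLpNorm_add_le (hφ.isC1c.aesm_gradient.sub hw.memLp_grad.1)
      (hψ.isC1c.aesm_gradient.sub hz.memLp_grad.1) hP).trans (add_le_add d2 e2)

theorem MemX.smul (hp : 1 < p) {w : (RN N → ℝ) × (RN N → RN N)} (c : ℝ) (hw : MemX Ω p w) :
    MemX Ω p (c • w) := by
  obtain ⟨φ, hφ, t1, t2, -⟩ := hw.exists_seq hp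
  refine .of_tendsto hp (w' := fun n => (c • φ n, gradient (c • φ n)))
    (fun n => ((hφ n).const_smul c).memX) (hw.memLp.1.const_smul c)
    (hw.memLp_grad.1.const_smul c) ?_ ?_
  · have := ENNReal.Tendsto.const_mul t1 (.inr (enorm_ne_top (x := c)))
    simpa only [Prod.smul_fst, ← smul_sub, eLpNorm_const_smul, mul_zero] using this
  · have hg : ∀ n, gradient (c • φ n) = c • gradient (φ n) := fun n =>
      funext fun x => gradient_const_smul' c ((hφ n).isC1c.differentiable x)
    have := ENNReal.Tendsto.const_mul t2 (.inr (enorm_ne_top (x := c)))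
    simpa only [Prod.smul_snd, hg, ← smul_sub, eLpNorm_const_smul, mul_zero] using this

theorem MemX.sub (hp : 1 < p) {w z : (RN N → ℝ) × (RN N → RN N)} (hw : MemX Ω p w)
    (hz : MemX Ω p z) : MemX Ω p (w - z) := by
  have := hw.add hp (hz.smul hp (-1))
  rwa [neg_one_smul, ← sub_eq_add_neg] at this

theorem MemX.congr_ae {w z : (RN N → ℝ) × (RN N → RN N)} (hw : MemX Ω p w)
    (h1 : w.1 =ᵐ[volume] z.1) (h2 : w.2 =ᵐ[volume] z.2) : MemX Ω p z := by
  refine ⟨hw.memLp.ae_eq h1, hw.memLp_grad.ae_eq h2, fun ε hε => ?_⟩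
  obtain ⟨φ, hφ, d1, d2⟩ := hw.approx ε hε
  refine ⟨φ, hφ, ?_, ?_⟩
  · rwa [← eLpNorm_congr_ae (EventuallyEq.rfl.sub h1)]
  · rwa [← eLpNorm_congr_ae (EventuallyEq.rfl.sub h2)]

theorem MemX.mono {Ω' : Set (RN N)} (hΩ : Ω ⊆ Ω') {w : (RN N → ℝ) × (RN N → RN N)}
    (hw : MemX Ω p w) : MemX Ω' p w := by
  refine ⟨hw.memLp, hw.memLp_grad, fun ε hε => ?_⟩
  obtain ⟨φ, hφ, h⟩ := hw.approx ε hε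
  exact ⟨φ, ⟨hφ.smooth, hφ.compact, hφ.support_subset.trans hΩ⟩, h⟩

theorem eLpNorm_le_of_support_subset {F : Type*} [NormedAddCommGroup F] {K : Set (RN N)}
    {f : RN N → F} {η : ℝ} (hf : Function.support f ⊆ K) (hη : ∀ x, ‖f x‖ ≤ η) (P : ℝ≥0∞) :
    eLpNorm f P volume ≤ volume K ^ P.toReal⁻¹ * ENNReal.ofReal η := by
  rw [← eLpNorm_restrict_eq_of_support_subset hf]
  simpa using eLpNorm_le_of_ae_bound (μ := volume.restrict K) (p := P) (f := f) (C := η)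
    (.of_forall hη)

/-- Mollification: `C_c^1(Ω)` functions are limits of test functions. -/
theorem IsC1c.memX (hΩ : IsOpen Ω) {φ : RN N → ℝ} (hφ : IsC1c Ω φ) :
    MemX Ω p (φ, gradient φ) := by
  refine ⟨hφ.memLp _ _, hφ.memLp_gradient _ _, fun ε hε => ?_⟩
  obtain ⟨δ, hδ, hδΩ⟩ := hφ.compact.exists_cthickening_subset_open hΩ hφ.support_subset
  set K' := Metric.cthickening δ (tsupport φ)
  have hK' : IsCompact K' := hφ.compact.isCompact.cthickening
  obtain ⟨η, hη, hηε⟩ : ∃ η : ℝ, 0 < η ∧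
      volume K' ^ (ENNReal.ofReal p).toReal⁻¹ * ENNReal.ofReal η ≤ ε := by
    have hc : volume K' ^ (ENNReal.ofReal p).toReal⁻¹ ≠ ⊤ :=
      ENNReal.rpow_ne_top_of_nonneg (by positivity) hK'.measure_ne_top
    have : Tendsto (fun η : ℝ => volume K' ^ (ENNReal.ofReal p).toReal⁻¹ * ENNReal.ofReal η)
        (𝓝[>] 0) (𝓝 0) := by
      have := ENNReal.Tendsto.const_mul ((ENNReal.tendsto_ofReal
        (tendsto_id (α := ℝ) (x := 𝓝 0))).mono_left (nhdsWithin_le_nhds (s := Set.Ioi 0)))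
        (.inr hc)
      simpa using this
    obtain ⟨η, h1, h2⟩ := ((this.eventually_le_const (pos_iff_ne_zero.2 hε)).and
      self_mem_nhdsWithin).exists
    exact ⟨η, h2, h1⟩
  have hfc : Continuous (fderiv ℝ φ) := hφ.smooth.continuous_fderiv one_ne_zero
  obtain ⟨r1, hr1, hu1⟩ := Metric.uniformContinuous_iff.1
    (hφ.compact.uniformContinuous_of_continuous hφ.smooth.continuous) η hη
  obtain ⟨r2, hr2, hu2⟩ := Metric.uniformContinuous_iff.1
    ((hφ.compact.fderiv ℝ).uniformContinuous_of_continuous hfc) η hη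
  -- Radius at most `δ` keeps the support of the mollification in `Ω`; `r1` and `r2` bound the
  -- uniform errors of the function and of its derivative by `η`.
  set r := min δ (min r1 r2)
  have hr : 0 < r := by positivity
  let ρ : ContDiffBump (0 : RN N) := ⟨r / 2, r, by linarith, by linarith⟩
  set ψ : RN N → ℝ := convolution (ρ.normed volume) φ (ContinuousLinearMap.lsmul ℝ ℝ) volume
  have hli : LocallyIntegrable φ volume := hφ.smooth.continuous.locallyIntegrable
  have hfd : ∀ x, fderiv ℝ ψ x = convolution (ρ.normed volume) (fderiv ℝ φ)
      (ContinuousLinearMap.lsmul ℝ ℝ) volume x := fun x =>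
    (hφ.compact.hasFDerivAt_convolution_right (ContinuousLinearMap.lsmul ℝ ℝ)
      (ρ.continuous_normed.locallyIntegrable) hφ.smooth x).fderiv
  have hsupp : tsupport ψ ⊆ K' := by
    refine closure_minimal ((support_convolution_subset _).trans ?_) Metric.isClosed_cthickening
    rintro _ ⟨a, ha, b, hb, rfl⟩
    rw [ρ.support_normed_eq] at ha
    have ha' : ‖a‖ < r := mem_ball_zero_iff.1 ha
    refine Metric.mem_cthickening_of_dist_le _ b _ _ (subset_tsupport _ hb) ?_
    rw [dist_eq_norm, add_sub_cancel_right]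
    exact ha'.le.trans (min_le_left _ _)
  have hψ : IsTestFunction Ω ψ :=
    ⟨HasCompactSupport.contDiff_convolution_left _ ρ.hasCompactSupport_normed
      ρ.contDiff_normed hli, HasCompactSupport.intro hK' fun x hx => by
        by_contra h; exact hx (hsupp (subset_tsupport _ h)), hsupp.trans hδΩ⟩
  have hKφ : tsupport φ ⊆ K' := Metric.self_subset_cthickening _
  refine ⟨ψ, hψ, (eLpNorm_le_of_support_subset (K := K') (η := η) ?_ (fun x => ?_) _).trans hηε,
    (eLpNorm_le_of_support_subset (K := K') (η := η) ?_ (fun x => ?_) _).trans hηε⟩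
  · intro x hx
    by_contra h
    exact hx (by simp [image_eq_zero_of_notMem_tsupport fun h' => h (hsupp h'),
      image_eq_zero_of_notMem_tsupport fun h' => h (hKφ h')])
  · rw [Pi.sub_apply, ← dist_eq_norm]
    refine ρ.dist_normed_convolution_le hφ.smooth.continuous.aestronglyMeasurable fun y hy => ?_
    exact (hu1 (lt_of_lt_of_le hy ((min_le_right _ _).trans (min_le_left _ _)))).le
  · intro x hx
    by_contra h
    exact hx (by simp [gradient_eq_zero_of_notMem_tsupport fun h' => h (hsupp h'),
      gradient_eq_zero_of_notMem_tsupport fun h' => h (hKφ h')])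
  · rw [Pi.sub_apply, norm_gradient_sub_eq, ← dist_eq_norm, hfd]
    refine ρ.dist_normed_convolution_le hfc.aestronglyMeasurable fun y hy => ?_
    exact (hu2 (lt_of_lt_of_le hy ((min_le_right _ _).trans (min_le_right _ _)))).le

/-- Chain rule. -/
theorem MemX.comp (hp : 1 < p) (hΩ : IsOpen Ω) {w : (RN N → ℝ) × (RN N → RN N)}
    (hw : MemX Ω p w) {F f : ℝ → ℝ} {C : ℝ} (hF : ∀ t, HasDerivAt F (f t) t)
    (hf : Continuous f) (hC : ∀ t, |f t| ≤ C) (h0 : F 0 = 0) :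
    MemX Ω p (fun x => F (w.1 x), fun x => f (w.1 x) • w.2 x) := by
  have hP : 1 ≤ ENNReal.ofReal p := by simpa using hp.le
  have hFc : Continuous F := continuous_iff_continuousAt.2 fun t => (hF t).continuousAt
  obtain ⟨φ, hφ, t1, t2, hae⟩ := hw.exists_seq hp
  have hφm : ∀ n, AEStronglyMeasurable (φ n) volume := fun n =>
    (hφ n).isC1c.aesm
  have hgm : ∀ n, AEStronglyMeasurable (gradient (φ n)) volume := fun n =>
    (hφ n).isC1c.aesm_gradient
  have hfu : AEStronglyMeasurable (fun x => f (w.1 x)) volume :=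
    hf.comp_aestronglyMeasurable hw.memLp.1
  have hfφ : ∀ n, AEStronglyMeasurable (fun x => f (φ n x)) volume := fun n =>
    hf.comp_aestronglyMeasurable (hφm n)
  have hlip : ∀ a b, |F a - F b| ≤ C * |a - b| := fun a b => by
    have := Convex.norm_image_sub_le_of_norm_hasDerivWithin_le (s := Set.univ)
      (fun t _ => (hF t).hasDerivWithinAt) (fun t _ => hC t) convex_univ (Set.mem_univ b)
      (Set.mem_univ a)
    simpa using this
  have hmul : ∀ {F' : Type} [NormedAddCommGroup F'] (H : ℕ → RN N → F')
      , Tendsto (fun n => eLpNorm (H n) (ENNReal.ofReal p) volume) atTop (𝓝 0) →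
      Tendsto (fun n => ENNReal.ofReal C * eLpNorm (H n) (ENNReal.ofReal p) volume)
        atTop (𝓝 0) := fun H h => by
    simpa using ENNReal.Tendsto.const_mul h (.inr (ENNReal.ofReal_ne_top (r := C)))
  refine .of_tendsto hp (w' := fun n => (fun x => F (φ n x), gradient fun x => F (φ n x)))
    (fun n => ((hφ n).isC1c.comp hF hf h0).memX hΩ) (hFc.comp_aestronglyMeasurable hw.memLp.1)
    (hfu.smul hw.memLp_grad.1) ?_ ?_
  · refine tendsto_of_tendsto_of_tendsto_of_le_of_le tendsto_const_nhds (hmul _ t1)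
      (fun _ => zero_le) fun n => ?_
    exact eLpNorm_le_mul_eLpNorm_of_ae_le_mul (.of_forall fun x => hlip _ _) _
  -- The first summand is small because `f` is bounded and the gradients converge; the second tends
  -- to zero by dominated convergence, as `φ n → u` almost everywhere.
  · have hsplit : ∀ n, (gradient fun x => F (φ n x)) - (fun x => f (w.1 x) • w.2 x)
        = (fun x => f (φ n x) • (gradient (φ n) - w.2) x)
          + fun x => (f (φ n x) - f (w.1 x)) • w.2 x := fun n => by
      ext1 x
      rw [Pi.sub_apply, gradient_comp (hF _) ((hφ n).isC1c.differentiable x)]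
      simp [smul_sub, sub_smul]
    have h2 : Tendsto (fun n => eLpNorm (fun x => (f (φ n x) - f (w.1 x)) • w.2 x)
        (ENNReal.ofReal p) volume) atTop (𝓝 0) := by
      refine tendsto_eLpNorm_zero_of_dominated hp
        (fun n => ((hfφ n).sub hfu).smul hw.memLp_grad.1)
        (hw.memLp_grad.norm.const_mul (2 * C)) (fun n => .of_forall fun x => ?_) ?_
      · rw [norm_smul]
        gcongr
        refine (norm_sub_le _ _).trans ?_
        have := hC (φ n x); have := hC (w.1 x)
        simp only [Real.norm_eq_abs]; linarith
      · filter_upwards [hae] with x hx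
        have := (((hf.tendsto _).comp hx).sub_const (f (w.1 x))).smul_const (w.2 x)
        simpa using this
    have h3 := (hmul _ t2).add h2
    rw [add_zero] at h3
    refine tendsto_of_tendsto_of_tendsto_of_le_of_le tendsto_const_nhds h3
      (fun _ => zero_le) fun n => ?_
    simp only [hsplit]
    refine (eLpNorm_add_le ((hfφ n).smul ((hgm n).sub hw.memLp_grad.1))
      (((hfφ n).sub hfu).smul hw.memLp_grad.1) hP).trans ?_
    refine add_le_add ?_ le_rfl
    exact eLpNorm_le_mul_eLpNorm_of_ae_le_mul (.of_forall fun x => by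
      rw [Pi.smul_apply', norm_smul]; gcongr; exact hC _) _

/-- Product with a `C_c^1` function. -/
theorem MemX.mul_left (hp : 1 < p) {A : Set (RN N)} (hA : IsOpen A)
    {w : (RN N → ℝ) × (RN N → RN N)} (hw : MemX Ω p w) {θ : RN N → ℝ} (hθ : IsC1c A θ) :
    MemX A p (fun x => θ x * w.1 x, fun x => θ x • w.2 x + w.1 x • gradient θ x) := by
  have hP : 1 ≤ ENNReal.ofReal p := by simpa using hp.le
  obtain ⟨φ, hφ, t1, t2, hae⟩ := hw.exists_seq hp
  have hφm : ∀ n, AEStronglyMeasurable (φ n) volume := fun n =>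
    (hφ n).isC1c.aesm
  have hgm : ∀ n, AEStronglyMeasurable (gradient (φ n)) volume := fun n =>
    (hφ n).isC1c.aesm_gradient
  have hθm : AEStronglyMeasurable θ volume := hθ.smooth.continuous.aestronglyMeasurable
  have hθg : AEStronglyMeasurable (gradient θ) volume :=
    hθ.continuous_gradient.aestronglyMeasurable
  obtain ⟨C, hC⟩ := hθ.smooth.continuous.bounded_above_of_compact_support hθ.compact
  obtain ⟨D, hD⟩ := hθ.continuous_gradient.bounded_above_of_compact_support hθ.compact_gradient
  have hmul : ∀ (C : ℝ) {F' : Type} [NormedAddCommGroup F'] (H : ℕ → RN N → F')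
      , Tendsto (fun n => eLpNorm (H n) (ENNReal.ofReal p) volume) atTop (𝓝 0) →
      Tendsto (fun n => ENNReal.ofReal C * eLpNorm (H n) (ENNReal.ofReal p) volume)
        atTop (𝓝 0) := fun C _ _ H h => by
    simpa using ENNReal.Tendsto.const_mul h (.inr (ENNReal.ofReal_ne_top (r := C)))
  refine .of_tendsto hp (w' := fun n => (fun x => θ x * φ n x, gradient fun x => θ x * φ n x))
    (fun n => (hθ.mul (hφ n).isC1c.smooth).memX hA) (hθm.mul hw.memLp.1)
    ((hθm.smul hw.memLp_grad.1).add (hw.memLp.1.smul hθg)) ?_ ?_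
  · refine tendsto_of_tendsto_of_tendsto_of_le_of_le tendsto_const_nhds (hmul C _ t1)
      (fun _ => zero_le) fun n => ?_
    refine eLpNorm_le_mul_eLpNorm_of_ae_le_mul (.of_forall fun x => ?_) _
    simp only [Pi.sub_apply, ← mul_sub, norm_mul]
    gcongr; exact hC x
  · have hsplit : ∀ n, (gradient fun x => θ x * φ n x)
        - (fun x => θ x • w.2 x + w.1 x • gradient θ x)
        = (fun x => θ x • (gradient (φ n) - w.2) x)
          + fun x => (φ n - w.1) x • gradient θ x := fun n => by
      ext1 x
      rw [Pi.sub_apply, gradient_mul' (hθ.differentiable x) ((hφ n).isC1c.differentiable x)]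
      simp only [Pi.add_apply, Pi.sub_apply, smul_sub, sub_smul]
      abel
    have h3 := (hmul C _ t2).add (hmul D _ t1)
    rw [add_zero] at h3
    refine tendsto_of_tendsto_of_tendsto_of_le_of_le tendsto_const_nhds h3
      (fun _ => zero_le) fun n => ?_
    simp only [hsplit]
    refine (eLpNorm_add_le (hθm.smul ((hgm n).sub hw.memLp_grad.1))
      (((hφm n).sub hw.memLp.1).smul hθg) hP).trans ?_
    gcongr
    · exact eLpNorm_le_mul_eLpNorm_of_ae_le_mul (.of_forall fun x => by
        rw [Pi.smul_apply', norm_smul]; gcongr; exact hC _) _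
    · exact eLpNorm_le_mul_eLpNorm_of_ae_le_mul (.of_forall fun x => by
        rw [Pi.smul_apply', norm_smul, mul_comm]; gcongr; exact hD _) _

end MemX

end MixedEigen

namespace MixedEigen

/-! ### Weak gradients and the identification of `X_0` -/

section WeakGradient

variable {N : ℕ} {Ω : Set (RN N)} {p : ℝ}

theorem integrable_mul_of_isC1c (hp : 1 < p) {θ f : RN N → ℝ} (hθ : Continuous θ)
    (hθc : HasCompactSupport θ) (hf : MemLp f (ENNReal.ofReal p) volume) :
    Integrable (fun x => θ x * f x) volume := by
  have hP : 1 ≤ ENNReal.ofReal p := by simpa using hp.le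
  have hc := ENNReal.HolderConjugate.conjExponent hP
  have := hc.symm
  exact memLp_one_iff_integrable.1
    (hf.smul (hθ.memLp_of_hasCompactSupport hθc (p := (ENNReal.ofReal p).conjExponent)) (r := 1))

theorem tendsto_integral_mul_of_eLpNorm (hp : 1 < p) {θ : RN N → ℝ} (hθ : Continuous θ)
    (hθc : HasCompactSupport θ) {f : ℕ → RN N → ℝ} {g : RN N → ℝ}
    (hf : ∀ n, MemLp (f n) (ENNReal.ofReal p) volume) (hg : MemLp g (ENNReal.ofReal p) volume)
    (h : Tendsto (fun n => eLpNorm (f n - g) (ENNReal.ofReal p) volume) atTop (𝓝 0)) :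
    Tendsto (fun n => ∫ x, θ x * f n x) atTop (𝓝 (∫ x, θ x * g x)) := by
  have hP : 1 ≤ ENNReal.ofReal p := by simpa using hp.le
  have hc := (ENNReal.HolderConjugate.conjExponent hP).symm
  have hm := hθ.memLp_of_hasCompactSupport (μ := volume) hθc (p := (ENNReal.ofReal p).conjExponent)
  refine tendsto_integral_of_L1' _ (integrable_mul_of_isC1c hp hθ hθc hg).1
    (.of_forall fun n => integrable_mul_of_isC1c hp hθ hθc (hf n)) ?_
  have h2 := ENNReal.Tendsto.const_mul h (.inr hm.eLpNorm_ne_top)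
  rw [mul_zero] at h2
  refine tendsto_of_tendsto_of_tendsto_of_le_of_le tendsto_const_nhds h2
    (fun _ => zero_le) fun n => ?_
  have h3 : (fun x => θ x * f n x) - (fun x => θ x * g x) = θ • (f n - g) := by
    ext x; simp [mul_sub]
  simp only [h3]
  exact eLpNorm_smul_le_mul_eLpNorm ((hf n).1.sub hg.1) hm.1

theorem eLpNorm_inner_le {G : RN N → RN N} (e : RN N) (P : ℝ≥0∞) :
    eLpNorm (fun x => inner ℝ (G x) e) P volume ≤ ENNReal.ofReal ‖e‖ * eLpNorm G P volume :=
  eLpNorm_le_mul_eLpNorm_of_ae_le_mul (.of_forall fun x => by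
    rw [mul_comm]; exact norm_inner_le_norm _ _) P

theorem memLp_inner_const {G : RN N → RN N} (e : RN N) {P : ℝ≥0∞} (hG : MemLp G P volume) :
    MemLp (fun x => inner ℝ (G x) e) P volume :=
  ⟨hG.1.inner aestronglyMeasurable_const, (eLpNorm_inner_le e P).trans_lt
    (ENNReal.mul_lt_top ENNReal.ofReal_lt_top hG.2)⟩

theorem continuous_fderiv_apply_of_isC1c {φ : RN N → ℝ} (hφ : IsC1c Ω φ) (e : RN N) :
    Continuous fun x => fderiv ℝ φ x e :=
  (hφ.smooth.continuous_fderiv one_ne_zero).clm_apply continuous_const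

/-- Integration by parts holds for the approximating test functions, and both sides converge because
they pair an `L^p` limit with a continuous function of compact support. -/
theorem MemX.hasWeakGradient (hp : 1 < p) {w : (RN N → ℝ) × (RN N → RN N)} (hw : MemX Ω p w) :
    HasWeakGradient Set.univ w.1 w.2 := by
  intro θ hθ e
  obtain ⟨φ, hφ, t1, t2, -⟩ := hw.exists_seq hp
  have hθ' := hθ.isC1c
  have c1 := continuous_fderiv_apply_of_isC1c hθ' e
  have k1 : HasCompactSupport fun x => fderiv ℝ θ x e := hθ'.compact.fderiv_apply ℝ e
  have l1 := tendsto_integral_mul_of_eLpNorm hp c1 k1 (fun n => (hφ n).isC1c.memLp _ _) hw.memLp t1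
  have l2 := tendsto_integral_mul_of_eLpNorm hp hθ'.smooth.continuous hθ'.compact
    (f := fun n x => inner ℝ (gradient (φ n) x) e) (g := fun x => inner ℝ (w.2 x) e)
    (fun n => memLp_inner_const e ((hφ n).isC1c.memLp_gradient _ _))
    (memLp_inner_const e hw.memLp_grad) (by
      have h2 := ENNReal.Tendsto.const_mul t2 (.inr (ENNReal.ofReal_ne_top (r := ‖e‖)))
      rw [mul_zero] at h2
      refine tendsto_of_tendsto_of_tendsto_of_le_of_le tendsto_const_nhds h2
        (fun _ => zero_le) fun n => ?_
      refine le_trans (le_of_eq ?_) (eLpNorm_inner_le e _)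
      congr 1; ext x; simp [inner_sub_left])
  have h3 : ∀ n, ∫ x, fderiv ℝ θ x e * φ n x = - ∫ x, θ x * inner ℝ (gradient (φ n) x) e := by
    intro n
    have hn := (hφ n).isC1c
    have c2 := continuous_fderiv_apply_of_isC1c hn e
    have i1 : Integrable (fun x => fderiv ℝ θ x e * φ n x) volume :=
      (c1.mul hn.smooth.continuous).integrable_of_hasCompactSupport k1.mul_right
    have i2 : Integrable (fun x => θ x * fderiv ℝ (φ n) x e) volume :=
      (hθ'.smooth.continuous.mul c2).integrable_of_hasCompactSupport hθ'.compact.mul_right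
    have i3 : Integrable (fun x => θ x * φ n x) volume :=
      (hθ'.smooth.continuous.mul hn.smooth.continuous).integrable_of_hasCompactSupport
        hθ'.compact.mul_right
    simp only [inner_gradient_eq]
    rw [integral_mul_fderiv_eq_neg_fderiv_mul_of_integrable i1 i2 i3
      (fun x _ => hθ'.differentiable x) (fun x _ => hn.differentiable x), neg_neg]
  simp only [h3] at l1
  have := tendsto_nhds_unique l1 l2.neg
  simp only [Measure.restrict_univ]
  rw [← this]
  exact integral_congr_ae (.of_forall fun x => mul_comm _ _)

theorem HasWeakGradient.unique (hp : 1 < p) {u : RN N → ℝ} {G G' : RN N → RN N}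
    (hG : MemLp G (ENNReal.ofReal p) volume) (hG' : MemLp G' (ENNReal.ofReal p) volume)
    (h : HasWeakGradient Set.univ u G) (h' : HasWeakGradient Set.univ u G') :
    G =ᵐ[volume] G' := by
  have hP : 1 ≤ ENNReal.ofReal p := by simpa using hp.le
  have hc := (ENNReal.HolderConjugate.conjExponent hP).symm
  refine ae_eq_of_integral_contDiff_smul_eq (hG.locallyIntegrable hP) (hG'.locallyIntegrable hP)
    fun θ hθ hθc => ?_
  have hm := hθ.continuous.memLp_of_hasCompactSupport (μ := volume) hθc
    (p := (ENNReal.ofReal p).conjExponent)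
  have key : ∀ {H : RN N → RN N}, MemLp H (ENNReal.ofReal p) volume → ∀ e : RN N,
      inner ℝ (∫ x, θ x • H x) e = ∫ x, θ x * inner ℝ (H x) e := fun hH e => by
    have hi := memLp_one_iff_integrable.1 (hH.smul hm (r := 1))
    rw [real_inner_comm]
    refine (integral_inner hi e).symm.trans ?_
    refine integral_congr_ae (.of_forall fun x => ?_)
    simp only [Pi.smul_apply', inner_smul_right, real_inner_comm]
  refine ext_inner_right ℝ fun e => ?_
  have t : IsTestFunction Set.univ θ := ⟨hθ, hθc, Set.subset_univ _⟩
  have e1 := h θ t e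
  have e2 := h' θ t e
  simp only [Measure.restrict_univ] at e1 e2
  rw [key hG, key hG', ← neg_inj, ← e1, ← e2]

theorem eLpNorm_restrict_eq_of_ae_zero {F : Type*} [NormedAddCommGroup F] (hΩ : MeasurableSet Ω)
    {f : RN N → F} (hf : ∀ᵐ x, x ∉ Ω → f x = 0) (P : ℝ≥0∞) :
    eLpNorm f P (volume.restrict Ω) = eLpNorm f P volume := by
  rw [← eLpNorm_indicator_eq_eLpNorm_restrict hΩ]
  refine eLpNorm_congr_ae ?_
  filter_upwards [hf] with x hx
  by_cases h : x ∈ Ω <;> simp [h, hx]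

theorem IsTestFunction.eq_zero {φ : RN N → ℝ} (hφ : IsTestFunction Ω φ) {x : RN N}
    (hx : x ∉ Ω) : φ x = 0 :=
  image_eq_zero_of_notMem_tsupport fun h => hx (hφ.support_subset h)

theorem IsTestFunction.gradient_eq_zero {φ : RN N → ℝ} (hφ : IsTestFunction Ω φ) {x : RN N}
    (hx : x ∉ Ω) : gradient φ x = 0 :=
  gradient_eq_zero_of_notMem_tsupport fun h => hx (hφ.support_subset h)

theorem ae_eq_zero_of_tendsto_eLpNorm {F : Type*} [NormedAddCommGroup F] (hp : 1 < p)
    (hΩ : MeasurableSet Ω) {f : RN N → F} {φ : ℕ → RN N → F}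
    (hf : AEStronglyMeasurable f volume) (hφ : ∀ n, ∀ x, x ∉ Ω → φ n x = 0)
    (h : Tendsto (fun n => eLpNorm (φ n - f) (ENNReal.ofReal p) volume) atTop (𝓝 0)) :
    ∀ᵐ x, x ∉ Ω → f x = 0 := by
  have h1 : ∀ n, eLpNorm f (ENNReal.ofReal p) (volume.restrict Ωᶜ)
      ≤ eLpNorm (φ n - f) (ENNReal.ofReal p) volume := fun n => by
    refine le_trans (le_of_eq ?_) (eLpNorm_restrict_le (φ n - f) _ volume Ωᶜ)
    rw [← eLpNorm_neg]
    refine eLpNorm_congr_ae ?_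
    filter_upwards [ae_restrict_mem hΩ.compl] with x hx
    simp [hφ n x hx]
  have h2 := le_antisymm (ge_of_tendsto' h h1) zero_le
  rw [eLpNorm_eq_zero_iff hf.restrict (by simp; linarith)] at h2
  exact (ae_restrict_iff' hΩ.compl).1 h2

theorem MemX.ae_eq_zero (hp : 1 < p) (hΩ : IsOpen Ω) {w : (RN N → ℝ) × (RN N → RN N)}
    (hw : MemX Ω p w) : ∀ᵐ x, x ∉ Ω → w.1 x = 0 := by
  obtain ⟨φ, hφ, t1, -, -⟩ := hw.exists_seq hp
  exact ae_eq_zero_of_tendsto_eLpNorm hp hΩ.measurableSet hw.memLp.1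
    (fun n x hx => (hφ n).eq_zero hx) t1

/-- Extension by zero turns convergence on `Ω` into convergence on the whole space. The conditions
defining `X_0` thus collapse to one closure condition, with which the rest of the proof works. -/
theorem mem_spaceX0_iff (hp : 1 < p) (hΩ : IsOpen Ω) {w : (RN N → ℝ) × (RN N → RN N)} :
    w ∈ spaceX0 Ω p ↔ MemX Ω p w := by
  have hm := hΩ.measurableSet
  constructor
  · rintro ⟨h1, h2, h3⟩
    obtain ⟨φ, hφ, t1, t2⟩ := h2.approx
    have m1 : MemLp w.1 (ENNReal.ofReal p) volume := by simpa using h1.memLp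
    have m2 : MemLp w.2 (ENNReal.ofReal p) volume := by simpa using h1.memLp_grad
    -- The test functions approximate the gradient only inside `Ω`, so their limit carries the
    -- gradient cut off outside `Ω`; uniqueness of weak gradients identifies it with the given one.
    have hX : MemX Ω p (w.1, Ω.indicator w.2) := by
      refine .of_tendsto hp (fun n => (hφ n).memX) m1.1 (m2.1.indicator hm) ?_ ?_
      · convert t1 using 2 with n
        refine (eLpNorm_restrict_eq_of_ae_zero hm ?_ _).symm
        filter_upwards [h3] with x hx hxΩ
        simp [hx hxΩ, (hφ n).eq_zero hxΩ]
      · convert t2 using 2 with n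
        rw [← eLpNorm_indicator_eq_eLpNorm_restrict hm]
        congr 1; ext1 x
        by_cases hx : x ∈ Ω <;> simp [hx, (hφ n).gradient_eq_zero]
    refine hX.congr_ae EventuallyEq.rfl ?_
    exact HasWeakGradient.unique hp hX.memLp_grad m2 (hX.hasWeakGradient hp) h1.weakGradient
  · intro hw
    have hg := hw.hasWeakGradient hp
    obtain ⟨φ, hφ, t1, t2, -⟩ := hw.exists_seq hp
    refine ⟨⟨by simpa using hw.memLp, by simpa using hw.memLp_grad, hg⟩,
      ⟨⟨hw.memLp.restrict Ω, hw.memLp_grad.restrict Ω, fun θ hθ e => ?_⟩, φ, hφ, ?_, ?_⟩,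
      hw.ae_eq_zero hp hΩ⟩
    · have := hg θ ⟨hθ.smooth, hθ.compact, Set.subset_univ _⟩ e
      simp only [Measure.restrict_univ] at this
      rw [setIntegral_eq_integral_of_forall_compl_eq_zero, this,
        setIntegral_eq_integral_of_forall_compl_eq_zero]
      · intro x hx; simp [hθ.eq_zero hx]
      · intro x hx; simp [← inner_gradient_eq, hθ.gradient_eq_zero hx]
    · exact tendsto_of_tendsto_of_tendsto_of_le_of_le tendsto_const_nhds t1
        (fun _ => zero_le) fun n => eLpNorm_restrict_le _ _ _ _
    · exact tendsto_of_tendsto_of_tendsto_of_le_of_le tendsto_const_nhds t2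
        (fun _ => zero_le) fun n => eLpNorm_restrict_le _ _ _ _

/-- The weak gradient vanishes almost everywhere on a level set. -/
theorem MemX.ae_grad_eq_zero_of_eq_zero (hp : 1 < p) (hΩ : IsOpen Ω)
    {w : (RN N → ℝ) × (RN N → RN N)} (hw : MemX Ω p w) : ∀ᵐ x, w.1 x = 0 → w.2 x = 0 := by
  -- The functions `arctan (k t) / k` tend to zero uniformly while their derivatives tend boundedly
  -- to the indicator of `{0}`. By the chain rule the zero function then has weak gradient `1_{u=0}
  -- ∇u`, which must vanish.
  set k : ℕ → ℝ := fun n => n + 1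
  have hk : ∀ n, 0 < k n := fun n => by positivity
  set F : ℕ → ℝ → ℝ := fun n t => Real.arctan (k n * t) / k n
  set f : ℕ → ℝ → ℝ := fun n t => 1 / (1 + (k n * t) ^ 2)
  have hF : ∀ n t, HasDerivAt (F n) (f n t) t := fun n t => by
    have h1 : HasDerivAt (fun t => k n * t) (k n) t := by simpa using (hasDerivAt_id t).const_mul (k n)
    refine (h1.arctan.div_const (k n)).congr_deriv ?_
    have := (hk n).ne'
    simp only [f]; field_simp
  have hfc : ∀ n, Continuous (f n) := fun n => by
    refine continuous_const.div (by fun_prop) fun t => by positivity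
  have hf1 : ∀ n t, |f n t| ≤ 1 := fun n t => by
    rw [abs_of_nonneg (by positivity)]
    exact div_le_one_of_le₀ (by nlinarith [sq_nonneg (k n * t)]) (by positivity)
  have hFle : ∀ n t, |F n t| ≤ |t| := fun n t => by
    have := Convex.norm_image_sub_le_of_norm_hasDerivWithin_le (s := Set.univ)
      (fun t _ => (hF n t).hasDerivWithinAt) (fun t _ => hf1 n t) convex_univ (Set.mem_univ 0)
      (Set.mem_univ t)
    simpa [F, abs_div] using this
  have hkt : Tendsto k atTop atTop := tendsto_atTop_add_const_right _ _ tendsto_natCast_atTop_atTop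
  have hX : MemX Ω p (0, fun x => ({x | w.1 x = 0} : Set (RN N)).indicator w.2 x) := by
    have hms : NullMeasurableSet {x | w.1 x = 0} volume :=
      hw.memLp.1.nullMeasurableSet_eq_fun aestronglyMeasurable_const
    have hmi : AEStronglyMeasurable (({x | w.1 x = 0} : Set (RN N)).indicator w.2) volume :=
      hw.memLp_grad.1.indicator₀ hms
    refine .of_tendsto hp (fun n => hw.comp hp hΩ (hF n) (hfc n) (hf1 n) (by simp [F]))
      aestronglyMeasurable_const hmi ?_ ?_
    · refine tendsto_eLpNorm_zero_of_dominated hp (b := fun x => |w.1 x|) (fun n => ?_)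
        hw.memLp.norm (fun n => .of_forall fun x => ?_) (.of_forall fun x => ?_)
      · exact ((continuous_iff_continuousAt.2 fun t =>
          (hF n t).continuousAt).comp_aestronglyMeasurable hw.memLp.1).sub
          aestronglyMeasurable_const
      · simpa using hFle n (w.1 x)
      · have h1 : Tendsto (fun n => (Real.pi / 2) / k n) atTop (𝓝 0) :=
          hkt.const_div_atTop _
        refine squeeze_zero_norm (fun n => ?_) h1
        simp only [F, Pi.sub_apply, Pi.zero_apply, sub_zero, Real.norm_eq_abs, abs_div,
          abs_of_pos (hk n)]
        gcongr
        exact abs_le.2 ⟨(Real.neg_pi_div_two_lt_arctan _).le, (Real.arctan_lt_pi_div_two _).le⟩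
    · refine tendsto_eLpNorm_zero_of_dominated hp (b := fun x => 2 * ‖w.2 x‖) (fun n => ?_)
        (hw.memLp_grad.norm.const_mul 2) (fun n => .of_forall fun x => ?_)
        (.of_forall fun x => ?_)
      · exact (((hfc n).comp_aestronglyMeasurable hw.memLp.1).smul hw.memLp_grad.1).sub hmi
      · refine (norm_sub_le _ _).trans ?_
        have h1 : ‖f n (w.1 x) • w.2 x‖ ≤ 1 * ‖w.2 x‖ := by
          rw [norm_smul]; gcongr; exact hf1 _ _
        have h2 := norm_indicator_le_norm_self (s := {x | w.1 x = 0}) w.2 x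
        linarith
      · by_cases hx : w.1 x = 0
        · simp [hx, f]
        · have hsq : 0 < (w.1 x) ^ 2 := by positivity
          have h1 : Tendsto (fun n => f n (w.1 x)) atTop (𝓝 0) := by
            refine Tendsto.const_div_atTop ?_ 1
            refine tendsto_atTop_add_const_left _ _ ?_
            simp only [mul_pow]
            exact ((tendsto_pow_atTop two_ne_zero).comp hkt).atTop_mul_const hsq
          have := h1.smul_const (w.2 x)
          simpa [hx] using this
  have h0 : HasWeakGradient (N := N) Set.univ (0 : RN N → ℝ) (fun _ => 0) := by
    intro φ _ e; simp
  have := HasWeakGradient.unique hp hX.memLp_grad MemLp.zero' (hX.hasWeakGradient hp) h0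
  filter_upwards [this] with x hx hx0
  simpa [hx0] using hx

end WeakGradient

/-! ### The positive part through `C^1` truncations -/

section PosPart

variable {N : ℕ} {Ω : Set (RN N)} {p : ℝ}

/-- Continuous functions with support in `[1/k, k]`, increasing to the indicator of `(0, ∞)`. -/
noncomputable def tent (k : ℕ) (t : ℝ) : ℝ := max 0 (min 1 (min (k * t - 1) (k - t)))

/-- The primitive of `tent k`. -/
noncomputable def tentInt (k : ℕ) (t : ℝ) : ℝ := ∫ r in (0 : ℝ)..t, tent k r

theorem continuous_tent (k : ℕ) : Continuous (tent k) := by unfold tent; fun_prop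

theorem tent_nonneg (k : ℕ) (t : ℝ) : 0 ≤ tent k t := le_max_left _ _

theorem tent_le_one (k : ℕ) (t : ℝ) : tent k t ≤ 1 :=
  max_le zero_le_one (min_le_left _ _)

theorem abs_tent_le (k : ℕ) (t : ℝ) : |tent k t| ≤ 1 := by
  rw [abs_of_nonneg (tent_nonneg k t)]; exact tent_le_one k t

theorem tent_eq_zero {k : ℕ} {t : ℝ} (h : k * t ≤ 1) : tent k t = 0 :=
  max_eq_left ((min_le_right _ _).trans ((min_le_left _ _).trans (by linarith)))

theorem tent_eq_zero_of_le {k : ℕ} {t : ℝ} (h : (k : ℝ) ≤ t) : tent k t = 0 :=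
  max_eq_left ((min_le_right _ _).trans ((min_le_right _ _).trans (by linarith)))

theorem hasDerivAt_tentInt (k : ℕ) (t : ℝ) : HasDerivAt (tentInt k) (tent k t) t :=
  intervalIntegral.integral_hasDerivAt_right ((continuous_tent k).intervalIntegrable _ _)
    ((continuous_tent k).stronglyMeasurableAtFilter _ _) (continuous_tent k).continuousAt

theorem tentInt_eq_zero {k : ℕ} {t : ℝ} (h : k * t ≤ 1) : tentInt k t = 0 := by
  unfold tentInt
  rw [intervalIntegral.integral_congr (g := fun _ => 0)]
  · simp
  · intro r hr
    refine tent_eq_zero ?_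
    rcases le_total 0 t with h0 | h0
    · rw [Set.uIcc_of_le h0] at hr
      exact le_trans (by gcongr; exact hr.2) h
    · rw [Set.uIcc_of_ge h0] at hr
      have : (k : ℝ) * r ≤ 0 := mul_nonpos_of_nonneg_of_nonpos (by positivity) hr.2
      linarith

theorem abs_tentInt_le (k : ℕ) (t : ℝ) : |tentInt k t| ≤ max t 0 := by
  rcases le_total t 0 with h | h
  · rw [tentInt_eq_zero]
    · simp
    · have : (k : ℝ) * t ≤ 0 := mul_nonpos_of_nonneg_of_nonpos (by positivity) h
      linarith
  · have := intervalIntegral.norm_integral_le_of_norm_le_const (a := 0) (b := t) (C := 1)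
      (f := tent k) fun x _ => abs_tent_le k x
    rw [max_eq_left h]
    simpa [tentInt, abs_of_nonneg h] using this

theorem tentInt_le (k : ℕ) (t : ℝ) : |tentInt k t| ≤ k := by
  rcases le_total t k with h | h
  · exact (abs_tentInt_le k t).trans (max_le h (by positivity))
  · have h1 : tentInt k t = tentInt k k := by
      unfold tentInt
      rw [← intervalIntegral.integral_add_adjacent_intervals (b := (k : ℝ))
        ((continuous_tent k).intervalIntegrable _ _) ((continuous_tent k).intervalIntegrable _ _)]
      rw [intervalIntegral.integral_congr (a := (k : ℝ)) (g := fun _ => 0)]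
      · simp
      · intro r hr
        rw [Set.uIcc_of_le h] at hr
        exact tent_eq_zero_of_le hr.1
    rw [h1]
    exact (abs_tentInt_le k k).trans (max_le le_rfl (by positivity))

theorem tendsto_tent (t : ℝ) :
    Tendsto (fun k => tent k t) atTop (𝓝 ((Set.Ioi (0 : ℝ)).indicator 1 t)) := by
  rcases le_or_gt t 0 with h | h
  · rw [Set.indicator_of_notMem (by simpa using h)]
    refine tendsto_const_nhds.congr fun k => (tent_eq_zero ?_).symm
    have : (k : ℝ) * t ≤ 0 := mul_nonpos_of_nonneg_of_nonpos (by positivity) h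
    linarith
  · rw [Set.indicator_of_mem (by simpa using h)]
    have h1 : ∀ᶠ k : ℕ in atTop, 2 / t ≤ (k : ℝ) := tendsto_natCast_atTop_atTop.eventually_ge_atTop _
    have h2 : ∀ᶠ k : ℕ in atTop, t + 1 ≤ (k : ℝ) := tendsto_natCast_atTop_atTop.eventually_ge_atTop _
    refine tendsto_const_nhds.congr' ?_
    filter_upwards [h1, h2] with k h1 h2
    rw [div_le_iff₀ h] at h1
    rw [tent, min_eq_left, max_eq_right zero_le_one, Pi.one_apply]
    exact le_min (by linarith) (by linarith)

theorem tendsto_tentInt (t : ℝ) : Tendsto (fun k => tentInt k t) atTop (𝓝 (max t 0)) := by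
  have h : Tendsto (fun k => tentInt k t) atTop
      (𝓝 (∫ r in (0 : ℝ)..t, (Set.Ioi (0 : ℝ)).indicator (1 : ℝ → ℝ) r)) := by
    refine intervalIntegral.tendsto_integral_filter_of_dominated_convergence (fun _ => 1)
      (.of_forall fun k => (continuous_tent k).aestronglyMeasurable)
      (.of_forall fun k => .of_forall fun r _ => abs_tent_le k r) (by simp)
      (.of_forall fun r _ => tendsto_tent r)
  convert h using 2
  rcases le_total t 0 with h0 | h0
  · rw [max_eq_right h0, intervalIntegral.integral_congr (g := fun _ => 0)]
    · simp
    · intro r hr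
      rw [Set.uIcc_of_ge h0] at hr
      simp [hr.2]
  · rw [max_eq_left h0, intervalIntegral.integral_congr_ae (g := fun _ => 1)]
    · simp
    · refine .of_forall fun r hr => ?_
      rw [Set.uIoc_of_le h0] at hr
      simp [hr.1]

/-- The positive part of a function, with its gradient. -/
noncomputable def posPair (w : (RN N → ℝ) × (RN N → RN N)) : (RN N → ℝ) × (RN N → RN N) :=
  (fun x => max (w.1 x) 0, fun x => (Set.Ioi (0 : ℝ)).indicator (1 : ℝ → ℝ) (w.1 x) • w.2 x)

/-- If the truncations of `u` belong to `MemX A`, so does the positive part of `u`. -/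
theorem memX_posPair_of_tent {A : Set (RN N)} (hp : 1 < p)
    {w : (RN N → ℝ) × (RN N → RN N)} (h1 : MemLp w.1 (ENNReal.ofReal p) volume)
    (h2 : MemLp w.2 (ENNReal.ofReal p) volume)
    (hX : ∀ k, MemX A p (fun x => tentInt k (w.1 x), fun x => tent k (w.1 x) • w.2 x)) :
    MemX A p (posPair w) := by
  have hmi : AEStronglyMeasurable (posPair w).2 volume := by
    have : Measurable ((Set.Ioi (0 : ℝ)).indicator (1 : ℝ → ℝ)) :=
      measurable_one.indicator measurableSet_Ioi
    exact (this.comp_aemeasurable h1.1.aemeasurable).aestronglyMeasurable.smul h2.1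
  have hm0 : AEStronglyMeasurable (posPair w).1 volume :=
    (continuous_id.max continuous_const).comp_aestronglyMeasurable h1.1
  refine .of_tendsto hp hX hm0 hmi ?_ ?_
  · refine tendsto_eLpNorm_zero_of_dominated hp (b := fun x => 2 * |w.1 x|) (fun n => ?_)
      (h1.norm.const_mul 2) (fun n => .of_forall fun x => ?_) (.of_forall fun x => ?_)
    · exact (hX n).memLp.1.sub hm0
    · refine (norm_sub_le _ _).trans ?_
      have h3 := abs_tentInt_le n (w.1 x)
      have h4 : max (w.1 x) 0 ≤ |w.1 x| := max_le (le_abs_self _) (abs_nonneg _)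
      have h5 : ‖max (w.1 x) 0‖ ≤ |w.1 x| := by
        rw [Real.norm_eq_abs, abs_of_nonneg (le_max_right _ _)]; exact h4
      simp only [posPair]
      rw [Real.norm_eq_abs]
      linarith
    · have := (tendsto_tentInt (w.1 x)).sub_const (max (w.1 x) 0)
      simpa [posPair] using this
  · refine tendsto_eLpNorm_zero_of_dominated hp (b := fun x => 2 * ‖w.2 x‖) (fun n => ?_)
      (h2.norm.const_mul 2) (fun n => .of_forall fun x => ?_) (.of_forall fun x => ?_)
    · exact (hX n).memLp_grad.1.sub hmi
    · simp only [posPair, Pi.sub_apply, ← sub_smul, norm_smul]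
      gcongr
      refine (norm_sub_le _ _).trans ?_
      have h3 := abs_tent_le n (w.1 x)
      have h4 := norm_indicator_le_norm_self (s := Set.Ioi (0:ℝ)) (1 : ℝ → ℝ) (w.1 x)
      simp only [Pi.one_apply, norm_one] at h4
      rw [Real.norm_eq_abs]
      linarith
    · have := ((tendsto_tent (w.1 x)).sub_const
        ((Set.Ioi (0 : ℝ)).indicator (1 : ℝ → ℝ) (w.1 x))).smul_const (w.2 x)
      simpa [posPair, sub_smul] using this

theorem MemX.tent (hp : 1 < p) (hΩ : IsOpen Ω) {w : (RN N → ℝ) × (RN N → RN N)}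
    (hw : MemX Ω p w) (k : ℕ) :
    MemX Ω p (fun x => tentInt k (w.1 x), fun x => MixedEigen.tent k (w.1 x) • w.2 x) :=
  hw.comp hp hΩ (hasDerivAt_tentInt k) (continuous_tent k) (abs_tent_le k) (by simp [tentInt])

theorem MemX.posPair (hp : 1 < p) (hΩ : IsOpen Ω) {w : (RN N → ℝ) × (RN N → RN N)}
    (hw : MemX Ω p w) : MemX Ω p (posPair w) :=
  memX_posPair_of_tent hp hw.memLp hw.memLp_grad (hw.tent hp hΩ)

end PosPart

end MixedEigen

namespace MixedEigen

/-! ### Positive parts of continuous functions on the open positivity set -/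

section PosSet

variable {N : ℕ} {Ω : Set (RN N)} {p : ℝ}

/-- The cutoff equals one in a neighbourhood of each point of `K`, so that its gradient vanishes on
`K` as well. -/
theorem exists_cutoff {K A : Set (RN N)} (hK : IsCompact K) (hA : IsOpen A) (hKA : K ⊆ A) :
    ∃ θ : RN N → ℝ, IsTestFunction A θ ∧ (∀ x, 0 ≤ θ x) ∧ ∀ x ∈ K, θ =ᶠ[𝓝 x] 1 := by
  obtain ⟨L, hL, hKL, hLA⟩ := exists_compact_between hK hA hKA
  obtain ⟨δ, hδ, hδA⟩ := hL.exists_cthickening_subset_open hA hLA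
  obtain ⟨θ, hθ, hr, hs, h1⟩ := exists_contMDiff_support_eq_eq_one_iff
    (modelWithCornersSelf ℝ (RN N)) (s := Metric.thickening δ L) (t := L)
    Metric.isOpen_thickening hL.isClosed (Metric.self_subset_thickening hδ L)
  have hsub : tsupport θ ⊆ Metric.cthickening δ L := by
    rw [tsupport, hs]; exact Metric.closure_thickening_subset_cthickening δ L
  refine ⟨θ, ⟨hθ.contDiff, HasCompactSupport.intro (hL.cthickening (r := δ)) fun x hx => ?_, hsub.trans hδA⟩,
    fun x => ?_, fun x hx => ?_⟩
  · by_contra h; exact hx (hsub (subset_tsupport _ h))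
  · exact (hr (Set.mem_range_self x)).1
  · filter_upwards [isOpen_interior.mem_nhds (hKL hx)] with y hy
    exact (h1 y).1 (interior_subset hy)

theorem exists_norm_deriv_smoothTransition_le : ∃ C, ∀ t, |deriv Real.smoothTransition t| ≤ C := by
  have hc : Continuous (deriv Real.smoothTransition) :=
    (Real.smoothTransition.contDiff (n := 1)).continuous_deriv le_rfl
  have hs : HasCompactSupport (deriv Real.smoothTransition) := by
    refine HasCompactSupport.intro (isCompact_Icc (a := (0 : ℝ)) (b := 1)) fun t ht => ?_
    rw [Set.mem_Icc, not_and_or, not_le, not_le] at ht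
    rcases ht with ht | ht
    · have : Real.smoothTransition =ᶠ[𝓝 t] fun _ => 0 := by
        filter_upwards [Iio_mem_nhds ht] with r hr
        exact Real.smoothTransition.zero_of_nonpos (le_of_lt hr)
      rw [this.deriv_eq, deriv_const]
    · have : Real.smoothTransition =ᶠ[𝓝 t] fun _ => 1 := by
        filter_upwards [Ioi_mem_nhds ht] with r hr
        exact Real.smoothTransition.one_of_one_le (le_of_lt hr)
      rw [this.deriv_eq, deriv_const]
  exact hc.bounded_above_of_compact_support hs

theorem isOpen_posSet (hΩ : IsOpen Ω) {u : RN N → ℝ} (hu : ContinuousOn u Ω) :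
    IsOpen (posSet Ω u) := hu.isOpen_inter_preimage hΩ isOpen_Ioi

/-- The product of a truncation of `u` with a test function, for `u` continuous, is an
element of `X_0` of the positivity set. -/
theorem MemX.tent_mul_of_continuousOn (hp : 1 < p) (hΩ : IsOpen Ω)
    {w : (RN N → ℝ) × (RN N → RN N)} (hw : MemX Ω p w) (hc : ContinuousOn w.1 Ω) (k : ℕ)
    {η : RN N → ℝ} (hη : IsTestFunction Ω η) :
    MemX (posSet Ω w.1) p (fun x => η x * tentInt k (w.1 x),
      fun x => η x • MixedEigen.tent k (w.1 x) • w.2 x + tentInt k (w.1 x) • gradient η x) := by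
  have hA := isOpen_posSet hΩ hc
  have hz := (hw.tent hp hΩ k).mul_left hp hΩ hη.isC1c
  -- Outside `K` the product and its gradient vanish. By continuity of `u` on the support of `η`,
  -- `K` is a compact subset of the positivity set, so multiplying by a cutoff that is one near `K`
  -- changes nothing but places the product in the smaller space.
  set K := tsupport η ∩ {x | 1 ≤ k * w.1 x}
  have hK : IsCompact K := by
    refine hη.compact.isCompact.of_isClosed_subset ?_ Set.inter_subset_left
    exact ((continuousOn_const.mul (hc.mono hη.support_subset))).preimage_isClosed_of_isClosed
      (isClosed_tsupport _) isClosed_Ici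
  have hKA : K ⊆ posSet Ω w.1 := fun x hx => by
    refine ⟨hη.support_subset hx.1, ?_⟩
    by_contra h
    have h1 : 1 ≤ (k : ℝ) * w.1 x := hx.2
    have : (k : ℝ) * w.1 x ≤ 0 := mul_nonpos_of_nonneg_of_nonpos (by positivity) (not_lt.1 h)
    linarith
  obtain ⟨θ, hθ, -, hθ1⟩ := exists_cutoff hK hA hKA
  refine (hz.mul_left hp hA hθ.isC1c).congr_ae (.of_forall fun x => ?_) (.of_forall fun x => ?_)
  all_goals
    by_cases hx : x ∈ K
    · have h1 := hθ1 x hx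
      have h2 : gradient θ x = 0 := by rw [h1.gradient_eq]; exact gradient_const x _
      simp [h1.self_of_nhds, h2]
    · have h2 : x ∉ tsupport η ∨ (k : ℝ) * w.1 x ≤ 1 := by
        by_contra! h; exact hx ⟨h.1, h.2.le⟩
      rcases h2 with h2 | h2
      · simp [image_eq_zero_of_notMem_tsupport h2, gradient_eq_zero_of_notMem_tsupport h2]
      · simp [tentInt_eq_zero h2, tent_eq_zero h2]

/-- If `u ∈ X_0(Ω)` is continuous in `Ω`, then `u⁺` belongs to `X_0` of the positivity set. -/
theorem MemX.posPair_of_continuousOn (hp : 1 < p) (hΩ : IsOpen Ω)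
    {w : (RN N → ℝ) × (RN N → RN N)} (hw : MemX Ω p w) (hc : ContinuousOn w.1 Ω) :
    MemX (posSet Ω w.1) p (MixedEigen.posPair w) := by
  have hP : 1 ≤ ENNReal.ofReal p := by simpa using hp.le
  refine memX_posPair_of_tent hp hw.memLp hw.memLp_grad fun k => ?_
  obtain ⟨φ, hφ, t1, t2, hae⟩ := hw.exists_seq hp
  obtain ⟨D, hD⟩ := exists_norm_deriv_smoothTransition_le
  have hD0 : 0 ≤ D := (abs_nonneg _).trans (hD 0)
  -- The cutoffs are built from the approximants of `u` itself. They have compact support in `Ω`,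
  -- and wherever the truncation of `u` does not vanish they are almost everywhere eventually one,
  -- with eventually zero gradient. No regularity of the boundary is needed.
  set η : ℕ → RN N → ℝ := fun n x => Real.smoothTransition (k * φ n x) with hηdef
  have hη : ∀ n, IsTestFunction Ω (η n) := fun n => by
    have h0 : Real.smoothTransition (k * (0 : ℝ)) = 0 := by simp
    refine ⟨Real.smoothTransition.contDiff.comp (contDiff_const.mul (hφ n).smooth), ?_, ?_⟩
    · exact (hφ n).compact.comp_left (g := fun t => Real.smoothTransition (k * t)) h0
    · exact (closure_mono (Function.support_comp_subset
        (g := fun t => Real.smoothTransition (k * t)) h0 (φ n))).trans (hφ n).support_subset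
  set H : ℝ → ℝ := fun t => deriv Real.smoothTransition (k * t) * k with hH
  have hst1 : ContDiff ℝ 1 Real.smoothTransition := Real.smoothTransition.contDiff
  have hHc : Continuous H :=
    ((hst1.continuous_deriv le_rfl).comp (continuous_const.mul continuous_id)).mul continuous_const
  have hg : ∀ n x, gradient (η n) x = H (φ n x) • gradient (φ n) x := fun n x => by
    refine gradient_comp (F := fun t => Real.smoothTransition (k * t)) ?_
      ((hφ n).isC1c.differentiable x)
    have h1 : HasDerivAt (fun t : ℝ => (k : ℝ) * t) k (φ n x) := by
      simpa using (hasDerivAt_id (φ n x)).const_mul (k : ℝ)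
    exact (hst1.differentiable one_ne_zero _).hasDerivAt.comp (φ n x) h1
  have hηm : ∀ n, AEStronglyMeasurable (η n) volume := fun n => (hη n).isC1c.aesm
  have hT := hw.tent hp hΩ k
  have htm : AEStronglyMeasurable (fun x => tentInt k (w.1 x)) volume := hT.memLp.1
  have hHm : ∀ n, AEStronglyMeasurable (fun x => H (φ n x)) volume := fun n =>
    hHc.comp_aestronglyMeasurable (hφ n).isC1c.aesm
  have hHle : ∀ t, |H t| ≤ D * k := fun t => by
    rw [hH, abs_mul, abs_of_nonneg (by positivity : (0:ℝ) ≤ k)]; gcongr; exact hD _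
  have hη1 : ∀ n x, |η n x - 1| ≤ 1 := fun n x => by
    have h1 := Real.smoothTransition.nonneg (k * φ n x)
    have h2 := Real.smoothTransition.le_one (k * φ n x)
    rw [abs_le]; constructor <;> simp only [hηdef] <;> linarith
  -- where `tentInt k (u x) ≠ 0`, `k u x > 1` and the cutoffs are eventually one
  have hev : ∀ᵐ x, (k * w.1 x ≤ 1) ∨ (∀ᶠ n in atTop, 1 < k * φ n x) := by
    filter_upwards [hae] with x hx
    rcases le_or_gt (k * w.1 x) 1 with h | h
    · exact .inl h
    · exact .inr ((hx.const_mul (k : ℝ)).eventually_const_lt h)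
  refine .of_tendsto hp (fun n => hw.tent_mul_of_continuousOn hp hΩ hc k (hη n)) htm
    hT.memLp_grad.1 ?_ ?_
  · refine tendsto_eLpNorm_zero_of_dominated hp (b := fun x => |tentInt k (w.1 x)|)
      (fun n => ((hηm n).mul htm).sub htm) hT.memLp.norm (fun n => .of_forall fun x => ?_) ?_
    · have : η n x * tentInt k (w.1 x) - tentInt k (w.1 x)
          = (η n x - 1) * tentInt k (w.1 x) := by ring
      simp only [Pi.sub_apply, this]
      rw [norm_mul]
      exact mul_le_of_le_one_left (abs_nonneg _) (hη1 n x)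
    · filter_upwards [hev] with x hx
      rcases hx with hx | hx
      · simp [tentInt_eq_zero hx]
      · refine tendsto_const_nhds.congr' ?_
        filter_upwards [hx] with n hn
        simp [hηdef, Real.smoothTransition.one_of_one_le hn.le]
  -- With `∇η = H(φ n) ∇φ n`, the gradient error splits into `(η - 1) T`, the truncation times `H(φ
  -- n) ∇u`, and the truncation times `H(φ n) (∇φ n - ∇u)`. The first two tend to zero by
  -- domination, the third by norm convergence of the gradients.
  · set T : RN N → RN N := fun x => MixedEigen.tent k (w.1 x) • w.2 x
    have a1 : Tendsto (fun n => eLpNorm (fun x => (η n x - 1) • T x) (ENNReal.ofReal p) volume)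
        atTop (𝓝 0) := by
      refine tendsto_eLpNorm_zero_of_dominated hp (b := fun x => ‖T x‖)
        (fun n => ((hηm n).sub aestronglyMeasurable_const).smul hT.memLp_grad.1) hT.memLp_grad.norm
        (fun n => .of_forall fun x => ?_) ?_
      · rw [norm_smul]
        exact mul_le_of_le_one_left (norm_nonneg _) (hη1 n x)
      · filter_upwards [hev] with x hx
        rcases hx with hx | hx
        · simp [T, tent_eq_zero hx]
        · refine tendsto_const_nhds.congr' ?_
          filter_upwards [hx] with n hn
          simp [hηdef, Real.smoothTransition.one_of_one_le hn.le]
    have a2 : Tendsto (fun n => eLpNorm (fun x => (tentInt k (w.1 x) * H (φ n x)) • w.2 x)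
        (ENNReal.ofReal p) volume) atTop (𝓝 0) := by
      refine tendsto_eLpNorm_zero_of_dominated hp (b := fun x => (k * (D * k)) * ‖w.2 x‖)
        (fun n => (htm.mul (hHm n)).smul hw.memLp_grad.1) (hw.memLp_grad.norm.const_mul _)
        (fun n => .of_forall fun x => ?_) ?_
      · rw [norm_smul, norm_mul]
        gcongr
        · exact tentInt_le k _
        · exact hHle _
      · filter_upwards [hev] with x hx
        rcases hx with hx | hx
        · simp [tentInt_eq_zero hx]
        · refine tendsto_const_nhds.congr' ?_
          filter_upwards [hx] with n hn
          have : Real.smoothTransition =ᶠ[𝓝 (k * φ n x)] fun _ => 1 := by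
            filter_upwards [Ioi_mem_nhds hn] with r hr
            exact Real.smoothTransition.one_of_one_le (le_of_lt hr)
          simp [H, this.deriv_eq]
    have a3 : Tendsto (fun n => eLpNorm (fun x => (tentInt k (w.1 x) * H (φ n x)) •
        (gradient (φ n) - w.2) x) (ENNReal.ofReal p) volume) atTop (𝓝 0) := by
      have h2 := ENNReal.Tendsto.const_mul t2
        (.inr (ENNReal.ofReal_ne_top (r := k * (D * k))))
      rw [mul_zero] at h2
      refine tendsto_of_tendsto_of_tendsto_of_le_of_le tendsto_const_nhds h2
        (fun _ => zero_le) fun n => ?_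
      refine eLpNorm_le_mul_eLpNorm_of_ae_le_mul (.of_forall fun x => ?_) _
      rw [norm_smul, norm_mul]
      gcongr
      · exact tentInt_le k _
      · exact hHle _
    have a4 := (a1.add a2).add a3
    simp only [add_zero] at a4
    refine tendsto_of_tendsto_of_tendsto_of_le_of_le tendsto_const_nhds a4
      (fun _ => zero_le) fun n => ?_
    have m1 : AEStronglyMeasurable (fun x => (η n x - 1) • T x) volume :=
      ((hηm n).sub aestronglyMeasurable_const).smul hT.memLp_grad.1
    have m2 : AEStronglyMeasurable (fun x => (tentInt k (w.1 x) * H (φ n x)) • w.2 x) volume :=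
      (htm.mul (hHm n)).smul hw.memLp_grad.1
    have m3 : AEStronglyMeasurable (fun x => (tentInt k (w.1 x) * H (φ n x)) •
        (gradient (φ n) - w.2) x) volume :=
      (htm.mul (hHm n)).smul ((hφ n).isC1c.aesm_gradient.sub hw.memLp_grad.1)
    refine le_trans (le_of_eq ?_) ((eLpNorm_add_le (m1.add m2) m3 hP).trans
      (add_le_add (eLpNorm_add_le m1 m2 hP) le_rfl))
    congr 1
    ext1 x
    simp only [Pi.add_apply, Pi.sub_apply, hg, T]
    module

end PosSet

end MixedEigen

namespace MixedEigen

/-- Fatou's lemma, in the form that carries norm inequalities from test functions to their closure.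
-/
theorem eLpNorm_le_of_tendsto_ae {α F : Type*} [MeasurableSpace α] {μ : Measure α}
    [NormedAddCommGroup F] {P : ℝ≥0∞} {f : ℕ → α → F} {g : α → F} {c : ℕ → ℝ≥0∞} {c₀ : ℝ≥0∞}
    (hf : ∀ n, AEStronglyMeasurable (f n) μ)
    (h : ∀ᵐ x ∂μ, Tendsto (fun n => f n x) atTop (𝓝 (g x)))
    (hle : ∀ n, eLpNorm (f n) P μ ≤ c n) (hc : Tendsto c atTop (𝓝 c₀)) :
    eLpNorm g P μ ≤ c₀ :=
  (Lp.eLpNorm_lim_le_liminf_eLpNorm hf g h).trans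
    ((liminf_le_liminf (.of_forall hle)).trans hc.liminf_eq.le)

/-! ### Sobolev and Poincaré inequalities -/

section Sobolev

variable {N : ℕ} {Ω : Set (RN N)} {p : ℝ}

theorem eLpNorm_gradient (φ : RN N → ℝ) (P : ℝ≥0∞) (μ : Measure (RN N)) :
    eLpNorm (gradient φ) P μ = eLpNorm (fderiv ℝ φ) P μ :=
  eLpNorm_congr_norm_ae (.of_forall fun x => norm_gradient_eq φ x)

theorem MemX.tendsto_eLpNorm (hp : 1 < p) {w : (RN N → ℝ) × (RN N → RN N)} (hw : MemX Ω p w)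
    {φ : ℕ → RN N → ℝ} (hφ : ∀ n, IsTestFunction Ω (φ n))
    (t2 : Tendsto (fun n => eLpNorm (gradient (φ n) - w.2) (ENNReal.ofReal p) volume)
      atTop (𝓝 0)) :
    Tendsto (fun n => eLpNorm (gradient (φ n)) (ENNReal.ofReal p) volume) atTop
      (𝓝 (eLpNorm w.2 (ENNReal.ofReal p) volume)) :=
  tendsto_eLpNorm_of_tendsto_sub (by simpa using hp.le) (fun n => (hφ n).isC1c.aesm_gradient)
    hw.memLp_grad t2

/-- Sobolev inequality. -/
theorem exists_sobolev (hp : 1 < p) (hpN : p < N) :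
    ∃ S : ℝ, 0 < S ∧ ∀ (Ω : Set (RN N)) (w : (RN N → ℝ) × (RN N → RN N)), MemX Ω p w →
      eLpNorm w.1 (ENNReal.ofReal (N * p / (N - p))) volume
        ≤ ENNReal.ofReal S * eLpNorm w.2 (ENNReal.ofReal p) volume := by
  have hp0 : 0 < p := by linarith
  have hN0 : 0 < (N : ℝ) := by linarith
  have hq0 : 0 < N * p / (N - p) := div_pos (by positivity) (by linarith)
  -- Adding one makes the constant strictly positive; its inverse is needed in the lower bound.
  set S : ℝ := (SNormLESNormFDerivOfEqConst ℝ (volume : Measure (RN N)) p.toNNReal : ℝ) + 1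
  have hS : 0 < S := by positivity
  refine ⟨S, hS, fun Ω w hw => ?_⟩
  obtain ⟨φ, hφ, t1, t2, hae⟩ := hw.exists_seq hp
  refine eLpNorm_le_of_tendsto_ae (fun n => (hφ n).isC1c.aesm) hae (fun n => ?_)
    (ENNReal.Tendsto.const_mul (hw.tendsto_eLpNorm hp hφ t2) (.inr ENNReal.ofReal_ne_top))
  have h := eLpNorm_le_eLpNorm_fderiv_of_eq (μ := volume) (p := p.toNNReal)
    (p' := (N * p / (N - p)).toNNReal) (hφ n).isC1c.smooth (hφ n).compact
    (by simpa using hp.le) (by simpa using hN0) (by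
      rw [NNReal.coe_inv, Real.coe_toNNReal _ hq0.le, Real.coe_toNNReal _ hp0.le, finrank_euclideanSpace_fin]
      have : (N : ℝ) - p ≠ 0 := by linarith
      field_simp)
  rw [← eLpNorm_gradient] at h
  refine h.trans ?_
  gcongr
  · rw [← ENNReal.ofReal_coe_nnreal]
    exact ENNReal.ofReal_le_ofReal (by simp [S])
  · exact le_rfl

/-- Poincaré inequality. -/
theorem exists_poincare (hp : 1 < p) (hpN : p < N) (hΩ : Bornology.IsBounded Ω) :
    ∃ C : ℝ, 0 < C ∧ ∀ (w : (RN N → ℝ) × (RN N → RN N)), MemX Ω p w →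
      eLpNorm w.1 (ENNReal.ofReal p) volume
        ≤ ENNReal.ofReal C * eLpNorm w.2 (ENNReal.ofReal p) volume := by
  have hp0 : 0 < p := by linarith
  set C : ℝ := (eLpNormLESNormFDerivOfLeConst ℝ (volume : Measure (RN N)) Ω
    p.toNNReal p.toNNReal : ℝ) + 1
  have hC : 0 < C := by positivity
  refine ⟨C, hC, fun w hw => ?_⟩
  obtain ⟨φ, hφ, t1, t2, hae⟩ := hw.exists_seq hp
  refine eLpNorm_le_of_tendsto_ae (fun n => (hφ n).isC1c.aesm) hae (fun n => ?_)
    (ENNReal.Tendsto.const_mul (hw.tendsto_eLpNorm hp hφ t2) (.inr ENNReal.ofReal_ne_top))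
  have h := eLpNorm_le_eLpNorm_fderiv (μ := volume) (p := p.toNNReal)
    (hφ n).isC1c.smooth ((subset_tsupport _).trans (hφ n).support_subset)
    (by simpa using hp.le) (by
      rw [finrank_euclideanSpace_fin, ← NNReal.coe_lt_coe, Real.coe_toNNReal _ hp0.le]
      simpa using hpN) hΩ
  rw [← eLpNorm_gradient] at h
  refine h.trans ?_
  gcongr
  · rw [← ENNReal.ofReal_coe_nnreal]
    exact ENNReal.ofReal_le_ofReal (by simp [C])
  · exact le_rfl

end Sobolev

/-! ### The translation estimate -/

section Translation

variable {N : ℕ} {p : ℝ}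

/-- Jensen's inequality, from the monotonicity of `L^p` norms in the exponent on a probability
space. -/
theorem enorm_integral_rpow_le {α : Type*} [MeasurableSpace α] {μ : Measure α}
    [IsProbabilityMeasure μ] (hp : 1 < p) {f : α → ℝ} (hf : AEStronglyMeasurable f μ) :
    ‖∫ x, f x ∂μ‖ₑ ^ p ≤ ∫⁻ x, ‖f x‖ₑ ^ p ∂μ := by
  have hp0 : 0 < p := by linarith
  rw [lintegral_enorm_rpow_eq hp]
  gcongr
  refine (enorm_integral_le_lintegral_enorm f).trans ?_
  rw [← eLpNorm_one_eq_lintegral_enorm]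
  exact eLpNorm_le_eLpNorm_of_exponent_le (by simpa using hp.le) hf

/-- Write the difference as the integral of the derivative along the segment, apply Jensen, exchange
the integrals, and use translation invariance. Both the fractional seminorm and the mollification
error rest on this. -/
theorem lintegral_translate_sub_le (hp : 1 < p) {U : Set (RN N)} {φ : RN N → ℝ}
    (hφ : IsC1c U φ) (z : RN N) :
    ∫⁻ x, ‖φ (x + z) - φ x‖ₑ ^ p ≤ ‖z‖ₑ ^ p * ∫⁻ x, ‖gradient φ x‖ₑ ^ p := by
  have hp0 : 0 < p := by linarith
  have hgc := hφ.continuous_gradient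
  set I : Measure ℝ := volume.restrict (Set.Ioc 0 1)
  have : IsProbabilityMeasure I := ⟨by simp [I]⟩
  have hfd := hφ.smooth.continuous_fderiv one_ne_zero
  have h1 : ∀ x, ‖φ (x + z) - φ x‖ₑ ^ p
      ≤ ∫⁻ t, ‖z‖ₑ ^ p * ‖gradient φ (x + t • z)‖ₑ ^ p ∂I := fun x => by
    have hd : ∀ t : ℝ, HasDerivAt (fun t : ℝ => φ (x + t • z)) (fderiv ℝ φ (x + t • z) z) t := by
      intro t
      have h2 : HasDerivAt (fun t : ℝ => x + t • z) z t := by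
        simpa using ((hasDerivAt_id t).smul_const z).const_add x
      exact (hφ.differentiable (x + t • z)).hasFDerivAt.comp_hasDerivAt t h2
    have hc : Continuous fun t : ℝ => fderiv ℝ φ (x + t • z) z :=
      (hfd.comp (by fun_prop)).clm_apply continuous_const
    have h3 : ∫ t, fderiv ℝ φ (x + t • z) z ∂I = φ (x + z) - φ x := by
      rw [← intervalIntegral.integral_of_le zero_le_one,
        intervalIntegral.integral_eq_sub_of_hasDerivAt (fun t _ => hd t)
          (hc.intervalIntegrable _ _)]
      simp
    rw [← h3]
    refine (enorm_integral_rpow_le hp hc.aestronglyMeasurable).trans (lintegral_mono fun t => ?_)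
    rw [← ENNReal.mul_rpow_of_nonneg _ _ hp0.le]
    gcongr
    rw [← inner_gradient_eq, mul_comm, ← ofReal_norm, ← ofReal_norm, ← ofReal_norm,
      ← ENNReal.ofReal_mul (norm_nonneg _)]
    exact ENNReal.ofReal_le_ofReal (norm_inner_le_norm _ _)
  calc ∫⁻ x, ‖φ (x + z) - φ x‖ₑ ^ p
      ≤ ∫⁻ x, ∫⁻ t, ‖z‖ₑ ^ p * ‖gradient φ (x + t • z)‖ₑ ^ p ∂I := lintegral_mono h1
    _ = ∫⁻ t, ∫⁻ x, ‖z‖ₑ ^ p * ‖gradient φ (x + t • z)‖ₑ ^ p ∂volume ∂I := by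
        refine lintegral_lintegral_swap (Measurable.aemeasurable ?_)
        have : Continuous fun y : RN N × ℝ => gradient φ (y.1 + y.2 • z) := by fun_prop
        exact measurable_const.mul (this.enorm.measurable.pow_const _)
    _ = ∫⁻ t, ‖z‖ₑ ^ p * ∫⁻ x, ‖gradient φ x‖ₑ ^ p ∂volume ∂I := by
        refine lintegral_congr fun t => ?_
        rw [lintegral_const_mul _ (by
          have : Continuous fun y : RN N => gradient φ (y + t • z) := by fun_prop
          exact this.enorm.measurable.pow_const _)]
        rw [lintegral_add_right_eq_self (fun x => ‖gradient φ x‖ₑ ^ p)]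
    _ = _ := by simp

end Translation

/-! ### The fractional seminorm as an `L^p` norm of differences -/

section Seminorm

variable {N : ℕ} {s p : ℝ}

/-- The kernel `|z|^{-(N+ps)}`. -/
noncomputable def kern (N : ℕ) (s p : ℝ) (z : RN N) : ℝ≥0∞ :=
  ENNReal.ofReal (1 / ‖z‖ ^ ((N : ℝ) + p * s))

/-- The measure `|x-y|^{-(N+ps)} dx dy`. -/
noncomputable def kernMeasure (N : ℕ) (s p : ℝ) : Measure (RN N × RN N) :=
  volume.withDensity fun y => kern N s p (y.1 - y.2)

/-- The difference `u(x) - u(y)`. -/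
def pairDiff {N : ℕ} (u : RN N → ℝ) : RN N × RN N → ℝ := fun y => u y.1 - u y.2

theorem measurable_kern : Measurable (kern N s p) := by unfold kern; fun_prop

theorem kernMeasure_absolutelyContinuous : kernMeasure N s p ≪ volume :=
  withDensity_absolutelyContinuous _ _

theorem aestronglyMeasurable_pairDiff {u : RN N → ℝ} (hu : AEStronglyMeasurable u volume) :
    AEStronglyMeasurable (pairDiff u) (kernMeasure N s p) := by
  have h1 : AEStronglyMeasurable (pairDiff u) (volume.prod volume) := hu.comp_fst.sub hu.comp_snd
  exact h1.mono_ac kernMeasure_absolutelyContinuous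

theorem ae_kernMeasure_of_ae {P : RN N → Prop} (h : ∀ᵐ x, P x) :
    ∀ᵐ y ∂(kernMeasure N s p), P y.1 ∧ P y.2 := by
  refine kernMeasure_absolutelyContinuous.ae_le ?_
  have h1 := (Measure.quasiMeasurePreserving_fst (μ := (volume : Measure (RN N)))
    (ν := (volume : Measure (RN N)))).ae h
  have h2 := (Measure.quasiMeasurePreserving_snd (μ := (volume : Measure (RN N)))
    (ν := (volume : Measure (RN N)))).ae h
  exact h1.and h2

/-- The integrand is `|z|^(p - ps - N)`, integrable at the origin exactly because `s < 1`. -/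
theorem lintegral_kern_ball_lt_top (hN : 0 < N) (hs1 : s < 1) (hp : 1 < p) :
    ∫⁻ z in Metric.ball (0 : RN N) 1, kern N s p z * ‖z‖ₑ ^ p < ⊤ := by
  have hp0 : 0 < p := by linarith
  have hm : Measurable fun z : RN N => 1 / ‖z‖ ^ ((N : ℝ) + p * s) * ‖z‖ ^ p := by fun_prop
  have hα : (N : ℝ) + p * s - p < N := by nlinarith
  have hi := integrableOn_ball_of_norm_le_rpow (μ := (volume : Measure (RN N)))
    (f := fun z : RN N => 1 / ‖z‖ ^ ((N : ℝ) + p * s) * ‖z‖ ^ p) (C := 1)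
    (α := (N : ℝ) + p * s - p) (r := 1) (by simpa using Nat.one_le_iff_ne_zero.2 hN.ne') (by simpa using hα)
    (.of_forall fun z => ?_) hm.aestronglyMeasurable
  · have := hi.2
    rw [hasFiniteIntegral_iff_enorm] at this
    convert this using 3 with z
    rw [Real.enorm_eq_ofReal (by positivity), ENNReal.ofReal_mul (by positivity), kern,
      ← ENNReal.ofReal_rpow_of_nonneg (norm_nonneg _) hp0.le, ofReal_norm]
  · rw [Real.norm_eq_abs, abs_of_nonneg (by positivity), one_mul]
    rcases eq_or_ne z 0 with rfl | hz
    · rw [norm_zero, Real.zero_rpow hp0.ne', mul_zero]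
      exact Real.rpow_nonneg le_rfl _
    · have : 0 < ‖z‖ := norm_pos_iff.2 hz
      rw [one_div, ← Real.rpow_neg this.le, ← Real.rpow_add this]
      exact le_of_eq (by congr 1; ring)

/-- Decay faster than `|z|^(-N)`, because `s > 0`; compare with `(1 + |z|)^(-(N+ps))`. -/
theorem lintegral_kern_compl_ball_lt_top (hs0 : 0 < s) (hp : 1 < p) :
    ∫⁻ z in (Metric.ball (0 : RN N) 1)ᶜ, kern N s p z < ⊤ := by
  have hps : 0 < p * s := by nlinarith
  have hr : 0 < (N : ℝ) + p * s := by positivity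
  have hi := (integrable_one_add_norm (μ := (volume : Measure (RN N))) (r := (N : ℝ) + p * s)
    (by simpa using hps)).const_mul (2 ^ ((N : ℝ) + p * s))
  have h2 := hi.2
  rw [hasFiniteIntegral_iff_enorm] at h2
  refine lt_of_le_of_lt ?_ h2
  refine le_trans (setLIntegral_mono' Metric.isOpen_ball.measurableSet.compl fun z hz => ?_)
    (setLIntegral_le_lintegral _ _)
  have hz1 : 1 ≤ ‖z‖ := by simpa using hz
  have hz0 : 0 < ‖z‖ := by linarith
  rw [Real.enorm_eq_ofReal (by positivity), kern]
  refine ENNReal.ofReal_le_ofReal ?_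
  rw [Real.rpow_neg (by positivity), ← div_eq_mul_inv, ← Real.div_rpow (by norm_num) (by positivity),
    one_div, ← Real.inv_rpow hz0.le]
  refine Real.rpow_le_rpow (by positivity) ?_ hr.le
  rw [inv_eq_one_div, div_le_div_iff₀ hz0 (by positivity)]
  linarith

/-- In the variable `z = x - y` the double integral is that of the kernel against `‖φ(·+z) -
φ‖_p^p`. This is at most `|z|^p ‖∇φ‖_p^p`, used for `|z| < 1`, and at most `2^p ‖φ‖_p^p`, used for
`|z| ≥ 1`. -/
theorem exists_lintegral_pairDiff_le (hN : 0 < N) (hs0 : 0 < s) (hs1 : s < 1) (hp : 1 < p) :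
    ∃ C : ℝ≥0∞, C ≠ ⊤ ∧ ∀ (U : Set (RN N)) (φ : RN N → ℝ), IsC1c U φ →
      ∫⁻ y, ‖pairDiff φ y‖ₑ ^ p ∂(kernMeasure N s p)
        ≤ C * ((∫⁻ x, ‖φ x‖ₑ ^ p) + ∫⁻ x, ‖gradient φ x‖ₑ ^ p) := by
  have hp0 : 0 < p := by linarith
  set K1 := ∫⁻ z in Metric.ball (0 : RN N) 1, kern N s p z * ‖z‖ₑ ^ p
  set K2 := ∫⁻ z in (Metric.ball (0 : RN N) 1)ᶜ, kern N s p z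
  refine ⟨K1 + K2 * 2 ^ p, ENNReal.add_ne_top.2
    ⟨(lintegral_kern_ball_lt_top hN hs1 hp).ne, ENNReal.mul_ne_top
      (lintegral_kern_compl_ball_lt_top hs0 hp).ne
      (ENNReal.rpow_ne_top_of_nonneg hp0.le ENNReal.ofNat_ne_top)⟩, fun U φ hφ => ?_⟩
  set A := ∫⁻ x, ‖gradient φ x‖ₑ ^ p
  set B := ∫⁻ x, ‖φ x‖ₑ ^ p
  have hφc := hφ.smooth.continuous
  have hk : Measurable (kern N s p) := measurable_kern
  have hkp : Measurable fun y : RN N × RN N => kern N s p (y.1 - y.2) :=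
    hk.comp (measurable_fst.sub measurable_snd)
  have hpd : Measurable fun y : RN N × RN N => ‖pairDiff φ y‖ₑ ^ p := by
    have : Continuous fun y : RN N × RN N => pairDiff φ y := by unfold pairDiff; fun_prop
    exact this.enorm.measurable.pow_const _
  set D : RN N → ℝ≥0∞ := fun z => ∫⁻ y, ‖φ (y + z) - φ y‖ₑ ^ p
  have hmeas : Measurable fun y : RN N × RN N => kern N s p (y.1 - y.2) * ‖pairDiff φ y‖ₑ ^ p :=
    hkp.mul hpd
  have h1 : ∫⁻ y, ‖pairDiff φ y‖ₑ ^ p ∂(kernMeasure N s p) = ∫⁻ z, kern N s p z * D z := by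
    rw [kernMeasure, lintegral_withDensity_eq_lintegral_mul _ hkp hpd]
    simp only [Pi.mul_apply]
    rw [Measure.volume_eq_prod, lintegral_prod_symm' _ hmeas]
    have h2 : ∀ y : RN N, ∫⁻ x, kern N s p (x - y) * ‖pairDiff φ (x, y)‖ₑ ^ p
        = ∫⁻ z, kern N s p z * ‖φ (y + z) - φ y‖ₑ ^ p := fun y => by
      rw [← lintegral_add_right_eq_self
        (fun x => kern N s p (x - y) * ‖pairDiff φ (x, y)‖ₑ ^ p) y]
      refine lintegral_congr fun z => ?_
      simp [pairDiff, add_comm]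
    simp only [h2]
    have hm2 : Measurable fun y : RN N × RN N => kern N s p y.2 * ‖φ (y.1 + y.2) - φ y.1‖ₑ ^ p := by
      have : Continuous fun y : RN N × RN N => φ (y.1 + y.2) - φ y.1 := by fun_prop
      exact (hk.comp measurable_snd).mul (this.enorm.measurable.pow_const _)
    rw [lintegral_lintegral_swap hm2.aemeasurable]
    refine lintegral_congr fun z => ?_
    rw [lintegral_const_mul]
    have : Continuous fun y : RN N => φ (y + z) - φ y := by fun_prop
    exact this.enorm.measurable.pow_const _
  have hD1 : ∀ z, D z ≤ ‖z‖ₑ ^ p * A := fun z => lintegral_translate_sub_le hp hφ z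
  have hD2 : ∀ z, D z ≤ 2 ^ p * B := fun z => by
    have hm : AEStronglyMeasurable (fun y : RN N => φ (y + z)) volume :=
      (hφc.comp (by fun_prop)).aestronglyMeasurable
    have e1 : eLpNorm (fun y : RN N => φ (y + z)) (ENNReal.ofReal p) volume
        = eLpNorm φ (ENNReal.ofReal p) volume :=
      eLpNorm_comp_measurePreserving hφ.aesm (measurePreserving_add_right volume z)
    have e2 := eLpNorm_sub_le (μ := volume) hm hφ.aesm (p := ENNReal.ofReal p) (by simpa using hp.le)
    rw [e1, ← two_mul] at e2
    have e3 : D z = eLpNorm ((fun y : RN N => φ (y + z)) - φ) (ENNReal.ofReal p) volume ^ p :=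
      lintegral_enorm_rpow_eq hp _
    have e4 : B = eLpNorm φ (ENNReal.ofReal p) volume ^ p := lintegral_enorm_rpow_eq hp _
    rw [e3, e4, ← ENNReal.mul_rpow_of_nonneg _ _ hp0.le]
    gcongr
  rw [h1, ← lintegral_add_compl _ (Metric.isOpen_ball (x := (0 : RN N)) (ε := 1)).measurableSet,
    add_mul]
  refine add_le_add ?_ ?_
  · calc _ ≤ ∫⁻ z in Metric.ball (0 : RN N) 1, kern N s p z * ‖z‖ₑ ^ p * A :=
          lintegral_mono fun z => by rw [mul_assoc]; gcongr; exact hD1 z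
      _ = K1 * A := lintegral_mul_const _ (hk.mul (measurable_enorm.pow_const _))
      _ ≤ _ := by gcongr; exact le_add_self
  · calc _ ≤ ∫⁻ z in (Metric.ball (0 : RN N) 1)ᶜ, kern N s p z * (2 ^ p * B) :=
          lintegral_mono fun z => by gcongr; exact hD2 z
      _ = K2 * (2 ^ p * B) := lintegral_mul_const _ hk
      _ ≤ _ := by rw [mul_assoc]; gcongr; exact le_self_add

/-- `W^{1,p}` controls the fractional seminorm. -/
theorem exists_eLpNorm_pairDiff_le (hN : 0 < N) (hs0 : 0 < s) (hs1 : s < 1) (hp : 1 < p) :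
    ∃ C : ℝ≥0∞, C ≠ ⊤ ∧ ∀ (Ω : Set (RN N)) (w : (RN N → ℝ) × (RN N → RN N)), MemX Ω p w →
      eLpNorm (pairDiff w.1) (ENNReal.ofReal p) (kernMeasure N s p)
        ≤ C * (eLpNorm w.1 (ENNReal.ofReal p) volume + eLpNorm w.2 (ENNReal.ofReal p) volume) := by
  have hp0 : 0 < p := by linarith
  obtain ⟨C, hC, h⟩ := exists_lintegral_pairDiff_le hN hs0 hs1 hp
  -- The factor two comes from `a^p + b^p ≤ 2 (a + b)^p`.
  refine ⟨(C * 2) ^ p⁻¹, ENNReal.rpow_ne_top_of_nonneg (by positivity)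
    (ENNReal.mul_ne_top hC ENNReal.ofNat_ne_top), fun Ω w hw => ?_⟩
  obtain ⟨φ, hφ, t1, t2, hae⟩ := hw.exists_seq hp
  have t1' := tendsto_eLpNorm_of_tendsto_sub (by simpa using hp.le : 1 ≤ ENNReal.ofReal p)
    (fun n => (hφ n).isC1c.aesm) hw.memLp t1
  refine eLpNorm_le_of_tendsto_ae
    (fun n => aestronglyMeasurable_pairDiff (hφ n).isC1c.aesm) ?_ (fun n => ?_)
    (ENNReal.Tendsto.const_mul (t1'.add (hw.tendsto_eLpNorm hp hφ t2)) (.inr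
      (ENNReal.rpow_ne_top_of_nonneg (by positivity)
        (ENNReal.mul_ne_top hC ENNReal.ofNat_ne_top))))
  · filter_upwards [ae_kernMeasure_of_ae hae] with y hy
    exact hy.1.sub hy.2
  · have h2 := h Ω (φ n) (hφ n).isC1c
    have e1 := lintegral_enorm_rpow_eq hp (μ := volume) (φ n)
    have e2 := lintegral_enorm_rpow_eq hp (μ := volume) (gradient (φ n))
    have e3 := lintegral_enorm_rpow_eq hp (μ := kernMeasure N s p) (pairDiff (φ n))
    rw [e1, e2, e3] at h2
    rw [← ENNReal.rpow_le_rpow_iff hp0, ENNReal.mul_rpow_of_nonneg _ _ hp0.le,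
      ENNReal.rpow_inv_rpow hp0.ne', mul_assoc]
    refine h2.trans ?_
    rw [two_mul]
    gcongr
    · exact le_self_add
    · exact le_add_self

theorem MemX.memLp_pairDiff {Ω : Set (RN N)} (hN : 0 < N) (hs0 : 0 < s) (hs1 : s < 1)
    (hp : 1 < p) {w : (RN N → ℝ) × (RN N → RN N)} (hw : MemX Ω p w) :
    MemLp (pairDiff w.1) (ENNReal.ofReal p) (kernMeasure N s p) := by
  obtain ⟨C, hC, h⟩ := exists_eLpNorm_pairDiff_le hN hs0 hs1 hp
  exact ⟨aestronglyMeasurable_pairDiff hw.memLp.1, (h Ω w hw).trans_lt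
    (ENNReal.mul_lt_top hC.lt_top (ENNReal.add_lt_top.2 ⟨hw.memLp.2, hw.memLp_grad.2⟩))⟩

end Seminorm

/-! ### Hölder's inequality with a weight -/

section Weighted

variable {α : Type*} [MeasurableSpace α] {μ : Measure α} {p : ℝ}

theorem lintegral_enorm_mul_rpow_le {F : Type*} [NormedAddCommGroup F] (hp : 1 < p) {a b : ℝ}
    (hab : a.HolderConjugate b) {h : α → ℝ}
    {f : α → F} (hh : AEStronglyMeasurable h μ) (hf : AEStronglyMeasurable f μ) :
    ∫⁻ x, ‖h x‖ₑ * ‖f x‖ₑ ^ p ∂μ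
      ≤ eLpNorm h (ENNReal.ofReal a) μ * eLpNorm f (ENNReal.ofReal (p * b)) μ ^ p := by
  have hp0 : 0 < p := by linarith
  have h1 := ENNReal.lintegral_mul_le_Lp_mul_Lq μ hab hh.enorm (hf.enorm.pow_const p)
  refine h1.trans (le_of_eq ?_)
  have hb := hab.symm.lt
  have hpb : 1 < p * b := by nlinarith
  have e1 := lintegral_enorm_rpow_eq hab.lt (μ := μ) h
  have e2 := lintegral_enorm_rpow_eq hpb (μ := μ) f
  simp only [← ENNReal.rpow_mul]
  rw [e1, e2, ← ENNReal.rpow_mul, ← ENNReal.rpow_mul, mul_one_div_cancel hab.ne_zero,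
    ENNReal.rpow_one, mul_assoc, mul_one_div_cancel hab.symm.ne_zero, mul_one]

end Weighted

end MixedEigen

namespace MixedEigen

/-! ### Rellich's compactness theorem -/

section Rellich

variable {N : ℕ} {Ω : Set (RN N)} {p : ℝ}

/-- The mollification of `φ`. -/
noncomputable def mollify (ρ : ContDiffBump (0 : RN N)) (φ : RN N → ℝ) : RN N → ℝ :=
  convolution (ρ.normed volume) φ (ContinuousLinearMap.lsmul ℝ ℝ) volume

theorem continuous_mollify (ρ : ContDiffBump (0 : RN N)) {U : Set (RN N)} {φ : RN N → ℝ}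
    (hφ : IsC1c U φ) : Continuous (mollify ρ φ) :=
  (HasCompactSupport.contDiff_convolution_left (n := 0) _ ρ.hasCompactSupport_normed
    (by simpa using ρ.continuous_normed) hφ.smooth.continuous.locallyIntegrable).continuous

/-- Mollification averages translates over a probability measure on vectors of length at most the
outer radius; Jensen and the translation estimate do the rest. The error is uniform over functions
with bounded gradient. -/
theorem eLpNorm_mollify_sub_le (hp : 1 < p) (ρ : ContDiffBump (0 : RN N)) {U : Set (RN N)}
    {φ : RN N → ℝ} (hφ : IsC1c U φ) :
    eLpNorm (mollify ρ φ - φ) (ENNReal.ofReal p) volume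
      ≤ ENNReal.ofReal ρ.rOut * eLpNorm (gradient φ) (ENNReal.ofReal p) volume := by
  have hp0 : 0 < p := by linarith
  have hc := hφ.smooth.continuous
  set d : RN N → ℝ≥0∞ := fun t => ENNReal.ofReal (ρ.normed volume t)
  have hd : Measurable d := ρ.continuous_normed.measurable.ennreal_ofReal
  set π : Measure (RN N) := volume.withDensity d
  have hπ : IsProbabilityMeasure π := ⟨by
    rw [withDensity_apply _ MeasurableSet.univ, Measure.restrict_univ,
      ← ofReal_integral_eq_lintegral_ofReal ρ.integrable_normed
        (.of_forall fun x => ρ.nonneg_normed x), ρ.integral_normed, ENNReal.ofReal_one]⟩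
  have hπr : ∀ᵐ t ∂π, ‖t‖ ≤ ρ.rOut := by
    rw [ae_withDensity_iff hd]
    refine .of_forall fun t ht => ?_
    have : t ∈ Function.support (ρ.normed volume) := fun h => ht (by simp [d, h])
    rw [ρ.support_normed_eq] at this
    exact (mem_ball_zero_iff.1 this).le
  have h1 : ∀ x, mollify ρ φ x - φ x = ∫ t, (φ (x - t) - φ x) ∂π := fun x => by
    have hb : Continuous fun t => φ (x - t) - φ x := by fun_prop
    have e1 : mollify ρ φ x = ∫ t, φ (x - t) ∂π := by
      rw [integral_withDensity_eq_integral_toReal_smul hd (.of_forall fun t => ENNReal.ofReal_lt_top)]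
      rw [mollify, convolution_def]
      refine integral_congr_ae (.of_forall fun t => ?_)
      simp [d, ENNReal.toReal_ofReal (ρ.nonneg_normed t)]
    obtain ⟨C, hC⟩ := hc.bounded_above_of_compact_support hφ.compact
    have i1 : Integrable (fun t => φ (x - t)) π :=
      Integrable.of_bound (by fun_prop) C (.of_forall fun t => hC _)
    rw [integral_sub i1 (integrable_const _), e1]
    simp
  rw [← ENNReal.rpow_le_rpow_iff hp0, ENNReal.mul_rpow_of_nonneg _ _ hp0.le,
    ← lintegral_enorm_rpow_eq hp, ← lintegral_enorm_rpow_eq hp]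
  calc ∫⁻ x, ‖(mollify ρ φ - φ) x‖ₑ ^ p
      ≤ ∫⁻ x, ∫⁻ t, ‖φ (x - t) - φ x‖ₑ ^ p ∂π := lintegral_mono fun x => by
        rw [Pi.sub_apply, h1]
        have hb : Continuous fun t => φ (x - t) - φ x := by fun_prop
        exact enorm_integral_rpow_le hp hb.aestronglyMeasurable
    _ = ∫⁻ t, ∫⁻ x, ‖φ (x - t) - φ x‖ₑ ^ p ∂volume ∂π := by
        refine lintegral_lintegral_swap (Measurable.aemeasurable ?_)
        have : Continuous fun y : RN N × RN N => φ (y.1 - y.2) - φ y.1 := by fun_prop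
        exact this.enorm.measurable.pow_const _
    _ ≤ ∫⁻ t, ENNReal.ofReal ρ.rOut ^ p * ∫⁻ x, ‖gradient φ x‖ₑ ^ p ∂volume ∂π := by
        refine lintegral_mono_ae ?_
        filter_upwards [hπr] with t ht
        have := lintegral_translate_sub_le hp hφ (-t)
        simp only [← sub_eq_add_neg, enorm_neg] at this
        refine this.trans ?_
        gcongr
        rw [← ofReal_norm]
        exact ENNReal.ofReal_le_ofReal ht
    _ = _ := by simp

theorem mollify_eq (ρ : ContDiffBump (0 : RN N)) (φ : RN N → ℝ) (x : RN N) :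
    mollify ρ φ x = ∫ y, ρ.normed volume (x - y) * φ y := by
  rw [mollify, convolution_eq_swap]; rfl

/-- For a fixed mollifier, an `L^1` bound on `φ` controls the modulus of continuity of the
mollification: the equicontinuity in an Arzelà–Ascoli argument. -/
theorem abs_mollify_sub_le (ρ : ContDiffBump (0 : RN N)) {U : Set (RN N)} {φ : RN N → ℝ}
    (hφ : IsC1c U φ) {η : ℝ} {x x' : RN N}
    (h : ∀ y, |ρ.normed volume (x - y) - ρ.normed volume (x' - y)| ≤ η) :
    |mollify ρ φ x - mollify ρ φ x'| ≤ η * ∫ y, |φ y| := by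
  have hc := hφ.smooth.continuous
  have hρ : Continuous (ρ.normed volume) := ρ.continuous_normed
  have hi : ∀ x, Integrable (fun y => ρ.normed volume (x - y) * φ y) volume := fun x =>
    Continuous.integrable_of_hasCompactSupport (by fun_prop) hφ.compact.mul_left
  have hi2 : Integrable (fun y => |φ y|) volume :=
    (hc.integrable_of_hasCompactSupport hφ.compact).abs
  rw [mollify_eq, mollify_eq, ← integral_sub (hi x) (hi x'), ← integral_const_mul]
  refine (abs_integral_le_integral_abs).trans (integral_mono ((hi x).sub (hi x')).abs
    (hi2.const_mul _) fun y => ?_)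
  simp only [← sub_mul, abs_mul]
  gcongr
  exact h y

theorem abs_mollify_le (ρ : ContDiffBump (0 : RN N)) {U : Set (RN N)} {φ : RN N → ℝ}
    (hφ : IsC1c U φ) {B : ℝ} (h : ∀ y, |ρ.normed volume y| ≤ B) (x : RN N) :
    |mollify ρ φ x| ≤ B * ∫ y, |φ y| := by
  have hc := hφ.smooth.continuous
  have hρ : Continuous (ρ.normed volume) := ρ.continuous_normed
  have hi : Integrable (fun y => ρ.normed volume (x - y) * φ y) volume :=
    Continuous.integrable_of_hasCompactSupport (by fun_prop) hφ.compact.mul_left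
  have hi2 : Integrable (fun y => |φ y|) volume :=
    (hc.integrable_of_hasCompactSupport hφ.compact).abs
  rw [mollify_eq, ← integral_const_mul]
  refine (abs_integral_le_integral_abs).trans (integral_mono hi.abs
    (hi2.const_mul _) fun y => ?_)
  simp only [abs_mul]
  gcongr
  exact h _

theorem support_mollify_subset (ρ : ContDiffBump (0 : RN N)) {φ : RN N → ℝ}
    (hφ : IsC1c Ω φ) : Function.support (mollify ρ φ) ⊆ Metric.cthickening ρ.rOut Ω := by
  refine (support_convolution_subset _).trans ?_
  rintro _ ⟨a, ha, b, hb, rfl⟩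
  rw [ρ.support_normed_eq] at ha
  have ha' : ‖a‖ < ρ.rOut := mem_ball_zero_iff.1 ha
  refine Metric.mem_cthickening_of_dist_le _ b _ _ (hφ.support_subset (subset_tsupport _ hb)) ?_
  rw [dist_eq_norm, add_sub_cancel_right]
  exact ha'.le

/-- Poincaré's inequality, followed by Hölder's inequality on the bounded set. -/
theorem exists_integral_abs_le (hp : 1 < p) (hpN : p < N) (hΩ : Bornology.IsBounded Ω) (M : ℝ) :
    ∃ M₁ : ℝ, 0 ≤ M₁ ∧ ∀ φ : RN N → ℝ, IsTestFunction Ω φ →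
      eLpNorm (gradient φ) (ENNReal.ofReal p) volume ≤ ENNReal.ofReal M → ∫ y, |φ y| ≤ M₁ := by
  have hP : 1 ≤ ENNReal.ofReal p := by simpa using hp.le
  obtain ⟨C, hC, h⟩ := exists_poincare hp hpN hΩ
  set c : ℝ≥0∞ := volume.restrict Ω Set.univ ^ (1 / (1 : ℝ≥0∞).toReal - 1 / (ENNReal.ofReal p).toReal)
  have hc : c ≠ ⊤ := by
    refine ENNReal.rpow_ne_top_of_nonneg ?_ (by simpa using hΩ.measure_lt_top.ne)
    rw [ENNReal.toReal_ofReal (by linarith), ENNReal.toReal_one, div_one, sub_nonneg,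
      div_le_one (by linarith)]
    exact hp.le
  have hfin : ENNReal.ofReal C * ENNReal.ofReal M * c ≠ ⊤ := by finiteness
  refine ⟨(ENNReal.ofReal C * ENNReal.ofReal M * c).toReal, ENNReal.toReal_nonneg,
    fun φ hφ hM => ?_⟩
  have hs : Function.support φ ⊆ Ω := (subset_tsupport _).trans hφ.support_subset
  have e1 : ∫ y, |φ y| = (eLpNorm φ 1 volume).toReal := by
    rw [eLpNorm_one_eq_lintegral_enorm, ← integral_norm_eq_lintegral_enorm hφ.isC1c.aesm]
    rfl
  rw [e1]
  refine ENNReal.toReal_mono hfin ?_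
  rw [← eLpNorm_restrict_eq_of_support_subset hs]
  refine (eLpNorm_le_eLpNorm_mul_rpow_measure_univ hP hφ.isC1c.aesm.restrict).trans ?_
  gcongr
  exact (eLpNorm_restrict_le _ _ _ _).trans ((h _ hφ.memX).trans (by gcongr))

/-- Test functions with bounded gradients can be told apart, up to `ε`, by finitely many data. -/
theorem exists_finite_discretization (hp : 1 < p) (hpN : p < N) (hΩ : Bornology.IsBounded Ω)
    {M : ℝ} (hM : 0 ≤ M) {ε : ℝ} (hε : 0 < ε) :
    ∃ (β : Type) (_ : Fintype β) (d : {φ : RN N → ℝ // IsTestFunction Ω φ ∧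
      eLpNorm (gradient φ) (ENNReal.ofReal p) volume ≤ ENNReal.ofReal M} → β),
      ∀ φ ψ, d φ = d ψ →
        eLpNorm (φ.1 - ψ.1) (ENNReal.ofReal p) volume ≤ ENNReal.ofReal ε := by
  have hP : 1 ≤ ENNReal.ofReal p := by simpa using hp.le
  obtain ⟨M₁, hM₁, hint⟩ := exists_integral_abs_le hp hpN hΩ M
  -- Each of the two mollification errors is then at most `ε / 4`, leaving `ε / 2` for comparing the
  -- mollified functions.
  set r : ℝ := ε / (4 * (M + 1))
  have hr : 0 < r := by positivity
  let ρ : ContDiffBump (0 : RN N) := ⟨r / 2, r, by linarith, by linarith⟩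
  have hrM : r * M ≤ ε / 4 := by
    simp only [r]
    rw [div_mul_eq_mul_div, div_le_div_iff₀ (by positivity) (by positivity)]
    nlinarith
  set Ω' := Metric.cthickening r Ω
  have hΩ'c : IsCompact Ω' := Metric.isCompact_of_isClosed_isBounded
    Metric.isClosed_cthickening hΩ.cthickening
  set v : ℝ≥0∞ := volume Ω' ^ (ENNReal.ofReal p).toReal⁻¹
  have hv : v ≠ ⊤ := ENNReal.rpow_ne_top_of_nonneg (by positivity) hΩ'c.measure_ne_top
  -- Two mollified functions with equal data differ by at most `(2 M₁ + 1) η`: `η` at a point of the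
  -- net, and `M₁ η` for moving each function to that point. The factor `v` converts this into an
  -- `L^p` bound.
  set η : ℝ := ε / 2 / ((2 * M₁ + 1) * (v.toReal + 1))
  have hη : 0 < η := by positivity
  have hηv : v * ENNReal.ofReal ((2 * M₁ + 1) * η) ≤ ENNReal.ofReal (ε / 2) := by
    rw [← ENNReal.ofReal_toReal hv, ← ENNReal.ofReal_mul ENNReal.toReal_nonneg]
    refine ENNReal.ofReal_le_ofReal ?_
    have : (2 * M₁ + 1) * η = ε / 2 / (v.toReal + 1) := by
      simp only [η]; field_simp
    rw [this, mul_div_assoc', div_le_iff₀ (by positivity)]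
    nlinarith [ENNReal.toReal_nonneg (a := v)]
  have hρc : Continuous (ρ.normed volume) := ρ.continuous_normed
  have hρs : HasCompactSupport (ρ.normed volume) := ρ.hasCompactSupport_normed
  obtain ⟨B, hB⟩ := hρc.bounded_above_of_compact_support hρs
  have hB0 : 0 ≤ B := (norm_nonneg _).trans (hB 0)
  obtain ⟨δ, hδ, hu⟩ := Metric.uniformContinuous_iff.1
    (hρs.uniformContinuous_of_continuous hρc) η hη
  obtain ⟨t, -, htf, htc⟩ := hΩ'c.finite_cover_balls hδ
  have : Fintype t := htf.fintype
  have : DecidableEq t := Classical.decEq _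
  obtain ⟨L, hL⟩ := exists_nat_ge (B * M₁ / η + 1)
  have hmem : ∀ φ : RN N → ℝ, IsTestFunction Ω φ →
      eLpNorm (gradient φ) (ENNReal.ofReal p) volume ≤ ENNReal.ofReal M → ∀ x,
      ⌊mollify ρ φ x / η⌋ ∈ Finset.Icc (-(L : ℤ)) L := fun φ hφ h x => by
    have h1 : |mollify ρ φ x| ≤ B * M₁ :=
      (abs_mollify_le ρ hφ.isC1c hB x).trans (by gcongr; exact hint φ hφ h)
    have h2 : |mollify ρ φ x / η| ≤ B * M₁ / η := by
      rw [abs_div, abs_of_pos hη]; gcongr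
    rw [abs_le] at h2
    rw [Finset.mem_Icc]
    constructor
    · rw [Int.le_floor]; push_cast; linarith
    · have := Int.floor_le (mollify ρ φ x / η)
      have h3 : ((⌊mollify ρ φ x / η⌋ : ℤ) : ℝ) ≤ (L : ℝ) := by linarith
      exact_mod_cast h3
  -- The data are the values of the mollified function at the points of a finite `δ`-net, rounded to
  -- multiples of `η`. The uniform bound on mollifications leaves finitely many values.
  refine ⟨t → Finset.Icc (-(L : ℤ)) L, inferInstance,
    fun φ x => ⟨⌊mollify ρ φ.1 x / η⌋, hmem φ.1 φ.2.1 φ.2.2 x⟩, ?_⟩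
  rintro ⟨φ, hφ, hφM⟩ ⟨ψ, hψ, hψM⟩ hd
  have hnet : ∀ x ∈ t, |mollify ρ φ x - mollify ρ ψ x| ≤ η := fun x hx => by
    have h1 : ⌊mollify ρ φ x / η⌋ = ⌊mollify ρ ψ x / η⌋ :=
      congrArg Subtype.val (congrFun hd ⟨x, hx⟩)
    have h2 := Int.abs_sub_lt_one_of_floor_eq_floor h1
    rw [← sub_div, abs_div, abs_of_pos hη, div_lt_one hη] at h2
    exact h2.le
  have hmod : ∀ x, ‖(mollify ρ φ - mollify ρ ψ) x‖ ≤ (2 * M₁ + 1) * η := fun x => by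
    by_cases hx : x ∈ Ω'
    · obtain ⟨y, hy, hxy⟩ := Set.mem_iUnion₂.1 (htc hx)
      have hc : ∀ z, |ρ.normed volume (x - z) - ρ.normed volume (y - z)| ≤ η := fun z => by
        refine (hu (a := x - z) (b := y - z) ?_).le
        rwa [dist_sub_right]
      have h1 := (abs_mollify_sub_le ρ hφ.isC1c hc).trans
        (mul_le_mul_of_nonneg_left (hint φ hφ hφM) hη.le)
      have h2 := (abs_mollify_sub_le ρ hψ.isC1c hc).trans
        (mul_le_mul_of_nonneg_left (hint ψ hψ hψM) hη.le)
      have h3 := hnet y hy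
      rw [Pi.sub_apply, Real.norm_eq_abs]
      rw [abs_le] at h1 h2 h3 ⊢
      constructor <;> linarith
    · have e1 : mollify ρ φ x = 0 := by
        by_contra h; exact hx (support_mollify_subset ρ hφ.isC1c h)
      have e2 : mollify ρ ψ x = 0 := by
        by_contra h; exact hx (support_mollify_subset ρ hψ.isC1c h)
      rw [Pi.sub_apply, e1, e2, sub_zero, norm_zero]
      positivity
  have hsupp : Function.support (mollify ρ φ - mollify ρ ψ) ⊆ Ω' :=
    (Function.support_sub _ _).trans (Set.union_subset (support_mollify_subset ρ hφ.isC1c)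
      (support_mollify_subset ρ hψ.isC1c))
  have hmid : eLpNorm (mollify ρ φ - mollify ρ ψ) (ENNReal.ofReal p) volume
      ≤ ENNReal.ofReal (ε / 2) := (eLpNorm_le_of_support_subset hsupp hmod _).trans hηv
  have herr : ∀ φ : RN N → ℝ, IsTestFunction Ω φ →
      eLpNorm (gradient φ) (ENNReal.ofReal p) volume ≤ ENNReal.ofReal M →
      eLpNorm (mollify ρ φ - φ) (ENNReal.ofReal p) volume ≤ ENNReal.ofReal (ε / 4) := by
    intro φ hφ h
    refine (eLpNorm_mollify_sub_le hp ρ hφ.isC1c).trans ?_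
    calc _ ≤ ENNReal.ofReal r * ENNReal.ofReal M := by gcongr
      _ = ENNReal.ofReal (r * M) := (ENNReal.ofReal_mul hr.le).symm
      _ ≤ _ := ENNReal.ofReal_le_ofReal hrM
  have m1 := (continuous_mollify ρ hφ.isC1c).aestronglyMeasurable (μ := volume)
  have m2 := (continuous_mollify ρ hψ.isC1c).aestronglyMeasurable (μ := volume)
  have hsplit : φ - ψ = (mollify ρ φ - mollify ρ ψ) - (mollify ρ φ - φ) + (mollify ρ ψ - ψ) := by
    abel
  rw [hsplit]
  refine (eLpNorm_add_le ((m1.sub m2).sub (m1.sub hφ.isC1c.aesm)) (m2.sub hψ.isC1c.aesm) hP).trans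
    ((add_le_add ((eLpNorm_sub_le (m1.sub m2) (m1.sub hφ.isC1c.aesm) hP).trans
      (add_le_add hmid (herr φ hφ hφM))) (herr ψ hψ hψM)).trans ?_)
  rw [← ENNReal.ofReal_add (by positivity) (by positivity),
    ← ENNReal.ofReal_add (by positivity) (by positivity)]
  exact ENNReal.ofReal_le_ofReal (by linarith)

/-- Rellich's theorem. -/
theorem exists_subseq_tendsto_eLpNorm (hp : 1 < p) (hpN : p < N) (hΩ : Bornology.IsBounded Ω)
    {w : ℕ → (RN N → ℝ) × (RN N → RN N)} (hw : ∀ n, MemX Ω p (w n)) {M : ℝ} (hM : 0 ≤ M)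
    (h : ∀ n, eLpNorm (w n).2 (ENNReal.ofReal p) volume ≤ ENNReal.ofReal M) :
    ∃ (ns : ℕ → ℕ) (f : RN N → ℝ), StrictMono ns ∧ MemLp f (ENNReal.ofReal p) volume ∧
      Tendsto (fun k => eLpNorm ((w (ns k)).1 - f) (ENNReal.ofReal p) volume) atTop (𝓝 0) := by
  have hP : 1 ≤ ENNReal.ofReal p := by simpa using hp.le
  have : Fact (1 ≤ ENNReal.ofReal p) := ⟨hP⟩
  -- The discretization concerns test functions, so `w n` is replaced by one at distance at most
  -- `1/(n+1)`. This raises the gradient bound to `M + 1` and does not affect the limit.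
  have := fun n : ℕ => (hw n).approx ((n + 1 : ℕ) : ℝ≥0∞)⁻¹ (by simp)
  choose φ hφ d1 d2 using this
  have hφM : ∀ n, eLpNorm (gradient (φ n)) (ENNReal.ofReal p) volume ≤ ENNReal.ofReal (M + 1) := by
    intro n
    have e1 : gradient (φ n) = (w n).2 + (gradient (φ n) - (w n).2) := by abel
    rw [e1, ENNReal.ofReal_add hM zero_le_one]
    refine (eLpNorm_add_le (hw n).memLp_grad.1 ((hφ n).isC1c.aesm_gradient.sub
      (hw n).memLp_grad.1) hP).trans (add_le_add (h n) ((d2 n).trans ?_))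
    rw [ENNReal.ofReal_one, ENNReal.inv_le_one]
    exact_mod_cast Nat.succ_le_succ (Nat.zero_le n)
  set s : Set (Lp ℝ (ENNReal.ofReal p) (volume : Measure (RN N))) :=
    {f | ∃ φ : {φ : RN N → ℝ // IsTestFunction Ω φ ∧
      eLpNorm (gradient φ) (ENNReal.ofReal p) volume ≤ ENNReal.ofReal (M + 1)}, f =ᵐ[volume] φ.1}
  have hs : TotallyBounded s := by
    refine Metric.totallyBounded_of_finite_discretization fun ε hε => ?_
    obtain ⟨β, iβ, d, hd⟩ := exists_finite_discretization hp hpN hΩ (M := M + 1) (by linarith)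
      (half_pos hε)
    refine ⟨β, iβ, fun f => d f.2.choose, fun f g hfg => ?_⟩
    have h1 := hd _ _ hfg
    have h2 : eLpNorm (f.1 - g.1 : RN N → ℝ) (ENNReal.ofReal p) volume ≤ ENNReal.ofReal (ε / 2) := by
      rwa [eLpNorm_congr_ae (f.2.choose_spec.sub g.2.choose_spec)]
    rw [Lp.dist_def]
    calc _ ≤ (ENNReal.ofReal (ε / 2)).toReal := ENNReal.toReal_mono ENNReal.ofReal_ne_top h2
      _ < ε := by rw [ENNReal.toReal_ofReal (by positivity)]; linarith
  have hsc : IsCompact (closure s) :=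
    isCompact_iff_totallyBounded_isComplete.2 ⟨hs.closure, isClosed_closure.isComplete⟩
  have hmp : ∀ n, MemLp (φ n) (ENNReal.ofReal p) (volume : Measure (RN N)) := fun n =>
    (hφ n).isC1c.memLp _ _
  obtain ⟨f, -, ns, hns, hlim⟩ := hsc.tendsto_subseq (x := fun n => (hmp n).toLp (φ n))
    fun n => subset_closure ⟨⟨φ n, hφ n, hφM n⟩, (hmp n).coeFn_toLp⟩
  refine ⟨ns, f, hns, Lp.memLp f, ?_⟩
  rw [Lp.tendsto_Lp_iff_tendsto_eLpNorm'] at hlim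
  set f' : RN N → ℝ := ⇑f
  have l1 : Tendsto (fun k => eLpNorm (φ (ns k) - f') (ENNReal.ofReal p) volume) atTop (𝓝 0) := by
    refine hlim.congr fun k => eLpNorm_congr_ae ?_
    exact (hmp (ns k)).coeFn_toLp.sub EventuallyEq.rfl
  have l2 : Tendsto (fun k => ((ns k + 1 : ℕ) : ℝ≥0∞)⁻¹) atTop (𝓝 0) :=
    ENNReal.tendsto_inv_nat_nhds_zero.comp
      ((tendsto_add_atTop_nat 1).comp hns.tendsto_atTop)
  have l3 := l2.add l1
  rw [add_zero] at l3
  refine tendsto_of_tendsto_of_tendsto_of_le_of_le tendsto_const_nhds l3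
    (fun _ => zero_le) fun k => ?_
  have e1 : (w (ns k)).1 - f' = ((w (ns k)).1 - φ (ns k)) + (φ (ns k) - f') := by abel
  simp only [e1]
  refine (eLpNorm_add_le ((hw _).memLp.1.sub (hφ _).isC1c.aesm)
    ((hφ _).isC1c.aesm.sub (Lp.aestronglyMeasurable f)) hP).trans (add_le_add ?_ le_rfl)
  rw [eLpNorm_sub_comm]
  exact d1 _

end Rellich

end MixedEigen

namespace MixedEigen

/-! ### The operator form and energy -/

section PairDiff

variable {N : ℕ}

theorem pairDiff_add (u v : RN N → ℝ) : pairDiff (u + v) = pairDiff u + pairDiff v := by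
  ext y; simp only [pairDiff, Pi.add_apply]; ring

theorem pairDiff_sub (u v : RN N → ℝ) : pairDiff (u - v) = pairDiff u - pairDiff v := by
  ext y; simp only [pairDiff, Pi.sub_apply]; ring

theorem pairDiff_smul (c : ℝ) (u : RN N → ℝ) : pairDiff (c • u) = c • pairDiff u := by
  ext y; simp only [pairDiff, Pi.smul_apply, smul_eq_mul]; ring

end PairDiff

section Forms

variable {N : ℕ} {s p : ℝ} {A : Set (RN N)} {V g : RN N → ℝ}

/-- The measure `h dx` on `A`. -/
noncomputable def wMeasure (A : Set (RN N)) (h : RN N → ℝ) : Measure (RN N) :=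
  (volume.restrict A).withDensity fun x => ENNReal.ofReal (h x)

theorem wMeasure_absolutelyContinuous (h : RN N → ℝ) : wMeasure A h ≪ volume :=
  (withDensity_absolutelyContinuous _ _).trans Measure.restrict_le_self.absolutelyContinuous

/-- The form of the operator, without the right-hand side. -/
noncomputable def opForm (A : Set (RN N)) (s p : ℝ) (V : RN N → ℝ)
    (w z : (RN N → ℝ) × (RN N → RN N)) : ℝ :=
  pForm p (volume.restrict A) w.2 z.2 + pForm p (kernMeasure N s p) (pairDiff w.1) (pairDiff z.1)
    + pForm p (wMeasure A V) w.1 z.1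

/-- The energy of the operator. -/
noncomputable def opEnergy (A : Set (RN N)) (s p : ℝ) (V : RN N → ℝ)
    (w : (RN N → ℝ) × (RN N → RN N)) : ℝ :=
  pEnergy p (volume.restrict A) w.2 + pEnergy p (kernMeasure N s p) (pairDiff w.1)
    + pEnergy p (wMeasure A V) w.1

theorem pForm_wMeasure {h : RN N → ℝ} (hm : AEMeasurable h (volume.restrict A))
    (h0 : ∀ᵐ x ∂(volume.restrict A), 0 ≤ h x) (u v : RN N → ℝ) :
    pForm p (wMeasure A h) u v = ∫ x in A, h x * |u x| ^ (p - 2) * u x * v x := by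
  rw [pForm, wMeasure, integral_withDensity_eq_integral_toReal_smul₀ hm.ennreal_ofReal
    (.of_forall fun _ => ENNReal.ofReal_lt_top)]
  refine integral_congr_ae ?_
  filter_upwards [h0] with x hx
  simp only [ENNReal.toReal_ofReal hx, smul_eq_mul, Real.norm_eq_abs, RCLike.inner_apply,
    conj_trivial]
  ring

theorem pForm_kernMeasure (u v : RN N → ℝ) :
    pForm p (kernMeasure N s p) (pairDiff u) (pairDiff v)
      = ∫ y : RN N × RN N, |u y.1 - u y.2| ^ (p - 2) * (u y.1 - u y.2) * (v y.1 - v y.2)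
          / ‖y.1 - y.2‖ ^ ((N : ℝ) + p * s) := by
  have hm : Measurable fun y : RN N × RN N => kern N s p (y.1 - y.2) :=
    measurable_kern.comp (measurable_fst.sub measurable_snd)
  rw [pForm, kernMeasure, integral_withDensity_eq_integral_toReal_smul hm
    (.of_forall fun _ => ENNReal.ofReal_lt_top)]
  refine integral_congr_ae (.of_forall fun y => ?_)
  have : 0 ≤ 1 / ‖y.1 - y.2‖ ^ ((N : ℝ) + p * s) := by positivity
  simp only [kern, ENNReal.toReal_ofReal this, smul_eq_mul, Real.norm_eq_abs, RCLike.inner_apply,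
    conj_trivial, pairDiff]
  ring

/-- All the integrals of the weak formulation become p-forms over suitable measures, so the general
results on p-energies apply to each term. -/
theorem weakForm_eq (hV : AEMeasurable V (volume.restrict A))
    (hg : AEMeasurable g (volume.restrict A))
    (hV0 : ∀ᵐ x ∂(volume.restrict A), 0 ≤ V x) (hg0 : ∀ᵐ x ∂(volume.restrict A), 0 ≤ g x)
    (lam : ℝ) (w z : (RN N → ℝ) × (RN N → RN N)) :
    weakForm A s p V g lam w z = opForm A s p V w z - lam * pForm p (wMeasure A g) w.1 z.1 := by
  rw [opForm, pForm_wMeasure hV hV0, pForm_wMeasure hg hg0, pForm_kernMeasure]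
  rfl

theorem opForm_self (hp : 1 < p) (w : (RN N → ℝ) × (RN N → RN N)) :
    opForm A s p V w w = opEnergy A s p V w := by
  simp only [opForm, opEnergy, pForm_self hp]

theorem opEnergy_nonneg (w : (RN N → ℝ) × (RN N → RN N)) : 0 ≤ opEnergy A s p V w :=
  add_nonneg (add_nonneg (pEnergy_nonneg _) (pEnergy_nonneg _)) (pEnergy_nonneg _)

theorem opEnergy_smul (c : ℝ) (w : (RN N → ℝ) × (RN N → RN N)) :
    opEnergy A s p V (c • w) = |c| ^ p * opEnergy A s p V w := by
  simp only [opEnergy, Prod.smul_fst, Prod.smul_snd, pairDiff_smul, pEnergy_smul]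
  ring

theorem pEnergy_grad_le_opEnergy (w : (RN N → ℝ) × (RN N → RN N)) :
    pEnergy p (volume.restrict A) w.2 ≤ opEnergy A s p V w := by
  have h1 := pEnergy_nonneg (p := p) (μ := kernMeasure N s p) (pairDiff w.1)
  have h2 := pEnergy_nonneg (p := p) (μ := wMeasure A V) w.1
  simp only [opEnergy]; linarith

end Forms

/-- The standing assumptions on the data. -/
structure Admissible {N : ℕ} (Ω : Set (RN N)) (s p : ℝ) (V g : RN N → ℝ) : Prop where
  s_pos : 0 < s
  s_lt : s < 1
  p_gt : 1 < p
  p_lt : p < N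
  isOpen : IsOpen Ω
  bounded : Bornology.IsBounded Ω
  memV : MemLp V (ENNReal.ofReal (N / p)) (volume.restrict Ω)
  memg : MemLp g (ENNReal.ofReal (N / p)) (volume.restrict Ω)
  V_nonneg : ∀ᵐ x ∂(volume.restrict Ω), 0 ≤ V x
  g_pos : ∀ᵐ x ∂(volume.restrict Ω), 0 < g x

/-! ### Weighted norms, continuity and convexity of the energy -/

section Weights

variable {N : ℕ} {Ω A : Set (RN N)} {s p : ℝ} {V g : RN N → ℝ}

theorem Admissible.N_pos (H : Admissible Ω s p V g) : 0 < N := by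
  have h1 := H.p_gt; have h2 := H.p_lt
  have : (0 : ℝ) < N := by linarith
  exact_mod_cast this

theorem Admissible.weakForm_eq (H : Admissible Ω s p V g) (hA : A ⊆ Ω) (lam : ℝ)
    (w z : (RN N → ℝ) × (RN N → RN N)) :
    weakForm A s p V g lam w z = opForm A s p V w z - lam * pForm p (wMeasure A g) w.1 z.1 := by
  have hle := Measure.restrict_mono hA (le_refl (volume : Measure (RN N)))
  exact MixedEigen.weakForm_eq (H.memV.1.aemeasurable.mono_measure hle)
    (H.memg.1.aemeasurable.mono_measure hle)
    (ae_restrict_of_ae_restrict_of_subset hA H.V_nonneg)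
    ((ae_restrict_of_ae_restrict_of_subset hA H.g_pos).mono fun _ h => h.le) lam w z

theorem eLpNorm_wMeasure_rpow_eq (hp : 1 < p) {h : RN N → ℝ}
    (hh : AEMeasurable h (volume.restrict A))
    {u : RN N → ℝ} (hu : AEStronglyMeasurable u volume) :
    eLpNorm u (ENNReal.ofReal p) (wMeasure A h) ^ p
      = ∫⁻ x in A, ENNReal.ofReal (h x) * ‖u x‖ₑ ^ p := by
  rw [← lintegral_enorm_rpow_eq hp, wMeasure,
    lintegral_withDensity_eq_lintegral_mul₀ hh.ennreal_ofReal (hu.restrict.enorm.pow_const _)]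
  rfl

theorem eLpNorm_wMeasure_rpow_le (hp : 1 < p) (hA : A ⊆ Ω) {h : RN N → ℝ}
    (hh : AEStronglyMeasurable h (volume.restrict Ω))
    {u : RN N → ℝ} (hu : AEStronglyMeasurable u volume) :
    eLpNorm u (ENNReal.ofReal p) (wMeasure A h) ^ p ≤ ∫⁻ x in Ω, ‖h x‖ₑ * ‖u x‖ₑ ^ p := by
  have hle := Measure.restrict_mono hA (le_refl (volume : Measure (RN N)))
  rw [eLpNorm_wMeasure_rpow_eq hp (hh.aemeasurable.mono_measure hle) hu]
  refine (lintegral_mono_set hA).trans (lintegral_mono fun x => ?_)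
  gcongr
  rw [← ofReal_norm]
  exact ENNReal.ofReal_le_ofReal (le_abs_self _)

theorem holderConjugate_sobolev (hp : 1 < p) (hpN : p < N) :
    ((N : ℝ) / p).HolderConjugate (N / (N - p)) := by
  have h1 : 0 < p := by linarith
  have h2 : (0 : ℝ) < N := by linarith
  have h3 : 0 < (N : ℝ) - p := by linarith
  rw [Real.holderConjugate_iff]
  constructor
  · rwa [lt_div_iff₀ h1, one_mul]
  · field_simp; ring

/-- The weighted Sobolev inequality. -/
theorem exists_lintegral_weight_le (hp : 1 < p) (hpN : p < N) :
    ∃ S : ℝ, 0 < S ∧ ∀ (Ω Ω' : Set (RN N)) (h : RN N → ℝ),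
      AEStronglyMeasurable h (volume.restrict Ω) →
      ∀ w : (RN N → ℝ) × (RN N → RN N), MemX Ω' p w →
      ∫⁻ x in Ω, ‖h x‖ₑ * ‖w.1 x‖ₑ ^ p
        ≤ eLpNorm h (ENNReal.ofReal (N / p)) (volume.restrict Ω)
          * (ENNReal.ofReal S * eLpNorm w.2 (ENNReal.ofReal p) volume) ^ p := by
  obtain ⟨S, hS, hSob⟩ := exists_sobolev hp hpN
  refine ⟨S, hS, fun Ω Ω' h hh w hw => ?_⟩
  refine (lintegral_enorm_mul_rpow_le hp (holderConjugate_sobolev hp hpN) hh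
    hw.memLp.1.restrict).trans ?_
  gcongr
  refine (eLpNorm_restrict_le _ _ _ _).trans ?_
  have := hSob Ω' w hw
  rwa [mul_comm (N : ℝ) p, mul_div_assoc] at this

theorem MemX.memLp_wMeasure (hp : 1 < p) (hpN : p < N) (hA : A ⊆ Ω) {h : RN N → ℝ}
    (hh : MemLp h (ENNReal.ofReal (N / p)) (volume.restrict Ω))
    {w : (RN N → ℝ) × (RN N → RN N)} (hw : MemX Ω p w) :
    MemLp w.1 (ENNReal.ofReal p) (wMeasure A h) := by
  have hp0 : 0 < p := by linarith
  obtain ⟨S, hS, hSob⟩ := exists_lintegral_weight_le hp hpN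
  refine ⟨hw.memLp.1.mono_ac (wMeasure_absolutelyContinuous h), ?_⟩
  have h1 := (eLpNorm_wMeasure_rpow_le hp hA hh.1 hw.memLp.1).trans (hSob Ω Ω h hh.1 w hw)
  refine (ENNReal.rpow_lt_top_iff_of_pos hp0).1 (h1.trans_lt ?_)
  exact ENNReal.mul_lt_top hh.2 (ENNReal.rpow_lt_top_of_nonneg hp0.le
    (ENNReal.mul_lt_top ENNReal.ofReal_lt_top hw.memLp_grad.2).ne)

theorem exists_eLpNorm_wMeasure_le (hp : 1 < p) (hpN : p < N) (hA : A ⊆ Ω) {h : RN N → ℝ}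
    (hh : MemLp h (ENNReal.ofReal (N / p)) (volume.restrict Ω)) :
    ∃ C : ℝ≥0∞, C ≠ ⊤ ∧ ∀ w : (RN N → ℝ) × (RN N → RN N), MemX Ω p w →
      eLpNorm w.1 (ENNReal.ofReal p) (wMeasure A h)
        ≤ C * eLpNorm w.2 (ENNReal.ofReal p) volume := by
  have hp0 : 0 < p := by linarith
  obtain ⟨S, hS, hSob⟩ := exists_lintegral_weight_le hp hpN
  refine ⟨eLpNorm h (ENNReal.ofReal (N / p)) (volume.restrict Ω) ^ p⁻¹ * ENNReal.ofReal S,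
    ENNReal.mul_ne_top (ENNReal.rpow_ne_top_of_nonneg (by positivity) hh.2.ne)
      ENNReal.ofReal_ne_top, fun w hw => ?_⟩
  rw [← ENNReal.rpow_le_rpow_iff hp0, mul_assoc, ENNReal.mul_rpow_of_nonneg _ _ hp0.le,
    ENNReal.rpow_inv_rpow hp0.ne']
  exact (eLpNorm_wMeasure_rpow_le hp hA hh.1 hw.memLp.1).trans (hSob Ω Ω h hh.1 w hw)

/-- On bounded sets of `W^{1,p}`, convergence in `L^p` implies convergence in `L^p(h dx)`. -/
theorem exists_eLpNorm_wMeasure_le_of_small (hp : 1 < p) (hpN : p < N) (hA : A ⊆ Ω)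
    {h : RN N → ℝ} (hh : MemLp h (ENNReal.ofReal (N / p)) (volume.restrict Ω)) {M : ℝ≥0∞}
    (hM : M ≠ ⊤) {ε : ℝ≥0∞} (hε : ε ≠ 0) (hε' : ε ≠ ⊤) :
    ∃ δ : ℝ≥0∞, δ ≠ 0 ∧ ∀ w : (RN N → ℝ) × (RN N → RN N), MemX Ω p w →
      eLpNorm w.2 (ENNReal.ofReal p) volume ≤ M → eLpNorm w.1 (ENNReal.ofReal p) volume ≤ δ →
      eLpNorm w.1 (ENNReal.ofReal p) (wMeasure A h) ≤ ε := by
  have hp0 : 0 < p := by linarith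
  obtain ⟨S, hS, hSob⟩ := exists_lintegral_weight_le hp hpN
  set K := (ENNReal.ofReal S * M) ^ p
  have hK : K ≠ ⊤ := ENNReal.rpow_ne_top_of_nonneg hp0.le (ENNReal.mul_ne_top ENNReal.ofReal_ne_top hM)
  have hεp0 : ε ^ p / 2 ≠ 0 := by
    have := (ENNReal.rpow_pos (p := p) (pos_iff_ne_zero.2 hε) hε').ne'
    simpa using this
  have hεpt : ε ^ p / 2 ≠ ⊤ := by
    refine ENNReal.div_ne_top (ENNReal.rpow_ne_top_of_nonneg hp0.le hε') two_ne_zero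
  -- Split `h` into a simple function, which is bounded, and a remainder small in `L^(N/p)`. The
  -- remainder is handled by Sobolev's inequality and the gradient bound, the bounded part by
  -- smallness in `L^p`. This gives compactness at the critical integrability of the weight.
  obtain ⟨f, hf1, hf2⟩ := hh.exists_simpleFunc_eLpNorm_sub_lt ENNReal.ofReal_ne_top
    (ε := ε ^ p / 2 / (K + 1)) (by
      rw [Ne, ENNReal.div_eq_zero_iff, not_or]
      exact ⟨hεp0, ENNReal.add_ne_top.2 ⟨hK, ENNReal.one_ne_top⟩⟩)
  obtain ⟨C, hC⟩ := f.exists_forall_norm_le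
  set C' : ℝ≥0∞ := ENNReal.ofReal C + 1
  have hC'0 : C' ≠ 0 := by positivity
  have hC't : C' ≠ ⊤ := by finiteness
  refine ⟨(ε ^ p / 2 / C') ^ p⁻¹, ?_, fun w hw hwM hwδ => ?_⟩
  · have : 0 < ε ^ p / 2 / C' := pos_iff_ne_zero.2 (by
      rw [Ne, ENNReal.div_eq_zero_iff, not_or]; exact ⟨hεp0, hC't⟩)
    exact (ENNReal.rpow_pos this (ENNReal.div_ne_top hεpt hC'0)).ne'
  · have hum := hw.memLp.1
    have hwp : ∫⁻ x, ‖w.1 x‖ₑ ^ p ≤ ε ^ p / 2 / C' := by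
      rw [lintegral_enorm_rpow_eq hp]
      refine (ENNReal.rpow_le_rpow hwδ hp0.le).trans ?_
      rw [ENNReal.rpow_inv_rpow hp0.ne']
    rw [← ENNReal.rpow_le_rpow_iff hp0]
    refine (eLpNorm_wMeasure_rpow_le hp hA hh.1 hum).trans ?_
    have hfm : AEStronglyMeasurable (h - ⇑f) (volume.restrict Ω) :=
      hh.1.sub f.aestronglyMeasurable
    calc ∫⁻ x in Ω, ‖h x‖ₑ * ‖w.1 x‖ₑ ^ p
        ≤ ∫⁻ x in Ω, (‖(h - ⇑f) x‖ₑ * ‖w.1 x‖ₑ ^ p + C' * ‖w.1 x‖ₑ ^ p) := by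
          refine lintegral_mono fun x => ?_
          rw [← add_mul]
          gcongr
          have : h x = (h - ⇑f) x + f x := by simp
          rw [this]
          refine (enorm_add_le _ _).trans ?_
          gcongr
          rw [← ofReal_norm]
          exact (ENNReal.ofReal_le_ofReal (hC x)).trans le_self_add
      _ = (∫⁻ x in Ω, ‖(h - ⇑f) x‖ₑ * ‖w.1 x‖ₑ ^ p) + ∫⁻ x in Ω, C' * ‖w.1 x‖ₑ ^ p :=
          lintegral_add_right' _ ((hum.restrict.enorm.pow_const _).const_mul _)
      _ ≤ ε ^ p / 2 + ε ^ p / 2 := by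
          refine add_le_add ?_ ?_
          · refine (hSob Ω Ω _ hfm w hw).trans ?_
            calc _ ≤ ε ^ p / 2 / (K + 1) * K := by
                  exact mul_le_mul' hf1.le (ENNReal.rpow_le_rpow (by gcongr) hp0.le)
              _ ≤ ε ^ p / 2 / (K + 1) * (K + 1) := by gcongr; exact le_self_add
              _ = ε ^ p / 2 := ENNReal.div_mul_cancel (by positivity) (by finiteness)
          · rw [lintegral_const_mul' _ _ hC't]
            calc _ ≤ C' * (ε ^ p / 2 / C') := by
                  gcongr
                  exact (setLIntegral_le_lintegral _ _).trans hwp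
              _ = ε ^ p / 2 := ENNReal.mul_div_cancel hC'0 hC't
      _ = ε ^ p := ENNReal.add_halves _

/-- The energies are continuous along sequences converging in `W^{1,p}`. -/
theorem Admissible.tendsto_energy (H : Admissible Ω s p V g) (hA : A ⊆ Ω)
    {w : ℕ → (RN N → ℝ) × (RN N → RN N)} {w₀ : (RN N → ℝ) × (RN N → RN N)}
    (hw : ∀ n, MemX Ω p (w n)) (hw₀ : MemX Ω p w₀)
    (t1 : Tendsto (fun n => eLpNorm ((w n).1 - w₀.1) (ENNReal.ofReal p) volume) atTop (𝓝 0))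
    (t2 : Tendsto (fun n => eLpNorm ((w n).2 - w₀.2) (ENNReal.ofReal p) volume) atTop (𝓝 0)) :
    Tendsto (fun n => opEnergy A s p V (w n)) atTop (𝓝 (opEnergy A s p V w₀)) ∧
    Tendsto (fun n => pEnergy p (wMeasure A g) (w n).1) atTop
      (𝓝 (pEnergy p (wMeasure A g) w₀.1)) := by
  have hp := H.p_gt
  have hN := H.N_pos
  have hwt : ∀ {h : RN N → ℝ}, MemLp h (ENNReal.ofReal (N / p)) (volume.restrict Ω) →
      Tendsto (fun n => pEnergy p (wMeasure A h) (w n).1) atTop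
        (𝓝 (pEnergy p (wMeasure A h) w₀.1)) := by
    intro h hh
    obtain ⟨C, hC, hle⟩ := exists_eLpNorm_wMeasure_le hp H.p_lt hA hh
    refine tendsto_pEnergy hp (fun n => ((hw n).memLp_wMeasure hp H.p_lt hA hh).1)
      (hw₀.memLp_wMeasure hp H.p_lt hA hh) ?_
    have h2 := ENNReal.Tendsto.const_mul t2 (.inr hC)
    rw [mul_zero] at h2
    refine tendsto_of_tendsto_of_tendsto_of_le_of_le tendsto_const_nhds h2 (fun _ => zero_le)
      fun n => ?_
    have := hle (w n - w₀) ((hw n).sub hp hw₀)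
    simpa only [Prod.fst_sub, Prod.snd_sub] using this
  have a1 : Tendsto (fun n => pEnergy p (volume.restrict A) (w n).2) atTop
      (𝓝 (pEnergy p (volume.restrict A) w₀.2)) := by
    refine tendsto_pEnergy hp (fun n => (hw n).memLp_grad.1.restrict)
      (hw₀.memLp_grad.restrict _) ?_
    exact tendsto_of_tendsto_of_tendsto_of_le_of_le tendsto_const_nhds t2 (fun _ => zero_le)
      fun n => eLpNorm_restrict_le _ _ _ _
  have a2 : Tendsto (fun n => pEnergy p (kernMeasure N s p) (pairDiff (w n).1)) atTop
      (𝓝 (pEnergy p (kernMeasure N s p) (pairDiff w₀.1))) := by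
    obtain ⟨C, hC, hle⟩ := exists_eLpNorm_pairDiff_le hN H.s_pos H.s_lt hp
    refine tendsto_pEnergy hp (fun n => aestronglyMeasurable_pairDiff (hw n).memLp.1)
      (hw₀.memLp_pairDiff hN H.s_pos H.s_lt hp) ?_
    have h2 := ENNReal.Tendsto.const_mul (t1.add t2) (.inr hC)
    rw [add_zero, mul_zero] at h2
    refine tendsto_of_tendsto_of_tendsto_of_le_of_le tendsto_const_nhds h2 (fun _ => zero_le)
      fun n => ?_
    have := hle Ω _ ((hw n).sub hp hw₀)
    simpa only [Prod.fst_sub, Prod.snd_sub, pairDiff_sub] using this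
  exact ⟨(a1.add a2).add (hwt H.memV), hwt H.memg⟩

theorem Admissible.hasDerivAt_energy (H : Admissible Ω s p V g) (hA : A ⊆ Ω)
    {w z : (RN N → ℝ) × (RN N → RN N)} (hw : MemX Ω p w) (hz : MemX Ω p z) :
    HasDerivAt (fun t : ℝ => opEnergy A s p V (w + t • z)) (p * opForm A s p V w z) 0 ∧
    HasDerivAt (fun t : ℝ => pEnergy p (wMeasure A g) (w + t • z).1)
      (p * pForm p (wMeasure A g) w.1 z.1) 0 := by
  have hp := H.p_gt
  have hN := H.N_pos
  refine ⟨?_, hasDerivAt_pEnergy hp (hw.memLp_wMeasure hp H.p_lt hA H.memg)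
    (hz.memLp_wMeasure hp H.p_lt hA H.memg)⟩
  have d1 := hasDerivAt_pEnergy hp (hw.memLp_grad.restrict A) (hz.memLp_grad.restrict A)
  have d2 := hasDerivAt_pEnergy hp (hw.memLp_pairDiff hN H.s_pos H.s_lt hp)
    (hz.memLp_pairDiff hN H.s_pos H.s_lt hp)
  have d3 := hasDerivAt_pEnergy hp (hw.memLp_wMeasure hp H.p_lt hA H.memV)
    (hz.memLp_wMeasure hp H.p_lt hA H.memV)
  have := (d1.add d2).add d3
  refine (this.congr_deriv (by simp only [opForm]; ring)).congr_of_eventuallyEq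
    (.of_forall fun t => ?_)
  simp only [opEnergy, Prod.fst_add, Prod.snd_add, Prod.smul_fst, Prod.smul_snd, pairDiff_add,
    pairDiff_smul, Pi.add_apply]

/-- Uniform convexity of the energy. -/
theorem Admissible.exists_opEnergy_sub_le (H : Admissible Ω s p V g) (hA : A ⊆ Ω) {δ : ℝ}
    (hδ : 0 < δ) : ∃ C : ℝ, 0 < C ∧ ∀ w z : (RN N → ℝ) × (RN N → RN N), MemX Ω p w →
      MemX Ω p z → opEnergy A s p V (w - z) ≤ δ * (opEnergy A s p V w + opEnergy A s p V z)
        + C * ((opEnergy A s p V w + opEnergy A s p V z) / 2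
          - opEnergy A s p V ((1 / 2 : ℝ) • (w + z))) := by
  have hp := H.p_gt
  have hN := H.N_pos
  obtain ⟨C₁, hC₁, h₁⟩ := exists_pEnergy_sub_le (F := RN N) hp hδ
  obtain ⟨C₂, hC₂, h₂⟩ := exists_pEnergy_sub_le (F := ℝ) hp hδ
  refine ⟨max C₁ C₂, by positivity, fun w z hw hz => ?_⟩
  have m1 := hw.memLp_grad.restrict A
  have m1' := hz.memLp_grad.restrict A
  have m2 := hw.memLp_pairDiff hN H.s_pos H.s_lt hp
  have m2' := hz.memLp_pairDiff hN H.s_pos H.s_lt hp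
  have m3 := hw.memLp_wMeasure hp H.p_lt hA H.memV
  have m3' := hz.memLp_wMeasure hp H.p_lt hA H.memV
  have e1 := h₁ _ _ _ m1 m1'
  have e2 := h₂ _ _ _ m2 m2'
  have e3 := h₂ _ _ _ m3 m3'
  have f1 := sub_nonneg.2 (pEnergy_half_add_le hp m1 m1')
  have f2 := sub_nonneg.2 (pEnergy_half_add_le hp m2 m2')
  have f3 := sub_nonneg.2 (pEnergy_half_add_le hp m3 m3')
  have g1 := mul_le_mul_of_nonneg_right (le_max_left C₁ C₂) f1
  have g2 := mul_le_mul_of_nonneg_right (le_max_right C₁ C₂) f2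
  have g3 := mul_le_mul_of_nonneg_right (le_max_right C₁ C₂) f3
  simp only [opEnergy, Prod.fst_sub, Prod.snd_sub, Prod.fst_add, Prod.snd_add, Prod.smul_fst,
    Prod.smul_snd, pairDiff_add, pairDiff_smul, pairDiff_sub]
  linarith

end Weights

end MixedEigen

namespace MixedEigen

/-! ### Completeness and closed subspaces of `X_0` -/

theorem exists_tendsto_eLpNorm_of_cauchy {α F : Type*} [MeasurableSpace α] {μ : Measure α}
    [NormedAddCommGroup F] [CompleteSpace F] {P : ℝ≥0∞} (hP : 1 ≤ P) {f : ℕ → α → F}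
    (hf : ∀ n, MemLp (f n) P μ)
    (h : ∀ ε : ℝ≥0∞, 0 < ε → ∃ K, ∀ k ≥ K, ∀ l ≥ K, eLpNorm (f k - f l) P μ < ε) :
    ∃ g, MemLp g P μ ∧ Tendsto (fun n => eLpNorm (f n - g) P μ) atTop (𝓝 0) := by
  have : Fact (1 ≤ P) := ⟨hP⟩
  have hc : CauchySeq fun n => (hf n).toLp := by
    refine EMetric.cauchySeq_iff.2 fun ε hε => ?_
    obtain ⟨K, hK⟩ := h ε hε
    refine ⟨K, fun k hk l hl => ?_⟩
    rw [Lp.edist_toLp_toLp]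
    exact hK k hk l hl
  obtain ⟨g, hg⟩ := cauchySeq_tendsto_of_complete hc
  refine ⟨g, Lp.memLp g, ?_⟩
  rw [tendsto_iff_edist_tendsto_0] at hg
  refine hg.congr fun n => ?_
  rw [Lp.edist_def]
  refine eLpNorm_congr_ae ?_
  filter_upwards [(hf n).coeFn_toLp] with x hx
  simp [hx]

/-- A closed linear subspace of `X_0^{s,p}(Ω)` of functions vanishing a.e. outside `A`. -/
structure IsEnergySpace {N : ℕ} (Ω A : Set (RN N)) (p : ℝ)
    (T : Set ((RN N → ℝ) × (RN N → RN N))) : Prop where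
  memX : ∀ w ∈ T, MemX Ω p w
  ae_eq_zero : ∀ w ∈ T, ∀ᵐ x, x ∉ A → w.1 x = 0
  add_mem : ∀ w ∈ T, ∀ z ∈ T, w + z ∈ T
  smul_mem : ∀ (c : ℝ), ∀ w ∈ T, c • w ∈ T
  closed : ∀ (w' : ℕ → (RN N → ℝ) × (RN N → RN N)) (w : (RN N → ℝ) × (RN N → RN N)),
    (∀ n, w' n ∈ T) → AEStronglyMeasurable w.1 volume → AEStronglyMeasurable w.2 volume →
    Tendsto (fun n => eLpNorm ((w' n).1 - w.1) (ENNReal.ofReal p) volume) atTop (𝓝 0) →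
    Tendsto (fun n => eLpNorm ((w' n).2 - w.2) (ENNReal.ofReal p) volume) atTop (𝓝 0) → w ∈ T

section Spaces

variable {N : ℕ} {Ω A : Set (RN N)} {p : ℝ}

/-- Vanishing outside `A` survives the limit along an almost everywhere convergent subsequence. -/
theorem isEnergySpace_spaceX0On (hp : 1 < p) (hΩ : IsOpen Ω) (A : Set (RN N)) :
    IsEnergySpace Ω A p (spaceX0On Ω A p) where
  memX _ hw := (mem_spaceX0_iff hp hΩ).1 hw.1
  ae_eq_zero _ hw := hw.2
  add_mem w hw z hz := by
    refine ⟨(mem_spaceX0_iff hp hΩ).2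
      (((mem_spaceX0_iff hp hΩ).1 hw.1).add hp ((mem_spaceX0_iff hp hΩ).1 hz.1)), ?_⟩
    filter_upwards [hw.2, hz.2] with x h1 h2 hx
    simp [h1 hx, h2 hx]
  smul_mem c w hw := by
    refine ⟨(mem_spaceX0_iff hp hΩ).2 (((mem_spaceX0_iff hp hΩ).1 hw.1).smul hp c), ?_⟩
    filter_upwards [hw.2] with x h1 hx
    simp [h1 hx]
  closed w' w hw' h1 h2 t1 t2 := by
    have hm := fun n => (mem_spaceX0_iff hp hΩ).1 (hw' n).1
    refine ⟨(mem_spaceX0_iff hp hΩ).2 (MemX.of_tendsto hp hm h1 h2 t1 t2), ?_⟩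
    obtain ⟨ns, -, hns⟩ := exists_seq_tendsto_ae_of_eLpNorm hp (fun n => (hm n).memLp.1) h1 t1
    filter_upwards [hns, ae_all_iff.2 fun n => (hw' n).2] with x hx h0 hxA
    refine tendsto_nhds_unique hx ?_
    simp only [fun i => h0 (ns i) hxA, tendsto_const_nhds]

theorem isEnergySpace_spaceX0 (hp : 1 < p) (hA : IsOpen A) (hAΩ : A ⊆ Ω) :
    IsEnergySpace Ω A p (spaceX0 A p) where
  memX _ hw := ((mem_spaceX0_iff hp hA).1 hw).mono hAΩ
  ae_eq_zero _ hw := hw.2.2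
  add_mem _ hw _ hz := (mem_spaceX0_iff hp hA).2
      (((mem_spaceX0_iff hp hA).1 hw).add hp ((mem_spaceX0_iff hp hA).1 hz))
  smul_mem c _ hw := (mem_spaceX0_iff hp hA).2 (((mem_spaceX0_iff hp hA).1 hw).smul hp c)
  closed _ _ hw' h1 h2 t1 t2 := (mem_spaceX0_iff hp hA).2
    (MemX.of_tendsto hp (fun n => (mem_spaceX0_iff hp hA).1 (hw' n)) h1 h2 t1 t2)

theorem IsEnergySpace.sub_mem {T : Set ((RN N → ℝ) × (RN N → RN N))}
    (hT : IsEnergySpace Ω A p T) {w z : (RN N → ℝ) × (RN N → RN N)} (hw : w ∈ T) (hz : z ∈ T) :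
    w - z ∈ T := by
  have := hT.add_mem _ hw _ (hT.smul_mem (-1) _ hz)
  rwa [neg_one_smul, ← sub_eq_add_neg] at this

end Spaces

/-! ### Existence of the first eigenvalue -/

section Minimizer

variable {N : ℕ} {Ω A : Set (RN N)} {s p : ℝ} {V g : RN N → ℝ}
  {T : Set ((RN N → ℝ) × (RN N → RN N))}

/-- The gradient vanishes almost everywhere where the function does, so nothing is lost outside `A`.
As `A` need not be measurable, the argument passes to a measurable hull. -/
theorem IsEnergySpace.eLpNorm_grad_restrict (hT : IsEnergySpace Ω A p T) (hp : 1 < p)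
    (hΩ : IsOpen Ω) (hb : Bornology.IsBounded Ω) (hA : A ⊆ Ω)
    {w : (RN N → ℝ) × (RN N → RN N)} (hw : w ∈ T) :
    eLpNorm w.2 (ENNReal.ofReal p) (volume.restrict A)
      = eLpNorm w.2 (ENNReal.ofReal p) volume := by
  rw [← Measure.restrict_toMeasurable ((hb.subset hA).measure_lt_top.ne)]
  refine eLpNorm_restrict_eq_of_ae_zero (measurableSet_toMeasurable _ _) ?_ _
  filter_upwards [hT.ae_eq_zero w hw, (hT.memX w hw).ae_grad_eq_zero_of_eq_zero hp hΩ]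
    with x h1 h2 hx
  exact h2 (h1 fun h => hx (subset_toMeasurable _ _ h))

theorem Admissible.eLpNorm_grad_le (H : Admissible Ω s p V g) (hA : A ⊆ Ω)
    (hT : IsEnergySpace Ω A p T) {w : (RN N → ℝ) × (RN N → RN N)} (hw : w ∈ T) :
    eLpNorm w.2 (ENNReal.ofReal p) volume ≤ ENNReal.ofReal (opEnergy A s p V w ^ p⁻¹) := by
  have hp := H.p_gt
  have hp0 : 0 < p := by linarith
  have hX := hT.memX w hw
  rw [← hT.eLpNorm_grad_restrict hp H.isOpen H.bounded hA hw,
    ← ENNReal.ofReal_toReal (hX.memLp_grad.restrict A).2.ne]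
  refine ENNReal.ofReal_le_ofReal ?_
  rw [Real.le_rpow_inv_iff_of_pos ENNReal.toReal_nonneg (opEnergy_nonneg w) hp0,
    ← pEnergy_eq_toReal_rpow hp (hX.memLp_grad.restrict A).1]
  exact pEnergy_grad_le_opEnergy w

theorem Admissible.weight_pos (H : Admissible Ω s p V g) (hA : A ⊆ Ω)
    (hT : IsEnergySpace Ω A p T) {w : (RN N → ℝ) × (RN N → RN N)} (hw : w ∈ T)
    (h0 : ¬ w.1 =ᵐ[volume] 0) : 0 < pEnergy p (wMeasure A g) w.1 := by
  refine lt_of_le_of_ne (pEnergy_nonneg _) fun h => h0 ?_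
  have h1 := (pEnergy_eq_zero_iff H.p_gt
    ((hT.memX w hw).memLp_wMeasure H.p_gt H.p_lt hA H.memg)).1 h.symm
  have hle := Measure.restrict_mono hA (le_refl (volume : Measure (RN N)))
  rw [wMeasure, Filter.EventuallyEq, ae_withDensity_iff'
    (H.memg.1.aemeasurable.mono_measure hle).ennreal_ofReal] at h1
  filter_upwards [hT.ae_eq_zero w hw, ae_imp_of_ae_restrict h1,
    ae_imp_of_ae_restrict (ae_restrict_of_ae_restrict_of_subset hA H.g_pos)] with x e1 e2 e3
  by_cases hx : x ∈ A
  · exact e2 hx (by simpa using e3 hx)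
  · exact e1 hx

/-- Weighted Sobolev together with coercivity. It keeps the infimum of the Rayleigh quotient away
from zero. -/
theorem Admissible.exists_weight_le (H : Admissible Ω s p V g) (hA : A ⊆ Ω)
    (hT : IsEnergySpace Ω A p T) :
    ∃ K : ℝ, 0 < K ∧ ∀ w ∈ T, pEnergy p (wMeasure A g) w.1 ≤ K * opEnergy A s p V w := by
  have hp := H.p_gt
  have hp0 : 0 < p := by linarith
  obtain ⟨C, hC, hle⟩ := exists_eLpNorm_wMeasure_le hp H.p_lt hA H.memg
  refine ⟨C.toReal ^ p + 1, by positivity, fun w hw => ?_⟩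
  have hX := hT.memX w hw
  have h1 := (hle w hX).trans (mul_le_mul_right (H.eLpNorm_grad_le hA hT hw) C)
  have hQ := opEnergy_nonneg (A := A) (s := s) (p := p) (V := V) w
  rw [pEnergy_eq_toReal_rpow hp (hX.memLp_wMeasure hp H.p_lt hA H.memg).1]
  have h2 := ENNReal.toReal_mono (ENNReal.mul_ne_top hC ENNReal.ofReal_ne_top) h1
  rw [ENNReal.toReal_mul, ENNReal.toReal_ofReal (by positivity)] at h2
  calc _ ≤ (C.toReal * opEnergy A s p V w ^ p⁻¹) ^ p :=
        Real.rpow_le_rpow ENNReal.toReal_nonneg h2 hp0.le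
    _ = C.toReal ^ p * opEnergy A s p V w := by
        rw [Real.mul_rpow ENNReal.toReal_nonneg (by positivity), Real.rpow_inv_rpow hQ hp0.ne']
    _ ≤ _ := by gcongr; linarith

/-- An eigenvalue below the Rayleigh quotient is the first eigenvalue. -/
theorem Admissible.isFirstEigenvalue_of_le (H : Admissible Ω s p V g) (hA : A ⊆ Ω)
    (hT : IsEnergySpace Ω A p T) {lam : ℝ} (hlam : 0 < lam) {u : RN N → ℝ}
    (hu : IsEigenfunction T A s p V g lam u)
    (h : ∀ w ∈ T, lam * pEnergy p (wMeasure A g) w.1 ≤ opEnergy A s p V w) :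
    IsFirstEigenvalue T A s p V g lam := by
  refine ⟨⟨hlam, u, hu⟩, ?_⟩
  rintro μ ⟨-, v, G, hv, hv0, hE⟩
  have h1 := hE _ hv
  rw [H.weakForm_eq hA, opForm_self H.p_gt, pForm_self H.p_gt] at h1
  have h2 := h _ hv
  have h3 := H.weight_pos hA hT hv hv0
  exact le_of_mul_le_mul_right (by linarith) h3

/-- The energy minus `lam` times the weight is nonnegative on `T` and vanishes at `w`. Its
derivative in any direction, `p` times the weak form, is therefore zero; no Lagrange multiplier is
needed. -/
theorem Admissible.eigenfunction_of_minimizer (H : Admissible Ω s p V g) (hA : A ⊆ Ω)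
    (hT : IsEnergySpace Ω A p T) {lam : ℝ}
    (h : ∀ w ∈ T, lam * pEnergy p (wMeasure A g) w.1 ≤ opEnergy A s p V w)
    {w : (RN N → ℝ) × (RN N → RN N)} (hw : w ∈ T)
    (hmin : opEnergy A s p V w = lam * pEnergy p (wMeasure A g) w.1) :
    ∀ z ∈ T, weakForm A s p V g lam w z = 0 := by
  intro z hz
  have hp := H.p_gt
  obtain ⟨d1, d2⟩ := H.hasDerivAt_energy hA (hT.memX w hw) (hT.memX z hz)
  have d := d1.sub (d2.const_mul lam)
  have hm : IsLocalMin ((fun t : ℝ => opEnergy A s p V (w + t • z)) -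
      fun t : ℝ => lam * pEnergy p (wMeasure A g) (w + t • z).1) 0 := by
    refine .of_forall fun t => ?_
    have := h _ (hT.add_mem _ hw _ (hT.smul_mem t _ hz))
    simp only [Pi.sub_apply, zero_smul, add_zero, hmin]
    linarith
  have h0 := hm.hasDerivAt_eq_zero d
  rw [H.weakForm_eq hA]
  have : p * (opForm A s p V w z - lam * pForm p (wMeasure A g) w.1 z.1) = 0 := by linarith
  exact (mul_eq_zero.1 this).resolve_left (by linarith)

/-- The midpoint of two close functions nearly keeps the constraint: its norm is at least `1 - t` by
the triangle inequality, and Bernoulli's inequality bounds the `p`-th power. -/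
theorem one_sub_le_of_pEnergy_eq_one {α F : Type*} [MeasurableSpace α] {μ : Measure α}
    [NormedAddCommGroup F] [InnerProductSpace ℝ F] (hp : 1 < p) {f h : α → F}
    (hf : MemLp f (ENNReal.ofReal p) μ) (hh : MemLp h (ENNReal.ofReal p) μ)
    (hf1 : pEnergy p μ f = 1) {t : ℝ} (ht0 : 0 ≤ t) (ht1 : t ≤ 1)
    (hfh : eLpNorm (f - h) (ENNReal.ofReal p) μ ≤ ENNReal.ofReal t) :
    1 - p * t ≤ pEnergy p μ ((1 / 2 : ℝ) • (f + h)) := by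
  have hp0 : 0 < p := by linarith
  have hm : MemLp ((1 / 2 : ℝ) • (f + h)) (ENNReal.ofReal p) μ := (hf.add hh).const_smul _
  rw [pEnergy_eq_toReal_rpow hp hf.1] at hf1
  have hn1 : (eLpNorm f (ENNReal.ofReal p) μ).toReal = 1 := by
    rw [← Real.rpow_rpow_inv ENNReal.toReal_nonneg hp0.ne', hf1, Real.one_rpow]
  have hP : 1 ≤ ENNReal.ofReal p := by
    rw [← ENNReal.ofReal_one]; exact ENNReal.ofReal_le_ofReal hp.le
  have h1 : eLpNorm f (ENNReal.ofReal p) μ ≤ eLpNorm ((1 / 2 : ℝ) • (f + h)) (ENNReal.ofReal p) μ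
      + eLpNorm ((1 / 2 : ℝ) • (f - h)) (ENNReal.ofReal p) μ := by
    have e : f = (1 / 2 : ℝ) • (f + h) + (1 / 2 : ℝ) • (f - h) := by
      ext x; simp only [Pi.add_apply, Pi.smul_apply, Pi.sub_apply]; module
    conv_lhs => rw [e]
    exact eLpNorm_add_le hm.1 ((hf.sub hh).const_smul (1 / 2 : ℝ)).1 hP
  have h2 : eLpNorm ((1 / 2 : ℝ) • (f - h)) (ENNReal.ofReal p) μ ≤ ENNReal.ofReal t := by
    rw [eLpNorm_const_smul]
    refine le_trans ?_ hfh
    refine mul_le_of_le_one_left zero_le ?_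
    rw [← ofReal_norm]
    exact ENNReal.ofReal_le_one.2 (by norm_num)
  have h3 := ENNReal.toReal_mono (by finiteness [hm.2.ne]) (h1.trans (add_le_add_right h2 _))
  rw [hn1, ENNReal.toReal_add hm.2.ne ENNReal.ofReal_ne_top, ENNReal.toReal_ofReal ht0] at h3
  rw [pEnergy_eq_toReal_rpow hp hm.1]
  have := one_add_mul_self_le_rpow_one_add (s := -t) (by linarith) hp.le
  calc 1 - p * t = 1 + p * -t := by ring
    _ ≤ (1 + -t) ^ p := this
    _ ≤ _ := Real.rpow_le_rpow (by linarith) (by linarith) hp0.le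

theorem Admissible.rayleigh_of_normalized (H : Admissible Ω s p V g)
    (hT : IsEnergySpace Ω A p T) {lam : ℝ}
    (h : ∀ w ∈ T, pEnergy p (wMeasure A g) w.1 = 1 → lam ≤ opEnergy A s p V w) :
    ∀ w ∈ T, lam * pEnergy p (wMeasure A g) w.1 ≤ opEnergy A s p V w := by
  intro w hw
  have hp0 : 0 < p := by linarith [H.p_gt]
  rcases (pEnergy_nonneg (p := p) (μ := wMeasure A g) w.1).eq_or_lt with h0 | h0
  · rw [← h0, mul_zero]; exact opEnergy_nonneg w
  · set r := pEnergy p (wMeasure A g) w.1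
    have hc : |(r⁻¹) ^ p⁻¹| ^ p = r⁻¹ := by
      rw [abs_of_nonneg (by positivity), Real.rpow_inv_rpow (by positivity) hp0.ne']
    have := h _ (hT.smul_mem ((r⁻¹) ^ p⁻¹) w hw)
      (by rw [Prod.smul_fst, pEnergy_smul, hc]; exact inv_mul_cancel₀ h0.ne')
    rw [opEnergy_smul, hc, inv_mul_eq_div, le_div_iff₀ h0] at this
    exact this

/-- A minimizing sequence for the Rayleigh quotient which converges weighted is Cauchy. -/
theorem Admissible.exists_minimizer (H : Admissible Ω s p V g) (hA : A ⊆ Ω)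
    (hT : IsEnergySpace Ω A p T) {lam : ℝ} (hlam : 0 < lam)
    (h : ∀ w ∈ T, lam * pEnergy p (wMeasure A g) w.1 ≤ opEnergy A s p V w)
    (hinf : ∀ ε > 0, ∃ w ∈ T, pEnergy p (wMeasure A g) w.1 = 1 ∧ opEnergy A s p V w < lam + ε) :
    ∃ w ∈ T, pEnergy p (wMeasure A g) w.1 = 1 ∧ opEnergy A s p V w = lam := by
  have hp := H.p_gt
  have hp0 : 0 < p := by linarith
  have hP : 1 ≤ ENNReal.ofReal p := by
    rw [← ENNReal.ofReal_one]; exact ENNReal.ofReal_le_ofReal hp.le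
  choose v hv hv1 hvQ using fun n : ℕ => hinf (1 / (n + 1)) Nat.one_div_pos_of_nat
  have hvM : ∀ n, eLpNorm (v n).2 (ENNReal.ofReal p) volume
      ≤ ENNReal.ofReal ((lam + 1) ^ p⁻¹) := fun n => by
    refine (H.eLpNorm_grad_le hA hT (hv n)).trans (ENNReal.ofReal_le_ofReal ?_)
    refine Real.rpow_le_rpow (opEnergy_nonneg _) ((hvQ n).le.trans ?_) (by positivity)
    have : (1 : ℝ) / (n + 1) ≤ 1 := by
      rw [div_le_one (by positivity)]; linarith [n.cast_nonneg (α := ℝ)]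
    linarith
  obtain ⟨ns, f, hns, hf, hfl⟩ := exists_subseq_tendsto_eLpNorm hp H.p_lt H.bounded
    (fun n => hT.memX _ (hv n)) (by positivity) hvM
  set w := fun k => v (ns k)
  have hw : ∀ k, w k ∈ T := fun k => hv _
  have hwX : ∀ k, MemX Ω p (w k) := fun k => hT.memX _ (hw k)
  have hwR : ∀ k, MemLp (w k).1 (ENNReal.ofReal p) (wMeasure A g) := fun k =>
    (hwX k).memLp_wMeasure hp H.p_lt hA H.memg
  have hwQ : ∀ k : ℕ, opEnergy A s p V (w k) ≤ lam + 1 / (k + 1) := fun k => by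
    refine (hvQ _).le.trans ?_
    gcongr
    exact hns.id_le k
  have hwQ1 : ∀ k : ℕ, opEnergy A s p V (w k) ≤ lam + 1 := fun k => by
    refine (hwQ k).trans ?_
    have : (1 : ℝ) / (k + 1) ≤ 1 := by
      rw [div_le_one (by positivity)]; linarith [k.cast_nonneg (α := ℝ)]
    linarith
  have hcauchyL : ∀ ε : ℝ≥0∞, 0 < ε → ∃ K, ∀ k ≥ K, ∀ l ≥ K,
      eLpNorm ((w k).1 - (w l).1) (ENNReal.ofReal p) volume ≤ ε := by
    intro ε hε
    obtain ⟨K, hK⟩ := eventually_atTop.1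
      (hfl.eventually (Iic_mem_nhds (ENNReal.half_pos hε.ne')))
    refine ⟨K, fun k hk l hl => ?_⟩
    have e : (w k).1 - (w l).1 = ((w k).1 - f) - ((w l).1 - f) := by abel
    rw [e]
    refine (eLpNorm_sub_le ((hwX k).memLp.sub hf).1 ((hwX l).memLp.sub hf).1 hP).trans ?_
    rw [← ENNReal.add_halves ε]
    exact add_le_add (hK k hk) (hK l hl)
  have hcauchyQ : ∀ ε : ℝ, 0 < ε → ∃ K, ∀ k ≥ K, ∀ l ≥ K, opEnergy A s p V (w k - w l) ≤ ε := by
    intro ε hε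
    -- Both energies are at most `lam + 1`, so the term with `δ` costs at most `ε / 2`. The choices
    -- of `t` and `K₂` make the convexity defect cost `ε / 4` twice: for the drop of the midpoint's
    -- weight and for the excess of the energies over `lam`.
    obtain ⟨C, hC, hunif⟩ := H.exists_opEnergy_sub_le hA (δ := ε / (4 * (lam + 1)))
      (by positivity)
    set t := min 1 (ε / (4 * C * lam * p))
    have ht0 : 0 < t := by positivity
    have ht : C * lam * p * t ≤ ε / 4 := by
      have : t ≤ ε / (4 * C * lam * p) := min_le_right _ _
      rw [le_div_iff₀ (by positivity)] at this
      linarith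
    obtain ⟨δ, hδ, hsmall⟩ := exists_eLpNorm_wMeasure_le_of_small hp H.p_lt hA H.memg
      (M := ENNReal.ofReal ((lam + 1) ^ p⁻¹) + ENNReal.ofReal ((lam + 1) ^ p⁻¹))
      (by finiteness) (ε := ENNReal.ofReal t) (by simpa using ht0) ENNReal.ofReal_ne_top
    obtain ⟨K₁, hK₁⟩ := hcauchyL δ (pos_iff_ne_zero.2 hδ)
    obtain ⟨K₂, hK₂⟩ := exists_nat_one_div_lt (show 0 < ε / (4 * C) by positivity)
    refine ⟨max K₁ K₂, fun k hk l hl => ?_⟩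
    have hR := hsmall (w k - w l) ((hwX k).sub hp (hwX l))
      ((eLpNorm_sub_le (hwX k).memLp_grad.1 (hwX l).memLp_grad.1 hP).trans
        (add_le_add (hvM _) (hvM _)))
      (hK₁ k (le_of_max_le_left hk) l (le_of_max_le_left hl))
    -- The midpoint has weight at least `1 - p t`, so its energy is at least `lam (1 - p t)`; a
    -- minimizing sequence therefore has small convexity defect.
    have h1 := one_sub_le_of_pEnergy_eq_one hp (hwR k) (hwR l) (hv1 _) ht0.le (min_le_left _ _) hR
    have h2 := h _ (hT.smul_mem (1 / 2) _ (hT.add_mem _ (hw k) _ (hw l)))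
    have h3 := hunif _ _ (hwX k) (hwX l)
    have hn : ∀ n ≥ max K₁ K₂, opEnergy A s p V (w n) ≤ lam + ε / (4 * C) := fun n hn => by
      refine (hwQ n).trans ?_
      have : (1 : ℝ) / (n + 1) ≤ 1 / (K₂ + 1) := by
        gcongr
        exact le_of_max_le_right hn
      linarith
    have hk' := hn k hk
    have hl' := hn l hl
    have h4 : lam * (1 - p * t) ≤ opEnergy A s p V ((1 / 2 : ℝ) • (w k + w l)) :=
      (mul_le_mul_of_nonneg_left h1 hlam.le).trans h2
    have h5 : ε / (4 * (lam + 1)) * (opEnergy A s p V (w k) + opEnergy A s p V (w l)) ≤ ε / 2 := by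
      calc _ ≤ ε / (4 * (lam + 1)) * (2 * (lam + 1)) := by
            gcongr
            linarith [hwQ1 k, hwQ1 l]
        _ = ε / 2 := by field_simp; ring
    have h6 : C * ((opEnergy A s p V (w k) + opEnergy A s p V (w l)) / 2
        - opEnergy A s p V ((1 / 2 : ℝ) • (w k + w l))) ≤ C * (ε / (4 * C) + lam * p * t) := by
      gcongr
      linarith
    have h7 : C * (ε / (4 * C) + lam * p * t) = ε / 4 + C * lam * p * t := by
      field_simp
    linarith
  -- The energy controls the gradient norm, so the gradients are Cauchy; the functions already
  -- converge to `f` by Rellich.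
  obtain ⟨G, hG, hGl⟩ := exists_tendsto_eLpNorm_of_cauchy hP (fun k => (hwX k).memLp_grad) (by
    intro ε hε
    obtain ⟨η, hη0, hη⟩ := ENNReal.lt_iff_exists_real_btwn.1 hε
    have hη1 : 0 < η := by simpa using hη.1
    obtain ⟨K, hK⟩ := hcauchyQ (η ^ p) (by positivity)
    refine ⟨K, fun k hk l hl => lt_of_le_of_lt ?_ hη.2⟩
    refine (H.eLpNorm_grad_le hA hT (hT.sub_mem (hw k) (hw l))).trans ?_
    refine ENNReal.ofReal_le_ofReal ?_
    rw [Real.rpow_inv_le_iff_of_pos (opEnergy_nonneg _) hη0 hp0]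
    exact hK k hk l hl)
  have hmem : (f, G) ∈ T := hT.closed w (f, G) hw hf.1 hG.1 hfl hGl
  obtain ⟨e1, e2⟩ := H.tendsto_energy hA hwX (hT.memX _ hmem) hfl hGl
  refine ⟨(f, G), hmem, ?_, ?_⟩
  · refine tendsto_nhds_unique e2 ?_
    simp only [w, hv1, tendsto_const_nhds]
  · refine tendsto_nhds_unique e1 (tendsto_of_tendsto_of_tendsto_of_le_of_le tendsto_const_nhds
      ?_ (fun k => ?_) hwQ)
    · simpa using tendsto_const_nhds.add tendsto_one_div_add_atTop_nhds_zero_nat (a := lam)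
    · have := h _ (hw k)
      rwa [hv1, mul_one] at this

/-- Existence of the first eigenvalue, and its variational characterization. -/
theorem Admissible.exists_isFirstEigenvalue (H : Admissible Ω s p V g) (hA : A ⊆ Ω)
    (hT : IsEnergySpace Ω A p T) {w₀ : (RN N → ℝ) × (RN N → RN N)} (hw₀ : w₀ ∈ T)
    (h0 : ¬ w₀.1 =ᵐ[volume] 0) :
    ∃ lam : ℝ, IsFirstEigenvalue T A s p V g lam ∧
      ∀ w ∈ T, lam * pEnergy p (wMeasure A g) w.1 ≤ opEnergy A s p V w := by
  have hp := H.p_gt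
  have hp0 : 0 < p := by linarith
  obtain ⟨K, hK, hKle⟩ := H.exists_weight_le hA hT
  set S := {r : ℝ | ∃ w ∈ T, pEnergy p (wMeasure A g) w.1 = 1 ∧ r = opEnergy A s p V w}
  have hlow : ∀ r ∈ S, 1 / K ≤ r := by
    rintro r ⟨w, hw, hw1, rfl⟩
    rw [div_le_iff₀ hK, ← hw1, mul_comm]
    exact hKle w hw
  have hbdd : BddBelow S := ⟨1 / K, hlow⟩
  have hr := H.weight_pos hA hT hw₀ h0
  have hne : S.Nonempty := by
    set r := pEnergy p (wMeasure A g) w₀.1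
    refine ⟨_, (r⁻¹ ^ p⁻¹) • w₀, hT.smul_mem _ _ hw₀, ?_, rfl⟩
    rw [Prod.smul_fst, pEnergy_smul, abs_of_nonneg (by positivity),
      Real.rpow_inv_rpow (by positivity) hp0.ne']
    exact inv_mul_cancel₀ hr.ne'
  have hpos : 0 < sInf S := (by positivity : 0 < 1 / K).trans_le (le_csInf hne hlow)
  have hray := H.rayleigh_of_normalized hT (lam := sInf S)
    fun w hw hw1 => csInf_le hbdd ⟨w, hw, hw1, rfl⟩
  obtain ⟨w, hw, hw1, hwQ⟩ := H.exists_minimizer hA hT hpos hray (by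
    intro ε hε
    obtain ⟨r, ⟨w, hw, hw1, rfl⟩, hr⟩ := exists_lt_of_csInf_lt hne (lt_add_of_pos_right _ hε)
    exact ⟨w, hw, hw1, hr⟩)
  refine ⟨sInf S, H.isFirstEigenvalue_of_le hA hT hpos (u := w.1) ⟨w.2, hw, ?_, ?_⟩ hray, hray⟩
  · intro hw0
    have : pEnergy p (wMeasure A g) w.1 = 0 :=
      (pEnergy_eq_zero_iff hp ((hT.memX _ hw).memLp_wMeasure hp H.p_lt hA H.memg)).2
        ((wMeasure_absolutelyContinuous g).ae_eq hw0)
    rw [hw1] at this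
    exact one_ne_zero this
  · exact H.eigenfunction_of_minimizer hA hT hray hw (by rw [hwQ, hw1, mul_one])

end Minimizer

end MixedEigen

namespace MixedEigen

/-! ### Picone's inequalities -/

section Picone

variable {p : ℝ}

/-- Bernoulli's inequality for `(r/t)^p`, multiplied by `t^p`. -/
theorem young_rpow_sub_one (hp : 1 < p) {t r : ℝ} (ht : 0 ≤ t) (hr : 0 ≤ r) :
    p * t ^ (p - 1) * r ≤ (p - 1) * t ^ p + r ^ p := by
  rcases ht.eq_or_lt with rfl | ht
  · rw [Real.zero_rpow (by linarith), Real.zero_rpow (by linarith)]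
    simp only [mul_zero, zero_mul, zero_add]
    positivity
  · have h := one_add_mul_self_le_rpow_one_add (s := r / t - 1)
      (by have : 0 ≤ r / t := by positivity
          linarith) hp.le
    rw [add_sub_cancel, Real.div_rpow hr ht.le, le_div_iff₀ (by positivity)] at h
    have e : t ^ p = t ^ (p - 1) * t := by
      rw [← Real.rpow_add_one ht.ne', sub_add_cancel]
    have e2 : (1 + p * (r / t - 1)) * t ^ p = p * t ^ (p - 1) * r - (p - 1) * t ^ p := by
      rw [e]; field_simp; ring
    linarith

/-- Picone's inequality. -/
theorem picone_local {F : Type*} [NormedAddCommGroup F] [InnerProductSpace ℝ F] (hp : 1 < p)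
    (X D : F) {a : ℝ} (ha : 0 < a) (c : ℝ) :
    ‖X‖ ^ (p - 2) * inner ℝ X (((1 - p) * |c| ^ p * a ^ (-p)) • X
      + (p * a ^ (1 - p) * (|c| ^ (p - 2) * c)) • D) ≤ ‖D‖ ^ p := by
  have h1 := norm_rpow_mul_inner_self hp X
  have h2 := abs_norm_rpow_mul_inner_le hp X D
  have h3 := abs_norm_rpow_mul_inner_le hp c 1
  simp only [Real.norm_eq_abs, RCLike.inner_apply, conj_trivial, one_mul, abs_one, mul_one] at h3
  -- With this `t`, Young's inequality is Picone's inequality in the case where `X` and `D` are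
  -- aligned; Cauchy–Schwarz covers the general case.
  have hy := young_rpow_sub_one hp (t := |c| * ‖X‖ / a) (by positivity) (norm_nonneg D)
  have e1 : (|c| * ‖X‖ / a) ^ p = |c| ^ p * ‖X‖ ^ p * a ^ (-p) := by
    rw [Real.div_rpow (by positivity) ha.le, Real.mul_rpow (abs_nonneg c) (norm_nonneg X),
      Real.rpow_neg ha.le, div_eq_mul_inv]
  have e2 : (|c| * ‖X‖ / a) ^ (p - 1) = |c| ^ (p - 1) * ‖X‖ ^ (p - 1) * a ^ (1 - p) := by
    rw [Real.div_rpow (by positivity) ha.le, Real.mul_rpow (abs_nonneg c) (norm_nonneg X),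
      show 1 - p = -(p - 1) by ring, Real.rpow_neg ha.le, div_eq_mul_inv]
  rw [e1, e2] at hy
  have h4 : (|c| ^ (p - 2) * c) * (‖X‖ ^ (p - 2) * inner ℝ X D)
      ≤ |c| ^ (p - 1) * (‖X‖ ^ (p - 1) * ‖D‖) := by
    refine (le_abs_self _).trans ?_
    rw [abs_mul]
    exact mul_le_mul h3 h2 (abs_nonneg _) (by positivity)
  have h5 := mul_le_mul_of_nonneg_left h4 (show 0 ≤ p * a ^ (1 - p) by
    have : 0 < p := by linarith
    positivity)
  rw [inner_add_right, inner_smul_right, inner_smul_right]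
  calc _ = (1 - p) * |c| ^ p * a ^ (-p) * (‖X‖ ^ (p - 2) * inner ℝ X X)
        + p * a ^ (1 - p) * ((|c| ^ (p - 2) * c) * (‖X‖ ^ (p - 2) * inner ℝ X D)) := by ring
    _ ≤ (1 - p) * |c| ^ p * a ^ (-p) * ‖X‖ ^ p
        + p * a ^ (1 - p) * (|c| ^ (p - 1) * (‖X‖ ^ (p - 1) * ‖D‖)) := by rw [h1]; gcongr
    _ ≤ _ := by linarith

theorem rpow_one_sub_eq {a : ℝ} (ha : 0 < a) : a ^ (1 - p) = (a ^ (p - 1))⁻¹ := by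
  rw [← Real.rpow_neg ha.le, neg_sub]

/-- Convexity of `x ↦ x^p` applied to `c ≤ |c-d| + d`, the right side being read as the combination
of `|c-d| a/(a-b)` and `d a/b` with weights `(a-b)/a` and `b/a`. Multiplying by `((a-b)/a)^(p-1)`
gives the claim. -/
theorem picone_discrete_of_lt (hp : 1 < p) {a b c d : ℝ} (hb : 0 < b) (hab : b < a)
    (hc : 0 ≤ c) (hd : 0 ≤ d) :
    (a - b) ^ (p - 1) * (c ^ p * a ^ (1 - p) - d ^ p * b ^ (1 - p)) ≤ |c - d| ^ p := by
  have ha : 0 < a := hb.trans hab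
  have hd' : 0 < a - b := sub_pos.2 hab
  have key : ∀ {x : ℝ}, 0 < x → x ^ p = x ^ (p - 1) * x := fun {x} hx => by
    rw [← Real.rpow_add_one hx.ne', sub_add_cancel]
  set e := |c - d|
  have he : 0 ≤ e := abs_nonneg _
  have hconv : ((a - b) / a * (e * a / (a - b)) + b / a * (d * a / b)) ^ p
      ≤ (a - b) / a * (e * a / (a - b)) ^ p + b / a * (d * a / b) ^ p :=
    (convexOn_rpow hp.le).2 (Set.mem_Ici.2 (by positivity)) (Set.mem_Ici.2 (by positivity))
      (by positivity) (by positivity) (by field_simp; ring)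
  have hle : c ≤ (a - b) / a * (e * a / (a - b)) + b / a * (d * a / b) := by
    have : (a - b) / a * (e * a / (a - b)) + b / a * (d * a / b) = e + d := by field_simp
    rw [this]
    have := le_abs_self (c - d)
    linarith
  have h1 := (Real.rpow_le_rpow hc hle (by linarith : 0 ≤ p)).trans hconv
  rw [Real.div_rpow (by positivity) hd'.le, Real.mul_rpow he ha.le,
    Real.div_rpow (by positivity) hb.le, Real.mul_rpow hd ha.le, key ha, key hb, key hd'] at h1
  rw [rpow_one_sub_eq ha, rpow_one_sub_eq hb]
  have hA : 0 < a ^ (p - 1) := by positivity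
  have hB : 0 < b ^ (p - 1) := by positivity
  have hD : 0 < (a - b) ^ (p - 1) := by positivity
  generalize a ^ (p - 1) = A at *
  generalize b ^ (p - 1) = B at *
  generalize (a - b) ^ (p - 1) = D at *
  have h2 : (a - b) / a * (e ^ p * (A * a) / (D * (a - b))) + b / a * (d ^ p * (A * a) / (B * b))
      = A / D * (e ^ p + D * (d ^ p * B⁻¹)) := by
    field_simp
  rw [h2] at h1
  have h3 := mul_le_mul_of_nonneg_left h1 (show 0 ≤ D / A by positivity)
  have h4 : D / A * (A / D * (e ^ p + D * (d ^ p * B⁻¹))) = e ^ p + D * (d ^ p * B⁻¹) := by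
    field_simp
  rw [h4] at h3
  have h5 : D / A * c ^ p = D * (c ^ p * A⁻¹) := by field_simp
  rw [h5] at h3
  linarith

/-- Picone's inequality for differences. -/
theorem picone_discrete (hp : 1 < p) {a b c d : ℝ} (ha : 0 < a) (hb : 0 < b)
    (hc : 0 ≤ c) (hd : 0 ≤ d) :
    |a - b| ^ (p - 2) * ((a - b) * (c ^ p * a ^ (1 - p) - d ^ p * b ^ (1 - p)))
      ≤ |c - d| ^ p := by
  have key : ∀ {x : ℝ}, 0 < x → x ^ (p - 1) = x ^ (p - 2) * x := fun {x} hx => by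
    rw [← Real.rpow_add_one hx.ne']; congr 1; ring
  rcases lt_trichotomy a b with h | rfl | h
  · have := picone_discrete_of_lt hp ha h hd hc
    rw [abs_sub_comm d c, key (sub_pos.2 h)] at this
    rw [abs_sub_comm a b, abs_of_pos (sub_pos.2 h)]
    linarith
  · simp only [sub_self, zero_mul, mul_zero]
    positivity
  · have := picone_discrete_of_lt hp hb h hc hd
    rw [key (sub_pos.2 h)] at this
    rw [abs_of_pos (sub_pos.2 h)]
    linarith

end Picone

/-! ### The Picone test function -/

section TestFunction

variable {N : ℕ} {Ω : Set (RN N)} {p : ℝ}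

theorem IsC1c.abs_rpow {φ : RN N → ℝ} (hφ : IsC1c Ω φ) (hp : 1 < p) :
    IsC1c Ω fun x => |φ x| ^ p where
  smooth := (contDiff_norm_rpow hp).comp hφ.smooth
  compact := hφ.compact.comp_left (g := fun t : ℝ => |t| ^ p)
    (by simp [Real.zero_rpow (by linarith : p ≠ 0)])
  support_subset := (closure_mono (Function.support_comp_subset (g := fun t : ℝ => |t| ^ p)
    (by simp [Real.zero_rpow (by linarith : p ≠ 0)]) φ)).trans hφ.support_subset

theorem IsC1c.gradient_abs_rpow {φ : RN N → ℝ} (hφ : IsC1c Ω φ) (hp : 1 < p) (x : RN N) :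
    gradient (fun y => |φ y| ^ p) x = (p * (|φ x| ^ (p - 2) * φ x)) • gradient φ x := by
  rw [← mul_assoc]
  exact gradient_comp (F := fun t => |t| ^ p) (hasDerivAt_abs_rpow (φ x) hp) (hφ.differentiable x)

/-- The test function `|φ|^p (u + ε)^(1-p)`. -/
theorem MemX.exists_picone_test (hp : 1 < p) (hΩ : IsOpen Ω)
    {w : (RN N → ℝ) × (RN N → RN N)} (hw : MemX Ω p w) (h0 : ∀ᵐ x, 0 ≤ w.1 x)
    {φ : RN N → ℝ} (hφ : IsTestFunction Ω φ) {ε : ℝ} (hε : 0 < ε) :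
    ∃ z : (RN N → ℝ) × (RN N → RN N), MemX Ω p z ∧
      (∀ᵐ x, z.1 x = |φ x| ^ p * (w.1 x + ε) ^ (1 - p)) ∧
      ∀ᵐ x, z.2 x = ((1 - p) * |φ x| ^ p * (w.1 x + ε) ^ (-p)) • w.2 x
        + (p * (w.1 x + ε) ^ (1 - p) * (|φ x| ^ (p - 2) * φ x)) • gradient φ x := by
  -- The derivative of `(r + ε)^(1-p)`, continued as a constant for `r < 0`, is bounded and
  -- continuous on the whole line, as the chain rule requires. Its primitive vanishes at zero; the
  -- missing constant `ε^(1-p)` is restored by adding that multiple of `|φ|^p`.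
  set f : ℝ → ℝ := fun r => (1 - p) * (max r 0 + ε) ^ (-p)
  have hpos : ∀ r : ℝ, 0 < max r 0 + ε := fun r => by positivity
  have hf : Continuous f := by
    refine continuous_const.mul ?_
    exact (by fun_prop : Continuous fun r : ℝ => max r 0 + ε).rpow_const
      fun r => .inl (hpos r).ne'
  set F : ℝ → ℝ := fun t => ∫ r in (0 : ℝ)..t, f r
  have hF : ∀ t, HasDerivAt F (f t) t := fun t =>
    intervalIntegral.integral_hasDerivAt_right (hf.intervalIntegrable _ _)
      hf.aestronglyMeasurable.stronglyMeasurableAtFilter hf.continuousAt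
  have hFe : ∀ t, 0 ≤ t → F t = (t + ε) ^ (1 - p) - ε ^ (1 - p) := fun t ht => by
    have := intervalIntegral.integral_eq_sub_of_hasDerivAt (a := 0) (b := t)
      (f := fun r => (r + ε) ^ (1 - p)) (f' := f) (fun r hr => by
        rw [Set.uIcc_of_le ht] at hr
        have h1 : HasDerivAt (fun r => (r + ε) ^ (1 - p)) (1 * (1 - p) * (r + ε) ^ (1 - p - 1)) r :=
          ((hasDerivAt_id r).add_const ε).rpow_const (.inl (by simp only [id]; linarith [hr.1]))
        refine h1.congr_deriv ?_
        change _ = (1 - p) * (max r 0 + ε) ^ (-p)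
        rw [max_eq_left hr.1, one_mul, show 1 - p - 1 = -p by ring]) (hf.intervalIntegrable _ _)
    rw [zero_add] at this
    exact this
  have hC : ∀ t, |f t| ≤ (p - 1) * ε ^ (-p) := fun t => by
    simp only [f, abs_mul]
    rw [abs_of_neg (by linarith : 1 - p < 0), abs_of_pos (by have := hpos t; positivity), neg_sub]
    gcongr ?_ * ?_
    exact Real.rpow_le_rpow_of_nonpos hε (by linarith [le_max_right t 0]) (by linarith)
  have hθ := hφ.isC1c.abs_rpow hp
  have m1 := (hw.comp hp hΩ hF hf hC (by simp [F])).mul_left hp hΩ hθ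
  have m2 := (hθ.memX hΩ).smul hp (ε ^ (1 - p))
  refine ⟨_, m1.add hp m2, ?_, ?_⟩
  · filter_upwards [h0] with x hx
    simp only [Prod.fst_add, Pi.add_apply, Prod.smul_fst, Pi.smul_apply, smul_eq_mul, hFe _ hx]
    ring
  · filter_upwards [h0] with x hx
    simp only [Prod.snd_add, Pi.add_apply, Prod.smul_snd, Pi.smul_apply, hFe _ hx,
      hφ.isC1c.gradient_abs_rpow hp, f, max_eq_left hx]
    module

end TestFunction

section Kernel

variable {N : ℕ} {s p : ℝ}

/-- The kernel is positive off the diagonal, so there its null sets are Lebesgue null, and Fubini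
gives the slices. -/
theorem ae_ae_of_ae_kernMeasure {P : RN N × RN N → Prop}
    (h : ∀ᵐ y ∂(kernMeasure N s p), P y) : ∀ᵐ x, ∀ᵐ y, x ≠ y → P (x, y) := by
  have hm : Measurable fun y : RN N × RN N => kern N s p (y.1 - y.2) :=
    measurable_kern.comp (measurable_fst.sub measurable_snd)
  rw [kernMeasure, ae_withDensity_iff hm, Measure.volume_eq_prod] at h
  filter_upwards [Measure.ae_ae_of_ae_prod h] with x hx
  filter_upwards [hx] with y hy hxy
  refine hy ?_
  have : 0 < ‖x - y‖ := norm_pos_iff.2 (sub_ne_zero.2 hxy)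
  simp only [kern, ne_eq, ENNReal.ofReal_eq_zero, not_le]
  positivity

end Kernel

end MixedEigen

namespace MixedEigen

/-! ### Maximum principle and eigenfunctions of one sign -/

section Sign

variable {N : ℕ} {Ω : Set (RN N)} {s p : ℝ} {V g : RN N → ℝ}

theorem abs_rpow_sub_two_mul_eq {u ε : ℝ} (hp : 1 < p) (hu : 0 ≤ u) (hε : 0 < ε) (c : ℝ) :
    |u| ^ (p - 2) * (c * (u + ε) ^ (1 - p) * u) = c * (u / (u + ε)) ^ (p - 1) := by
  have hue : 0 < u + ε := by linarith
  rw [abs_of_nonneg hu, Real.div_rpow hu hue.le, rpow_one_sub_eq hue]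
  rcases hu.eq_or_lt with rfl | hu
  · rw [Real.zero_rpow (by linarith : p - 1 ≠ 0)]; simp
  · have : u ^ (p - 1) = u ^ (p - 2) * u := by
      rw [← Real.rpow_add_one hu.ne']; congr 1; ring
    rw [this]; ring

theorem div_add_rpow_le_one {u ε : ℝ} (hp : 1 < p) (hu : 0 ≤ u) (hε : 0 < ε) :
    (u / (u + ε)) ^ (p - 1) ≤ 1 :=
  Real.rpow_le_one (by positivity) (by rw [div_le_one (by linarith)]; linarith) (by linarith)

/-- The nonlocal integrand of the weak formulation tested with `|φ|^p (u + ε)^(1-p)`. -/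
noncomputable def piconeKernel (p ε : ℝ) (φ u : RN N → ℝ) (y : RN N × RN N) : ℝ :=
  |u y.1 - u y.2| ^ (p - 2) * ((u y.1 - u y.2)
    * (|φ y.1| ^ p * (u y.1 + ε) ^ (1 - p) - |φ y.2| ^ p * (u y.2 + ε) ^ (1 - p)))

theorem piconeKernel_le (hp : 1 < p) {ε : ℝ} (hε : 0 < ε) {φ u : RN N → ℝ} {y : RN N × RN N}
    (h1 : 0 ≤ u y.1) (h2 : 0 ≤ u y.2) : piconeKernel p ε φ u y ≤ ‖pairDiff φ y‖ ^ p := by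
  have := picone_discrete hp (a := u y.1 + ε) (b := u y.2 + ε) (by linarith) (by linarith)
    (abs_nonneg (φ y.1)) (abs_nonneg (φ y.2))
  rw [add_sub_add_right_eq_sub] at this
  refine this.trans (Real.rpow_le_rpow (abs_nonneg _) ?_ (by linarith))
  exact abs_abs_sub_abs_le_abs_sub _ _

/-- The integrated Picone inequality. -/
theorem Admissible.picone_energy (H : Admissible Ω s p V g) {lam : ℝ}
    {w : (RN N → ℝ) × (RN N → RN N)} (hw : MemX Ω p w) (h0 : ∀ᵐ x, 0 ≤ w.1 x)
    (hE : ∀ z ∈ spaceX0 Ω p, weakForm Ω s p V g lam w z = 0) {φ : RN N → ℝ}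
    (hφ : IsTestFunction Ω φ) {ε : ℝ} (hε : 0 < ε) :
    Integrable (fun y => ‖pairDiff φ y‖ ^ p - piconeKernel p ε φ w.1 y) (kernMeasure N s p) ∧
    lam * ∫ x, |φ x| ^ p * (w.1 x / (w.1 x + ε)) ^ (p - 1) ∂(wMeasure Ω g)
      + ∫ y, (‖pairDiff φ y‖ ^ p - piconeKernel p ε φ w.1 y) ∂(kernMeasure N s p)
      ≤ opEnergy Ω s p V (φ, gradient φ) := by
  have hp := H.p_gt
  have hN := H.N_pos
  have hX : MemX Ω p (φ, gradient φ) := hφ.memX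
  -- The gradient term is bounded by Picone's inequality and the potential term by `(u/(u+ε))^(p-1)
  -- ≤ 1`. The nonlocal defect is kept instead of estimated, because the maximum principle reads off
  -- its blow-up.
  obtain ⟨z, hz, hz1, hz2⟩ := hw.exists_picone_test hp H.isOpen h0 hφ hε
  have hEz := hE z ((mem_spaceX0_iff hp H.isOpen).2 hz)
  rw [H.weakForm_eq subset_rfl] at hEz
  have i1 : pForm p (volume.restrict Ω) w.2 z.2 ≤ pEnergy p (volume.restrict Ω) (gradient φ) := by
    refine integral_mono_ae (integrable_pForm hp (hw.memLp_grad.restrict _)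
      (hz.memLp_grad.restrict _)) (integrable_norm_rpow_of_memLp hp
        (hX.memLp_grad.restrict _)) (ae_restrict_of_ae ?_)
    filter_upwards [hz2, h0] with x hx h0x
    simp only [hx]
    exact picone_local hp _ _ (by linarith) _
  have hκφ := integrable_norm_rpow_of_memLp hp (hX.memLp_pairDiff hN H.s_pos H.s_lt hp)
  have hκ := integrable_pForm hp (hw.memLp_pairDiff hN H.s_pos H.s_lt hp)
    (hz.memLp_pairDiff hN H.s_pos H.s_lt hp)
  have e2 : (fun y => ‖pairDiff w.1 y‖ ^ (p - 2) * inner ℝ (pairDiff w.1 y) (pairDiff z.1 y))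
      =ᵐ[kernMeasure N s p] piconeKernel p ε φ w.1 := by
    filter_upwards [ae_kernMeasure_of_ae (s := s) (p := p) hz1] with y hy
    simp only [pairDiff, piconeKernel, hy.1, hy.2, Real.norm_eq_abs, RCLike.inner_apply,
      conj_trivial]
    ring
  have hκ' := hκ.congr e2
  have hval : ∀ᵐ x, ‖w.1 x‖ ^ (p - 2) * inner ℝ (w.1 x) (z.1 x)
      = |φ x| ^ p * (w.1 x / (w.1 x + ε)) ^ (p - 1) := by
    filter_upwards [hz1, h0] with x hx h0x
    simp only [hx, Real.norm_eq_abs, RCLike.inner_apply, conj_trivial]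
    exact abs_rpow_sub_two_mul_eq hp h0x hε _
  have i3 : pForm p (wMeasure Ω V) w.1 z.1 ≤ pEnergy p (wMeasure Ω V) φ := by
    refine integral_mono_ae (integrable_pForm hp (hw.memLp_wMeasure hp H.p_lt subset_rfl H.memV)
      (hz.memLp_wMeasure hp H.p_lt subset_rfl H.memV)) (integrable_norm_rpow_of_memLp hp
        (hX.memLp_wMeasure hp H.p_lt subset_rfl H.memV))
        ((wMeasure_absolutelyContinuous V).ae_le ?_)
    filter_upwards [hval, h0] with x hx h0x
    simp only [hx]
    exact mul_le_of_le_one_right (by positivity) (div_add_rpow_le_one hp h0x hε)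
  have e4 : pForm p (wMeasure Ω g) w.1 z.1
      = ∫ x, |φ x| ^ p * (w.1 x / (w.1 x + ε)) ^ (p - 1) ∂(wMeasure Ω g) :=
    integral_congr_ae ((wMeasure_absolutelyContinuous g).ae_le hval)
  refine ⟨hκφ.sub hκ', ?_⟩
  rw [integral_sub hκφ hκ', ← integral_congr_ae e2, ← e4]
  simp only [opForm, pForm] at hEz i1 i3 ⊢
  simp only [opEnergy, pEnergy] at i1 i3 ⊢
  linarith

/-- Where `u(x) = 0 < u(y)`, the kernel contains `-u(y)^(p-1) |φ(x)|^p ε^(1-p)`, which diverges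
since `p > 1`; the remaining part stays bounded. -/
theorem tendsto_piconeKernel (hp : 1 < p) {φ u : RN N → ℝ} {y : RN N × RN N}
    (h1 : u y.1 = 0) (h2 : φ y.1 ≠ 0) (h3 : 0 < u y.2) :
    Tendsto (fun n : ℕ => ‖pairDiff φ y‖ ^ p - piconeKernel p (1 / (n + 1)) φ u y) atTop
      atTop := by
  have hc : 0 < |φ y.1| ^ p := by positivity
  have hb : 0 < |u y.2| ^ (p - 2) * u y.2 := by positivity
  have hlim : Tendsto (fun n : ℕ => |u y.2| ^ (p - 2) * u y.2 * |φ y.1| ^ p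
      * ((n : ℝ) + 1) ^ (p - 1)
      + (-(|u y.2| ^ (p - 2) * u y.2 * (|φ y.2| ^ p * u y.2 ^ (1 - p))))) atTop atTop := by
    refine tendsto_atTop_add_const_right _ _ (Tendsto.const_mul_atTop (by positivity) ?_)
    exact (tendsto_rpow_atTop (by linarith)).comp
      (tendsto_atTop_add_const_right _ _ tendsto_natCast_atTop_atTop)
  refine tendsto_atTop_mono (fun n => ?_) hlim
  have hn : (0 : ℝ) < n + 1 := by positivity
  have e1 : (1 / ((n : ℝ) + 1)) ^ (1 - p) = (n + 1) ^ (p - 1) := by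
    rw [one_div, Real.inv_rpow hn.le, ← Real.rpow_neg hn.le, neg_sub]
  have e2 : (u y.2 + 1 / ((n : ℝ) + 1)) ^ (1 - p) ≤ u y.2 ^ (1 - p) :=
    Real.rpow_le_rpow_of_nonpos h3 (by have : 0 < 1 / ((n : ℝ) + 1) := by positivity
                                       linarith) (by linarith)
  have e3 : 0 ≤ ‖pairDiff φ y‖ ^ p := by positivity
  have e4 := mul_le_mul_of_nonneg_left (mul_le_mul_of_nonneg_left e2
    (by positivity : 0 ≤ |φ y.2| ^ p)) hb.le
  simp only [piconeKernel, h1, zero_sub, abs_neg, zero_add, e1]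
  nlinarith

/-- The integrals of the nonnegative defects are bounded by the energy of `φ` independently of `ε`.
By Fatou their lower limit is finite almost everywhere, whereas at the excluded pairs it is
infinite. -/
theorem Admissible.ae_kernMeasure_not (H : Admissible Ω s p V g) {lam : ℝ} (hlam : 0 < lam)
    {w : (RN N → ℝ) × (RN N → RN N)} (hw : MemX Ω p w) (h0 : ∀ᵐ x, 0 ≤ w.1 x)
    (hE : ∀ z ∈ spaceX0 Ω p, weakForm Ω s p V g lam w z = 0) {φ : RN N → ℝ}
    (hφ : IsTestFunction Ω φ) :
    ∀ᵐ y ∂(kernMeasure N s p), ¬ (w.1 y.1 = 0 ∧ φ y.1 ≠ 0 ∧ 0 < w.1 y.2) := by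
  have hp := H.p_gt
  set D : ℕ → RN N × RN N → ℝ := fun n y =>
    ‖pairDiff φ y‖ ^ p - piconeKernel p (1 / ((n : ℝ) + 1)) φ w.1 y
  have hD := fun n : ℕ => H.picone_energy hw h0 hE hφ (ε := 1 / ((n : ℝ) + 1)) (by positivity)
  have hm : ∀ n, AEMeasurable (fun y => ENNReal.ofReal (D n y)) (kernMeasure N s p) :=
    fun n => (hD n).1.1.aemeasurable.ennreal_ofReal
  have hle : ∀ n, ∫⁻ y, ENNReal.ofReal (D n y) ∂(kernMeasure N s p)
      ≤ ENNReal.ofReal (opEnergy Ω s p V (φ, gradient φ)) := fun n => by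
    rw [← ofReal_integral_eq_lintegral_ofReal (hD n).1]
    · refine ENNReal.ofReal_le_ofReal ?_
      have h1 := (hD n).2
      have h2 : 0 ≤ ∫ x, |φ x| ^ p * (w.1 x / (w.1 x + 1 / ((n : ℝ) + 1))) ^ (p - 1)
          ∂(wMeasure Ω g) := by
        refine integral_nonneg_of_ae ((wMeasure_absolutelyContinuous g).ae_le ?_)
        filter_upwards [h0] with x hx
        simp only [Pi.zero_apply]
        positivity
      have h3 := mul_nonneg hlam.le h2
      linarith
    · filter_upwards [ae_kernMeasure_of_ae (s := s) (p := p) h0] with y hy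
      exact sub_nonneg.2 (piconeKernel_le hp (by positivity) hy.1 hy.2)
  have hfatou := (lintegral_liminf_le' (u := atTop) hm).trans
    (liminf_le_of_frequently_le' (Frequently.of_forall hle))
  have hliminf : AEMeasurable (fun y => liminf (fun n => ENNReal.ofReal (D n y)) atTop)
      (kernMeasure N s p) := by
    simp only [liminf_eq_iSup_iInf_of_nat']
    exact .iSup fun n => .iInf fun i => hm _
  have hfin := ae_lt_top' hliminf (hfatou.trans_lt ENNReal.ofReal_lt_top).ne
  filter_upwards [hfin] with y hy
  rintro ⟨h1, h2, h3⟩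
  have := (ENNReal.tendsto_ofReal_atTop.comp (tendsto_piconeKernel hp h1 h2 h3)).liminf_eq
  exact hy.ne this

/-- The strong maximum principle. -/
theorem Admissible.ae_pos (H : Admissible Ω s p V g) {lam : ℝ} (hlam : 0 < lam)
    {w : (RN N → ℝ) × (RN N → RN N)} (hw : MemX Ω p w) (h0 : ∀ᵐ x, 0 ≤ w.1 x)
    (hne : ¬ w.1 =ᵐ[volume] 0)
    (hE : ∀ z ∈ spaceX0 Ω p, weakForm Ω s p V g lam w z = 0) :
    ∀ᵐ x, x ∈ Ω → 0 < w.1 x := by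
  have key : ∀ φ, IsTestFunction Ω φ → ∀ᵐ x, φ x ≠ 0 → w.1 x ≠ 0 := by
    intro φ hφ
    -- One typical zero of `u` with `φ ≠ 0` would exclude `u(y) > 0` for almost every `y`, so `u`
    -- would be trivial.
    filter_upwards [ae_ae_of_ae_kernMeasure (H.ae_kernMeasure_not hlam hw h0 hE hφ)] with x hx h1 h2
    refine hne ?_
    filter_upwards [hx, h0] with y hy h0y
    by_contra hy0
    have hpos : 0 < w.1 y := lt_of_le_of_ne h0y (Ne.symm hy0)
    exact hy (fun h => by rw [h] at h2; exact hpos.ne' h2) ⟨h2, h1, hpos⟩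
  -- Nullity is local; on a small closed ball inside `Ω` a cutoff equal to one supplies the
  -- nonvanishing `φ`.
  have hnull : volume {x | x ∈ Ω ∧ w.1 x = 0} = 0 := by
    refine measure_null_of_locally_null _ fun x hx => ?_
    obtain ⟨r, hr, hrΩ⟩ := Metric.nhds_basis_closedBall.mem_iff.1 (H.isOpen.mem_nhds hx.1)
    obtain ⟨θ, hθ, -, hθ1⟩ := exists_cutoff (isCompact_closedBall x r) H.isOpen hrΩ
    refine ⟨{x | x ∈ Ω ∧ w.1 x = 0} ∩ Metric.closedBall x r,
      inter_mem self_mem_nhdsWithin (mem_nhdsWithin_of_mem_nhds (Metric.closedBall_mem_nhds x hr)),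
      measure_mono_null ?_ (key θ hθ)⟩
    rintro y ⟨⟨-, hy⟩, hyr⟩ h
    exact h (by rw [(hθ1 y hyr).eq_of_nhds]; exact one_ne_zero) hy
  filter_upwards [h0, measure_eq_zero_iff_ae_notMem.1 hnull] with x h1 h2 h3
  exact lt_of_le_of_ne h1 fun h => h2 ⟨h3, h.symm⟩

/-- Drop the nonnegative defect in the integrated Picone inequality and let `ε → 0`: since `u > 0`
almost everywhere, `u/(u+ε) → 1`. -/
theorem Admissible.rayleigh_of_nonneg (H : Admissible Ω s p V g) {lam : ℝ} (hlam : 0 < lam)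
    {w : (RN N → ℝ) × (RN N → RN N)} (hw : MemX Ω p w) (h0 : ∀ᵐ x, 0 ≤ w.1 x)
    (hne : ¬ w.1 =ᵐ[volume] 0)
    (hE : ∀ z ∈ spaceX0 Ω p, weakForm Ω s p V g lam w z = 0) {φ : RN N → ℝ}
    (hφ : IsTestFunction Ω φ) :
    lam * pEnergy p (wMeasure Ω g) φ ≤ opEnergy Ω s p V (φ, gradient φ) := by
  have hp := H.p_gt
  have hpos : ∀ᵐ x ∂(wMeasure Ω g), 0 < w.1 x :=
    (withDensity_absolutelyContinuous _ _).ae_le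
      ((ae_restrict_iff' H.isOpen.measurableSet).2 (H.ae_pos hlam hw h0 hne hE))
  have hX : MemX Ω p (φ, gradient φ) := hφ.memX
  have hint := integrable_norm_rpow_of_memLp hp (hX.memLp_wMeasure hp H.p_lt subset_rfl H.memg)
  have hum : AEMeasurable w.1 (wMeasure Ω g) :=
    (hw.memLp.1.mono_ac (wMeasure_absolutelyContinuous g)).aemeasurable
  have hlim : Tendsto (fun n : ℕ => ∫ x, |φ x| ^ p * (w.1 x / (w.1 x + 1 / ((n : ℝ) + 1))) ^ (p - 1)
      ∂(wMeasure Ω g)) atTop (𝓝 (pEnergy p (wMeasure Ω g) φ)) := by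
    refine tendsto_integral_of_dominated_convergence (fun x => ‖φ x‖ ^ p) (fun n => ?_) hint
      (fun n => ?_) ?_
    · exact hint.1.mul
        ((hum.div (hum.add_const _)).pow_const _).aestronglyMeasurable
    · filter_upwards [hpos] with x hx
      rw [Real.norm_of_nonneg (by positivity)]
      exact mul_le_of_le_one_right (by positivity) (div_add_rpow_le_one hp hx.le (by positivity))
    · filter_upwards [hpos] with x hx
      have h1 : Tendsto (fun n : ℕ => w.1 x / (w.1 x + 1 / ((n : ℝ) + 1))) atTop (𝓝 1) := by
        have := (tendsto_const_nhds (x := w.1 x)).div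
          ((tendsto_const_nhds (x := w.1 x)).add (tendsto_one_div_add_atTop_nhds_zero_nat (𝕜 := ℝ)))
          (by simpa using hx.ne')
        rwa [add_zero, div_self hx.ne'] at this
      have h2 := (h1.rpow_const (p := p - 1) (.inl one_ne_zero)).const_mul (|φ x| ^ p)
      simpa using h2
  refine le_of_tendsto (hlim.const_mul lam) (.of_forall fun n => ?_)
  obtain ⟨-, h2⟩ := H.picone_energy hw h0 hE hφ (ε := 1 / ((n : ℝ) + 1)) (by positivity)
  have h3 : 0 ≤ ∫ y, (‖pairDiff φ y‖ ^ p - piconeKernel p (1 / ((n : ℝ) + 1)) φ w.1 y)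
      ∂(kernMeasure N s p) := by
    refine integral_nonneg_of_ae ?_
    filter_upwards [ae_kernMeasure_of_ae (s := s) (p := p) h0] with y hy
    exact sub_nonneg.2 (piconeKernel_le hp (by positivity) hy.1 hy.2)
  linarith

/-- Testing with the eigenfunction itself makes `lam` the quotient of a positive energy and a
positive weight. -/
theorem Admissible.eigenvalue_pos (H : Admissible Ω s p V g) {A : Set (RN N)} (hA : A ⊆ Ω)
    {T : Set ((RN N → ℝ) × (RN N → RN N))} (hT : IsEnergySpace Ω A p T) {lam : ℝ}
    {w : (RN N → ℝ) × (RN N → RN N)} (hw : w ∈ T) (hne : ¬ w.1 =ᵐ[volume] 0)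
    (hE : weakForm A s p V g lam w w = 0) : 0 < lam := by
  rw [H.weakForm_eq hA, opForm_self H.p_gt, pForm_self H.p_gt] at hE
  have h1 := H.weight_pos hA hT hw hne
  obtain ⟨K, hK, hle⟩ := H.exists_weight_le hA hT
  have h2 := hle w hw
  have h3 : 0 < opEnergy A s p V w := pos_of_mul_pos_right (h1.trans_le h2) hK.le
  exact pos_of_mul_pos_left (by linarith : 0 < lam * pEnergy p (wMeasure A g) w.1) h1.le

/-- An eigenvalue with a nonnegative eigenfunction is the first eigenvalue. -/
theorem Admissible.isFirstEigenvalue_of_nonneg (H : Admissible Ω s p V g) {lam : ℝ}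
    {w : (RN N → ℝ) × (RN N → RN N)} (hw : w ∈ spaceX0 Ω p) (h0 : ∀ᵐ x, 0 ≤ w.1 x)
    (hne : ¬ w.1 =ᵐ[volume] 0)
    (hE : ∀ z ∈ spaceX0 Ω p, weakForm Ω s p V g lam w z = 0) :
    IsFirstEigenvalue (spaceX0 Ω p) Ω s p V g lam := by
  have hp := H.p_gt
  have hT := isEnergySpace_spaceX0 hp H.isOpen (subset_refl Ω)
  have hlam := H.eigenvalue_pos subset_rfl hT hw hne (hE w hw)
  refine H.isFirstEigenvalue_of_le subset_rfl hT hlam (u := w.1) ⟨w.2, hw, hne, hE⟩ fun z hz => ?_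
  have hzX := hT.memX z hz
  obtain ⟨φ, hφ, t1, t2, -⟩ := hzX.exists_seq hp
  obtain ⟨e1, e2⟩ := H.tendsto_energy (A := Ω) subset_rfl (w := fun n => (φ n, gradient (φ n)))
    (fun n => (hφ n).memX) hzX t1 t2
  exact le_of_tendsto_of_tendsto' (e2.const_mul lam) e1 fun n =>
    H.rayleigh_of_nonneg hlam (hT.memX w hw) h0 hne hE (hφ n)

end Sign

end MixedEigen

namespace MixedEigen

/-! ### Testing with the positive part, and the lower bound -/

section Splitting

variable {N : ℕ} {Ω A : Set (RN N)} {s p : ℝ} {V g : RN N → ℝ}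

theorem pForm_neg_left {α F : Type*} [MeasurableSpace α] [NormedAddCommGroup F]
    [InnerProductSpace ℝ F] (μ : Measure α) (f h : α → F) :
    pForm p μ (-f) h = -pForm p μ f h := by
  rw [pForm, pForm, ← integral_neg]
  simp only [Pi.neg_apply, norm_neg, inner_neg_left, mul_neg]

theorem pairDiff_neg (u : RN N → ℝ) : pairDiff (-u) = -pairDiff u := by
  ext y; simp only [pairDiff, Pi.neg_apply]; ring

theorem Admissible.weakForm_neg (H : Admissible Ω s p V g) (hA : A ⊆ Ω) (lam : ℝ)
    (w z : (RN N → ℝ) × (RN N → RN N)) :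
    weakForm A s p V g lam (-w) z = -weakForm A s p V g lam w z := by
  rw [H.weakForm_eq hA, H.weakForm_eq hA]
  simp only [opForm, Prod.fst_neg, Prod.snd_neg, pairDiff_neg, pForm_neg_left]
  ring

/-- The positive part is monotone and 1-Lipschitz: `d` has the sign of `a - b`, and `|d| ≤ |a - b|`.
-/
theorem abs_max_sub_max_rpow_le (hp : 1 < p) (a b : ℝ) :
    |max a 0 - max b 0| ^ p ≤ |a - b| ^ (p - 2) * ((max a 0 - max b 0) * (a - b)) := by
  set d := max a 0 - max b 0
  have hd : |d| ≤ |a - b| := abs_max_sub_max_le_abs a b 0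
  have hs : d * (a - b) = |d| * |a - b| := by
    rw [← abs_mul, abs_of_nonneg]
    rcases le_total a b with h | h
    · exact mul_nonneg_of_nonpos_of_nonpos (sub_nonpos.2 (max_le_max_right _ h)) (sub_nonpos.2 h)
    · exact mul_nonneg (sub_nonneg.2 (max_le_max_right _ h)) (sub_nonneg.2 h)
  rw [hs]
  rcases (abs_nonneg d).eq_or_lt with h | h
  · rw [← h, Real.zero_rpow (by linarith)]; simp
  · have h' := h.trans_le hd
    have e1 : |a - b| ^ (p - 1) = |a - b| ^ (p - 2) * |a - b| := by
      rw [← Real.rpow_add_one h'.ne']; congr 1; ring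
    have e2 : |d| ^ p = |d| ^ (p - 1) * |d| := by
      rw [← Real.rpow_add_one h.ne', sub_add_cancel]
    calc |d| ^ p ≤ |a - b| ^ (p - 1) * |d| := by
          rw [e2]; gcongr
      _ = _ := by rw [e1]; ring

/-- The inequality is `a^(p-1) < (a-b)^(p-1)`. This interaction of opposite signs makes the final
comparison strict. -/
theorem abs_max_sub_max_rpow_lt (hp : 1 < p) {a b : ℝ} (ha : 0 < a) (hb : b < 0) :
    |max a 0 - max b 0| ^ p < |a - b| ^ (p - 2) * ((max a 0 - max b 0) * (a - b)) := by
  rw [max_eq_left ha.le, max_eq_right hb.le, sub_zero, abs_of_pos ha,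
    abs_of_pos (by linarith : 0 < a - b)]
  have e1 : (a - b) ^ (p - 1) = (a - b) ^ (p - 2) * (a - b) := by
    rw [← Real.rpow_add_one (by linarith)]; congr 1; ring
  have e2 : a ^ p = a ^ (p - 1) * a := by
    rw [← Real.rpow_add_one ha.ne', sub_add_cancel]
  have h : a ^ (p - 1) < (a - b) ^ (p - 1) :=
    Real.rpow_lt_rpow ha.le (by linarith) (by linarith)
  have := mul_lt_mul_of_pos_right h ha
  rw [e1] at this
  rw [e2]
  linarith

theorem posPair_fst (w : (RN N → ℝ) × (RN N → RN N)) (x : RN N) :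
    (posPair w).1 x = max (w.1 x) 0 := rfl

theorem posPair_snd_of_pos {w : (RN N → ℝ) × (RN N → RN N)} {x : RN N} (h : 0 < w.1 x) :
    (posPair w).2 x = w.2 x := by
  simp [posPair, h]

theorem posPair_snd_of_nonpos {w : (RN N → ℝ) × (RN N → RN N)} {x : RN N} (h : w.1 x ≤ 0) :
    (posPair w).2 x = 0 := by
  simp [posPair, h]

theorem pForm_posPair_fst (hp : 1 < p) (μ : Measure (RN N))
    (w : (RN N → ℝ) × (RN N → RN N)) :
    pForm p μ w.1 (posPair w).1 = pEnergy p μ (posPair w).1 := by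
  rw [← pForm_self hp]
  refine integral_congr_ae (.of_forall fun x => ?_)
  simp only [posPair_fst]
  rcases le_total (w.1 x) 0 with h | h
  · simp [max_eq_right h]
  · rw [max_eq_left h]

theorem pForm_posPair_snd (hp : 1 < p) (μ : Measure (RN N))
    (w : (RN N → ℝ) × (RN N → RN N)) :
    pForm p μ w.2 (posPair w).2 = pEnergy p μ (posPair w).2 := by
  rw [← pForm_self hp]
  refine integral_congr_ae (.of_forall fun x => ?_)
  rcases le_or_gt (w.1 x) 0 with h | h
  · simp [posPair_snd_of_nonpos h]
  · simp only [posPair_snd_of_pos h]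

/-- The positive part of a sign-changing eigenfunction has Rayleigh quotient below the
eigenvalue. -/
theorem Admissible.opEnergy_posPair_lt (H : Admissible Ω s p V g) {lam : ℝ}
    {w : (RN N → ℝ) × (RN N → RN N)} (hw : MemX Ω p w)
    (hpos : ¬ (posPair w).1 =ᵐ[volume] 0) (hneg : ¬ ∀ᵐ x, 0 ≤ w.1 x)
    (hE : ∀ z ∈ spaceX0 Ω p, weakForm Ω s p V g lam w z = 0) :
    opEnergy Ω s p V (posPair w) < lam * pEnergy p (wMeasure Ω g) (posPair w).1 := by
  have hp := H.p_gt
  have hN := H.N_pos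
  have hX := hw.posPair hp H.isOpen
  have h := hE _ ((mem_spaceX0_iff hp H.isOpen).2 hX)
  rw [H.weakForm_eq subset_rfl, opForm, pForm_posPair_fst hp, pForm_posPair_fst hp,
    pForm_posPair_snd hp] at h
  have hi1 := integrable_pForm hp (hw.memLp_pairDiff hN H.s_pos H.s_lt hp)
    (hX.memLp_pairDiff hN H.s_pos H.s_lt hp)
  have hi2 := integrable_norm_rpow_of_memLp hp (hX.memLp_pairDiff hN H.s_pos H.s_lt hp)
  -- Otherwise the pointwise inequality is an equality at almost every pair, so for almost every `x`
  -- with `u(x) > 0` almost no `y` has `u(y) < 0`. That contradicts the change of sign.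
  have hkey : pEnergy p (kernMeasure N s p) (pairDiff (posPair w).1)
      < pForm p (kernMeasure N s p) (pairDiff w.1) (pairDiff (posPair w).1) := by
    by_contra! hcon
    have hnn : ∀ y, 0 ≤ ‖pairDiff w.1 y‖ ^ (p - 2) * inner ℝ (pairDiff w.1 y)
        (pairDiff (posPair w).1 y) - ‖pairDiff (posPair w).1 y‖ ^ p := fun y =>
      sub_nonneg.2 (abs_max_sub_max_rpow_le hp (w.1 y.1) (w.1 y.2))
    have h0 : ∫ y, (‖pairDiff w.1 y‖ ^ (p - 2) * inner ℝ (pairDiff w.1 y)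
        (pairDiff (posPair w).1 y) - ‖pairDiff (posPair w).1 y‖ ^ p) ∂(kernMeasure N s p) = 0 := by
      refine le_antisymm ?_ (integral_nonneg hnn)
      rw [integral_sub hi1 hi2]
      exact sub_nonpos.2 hcon
    rw [integral_eq_zero_iff_of_nonneg hnn (hi1.sub hi2)] at h0
    refine hpos ?_
    filter_upwards [ae_ae_of_ae_kernMeasure h0] with x hx
    rw [posPair_fst, Pi.zero_apply, max_eq_right_iff]
    by_contra! hux
    refine hneg ?_
    filter_upwards [hx] with y hy
    by_contra! huy
    refine (abs_max_sub_max_rpow_lt hp hux huy).ne' (sub_eq_zero.1 ?_)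
    exact hy (fun e => by rw [e] at hux; exact lt_asymm hux huy)
  simp only [opEnergy]
  linarith

theorem posSet_subset (Ω : Set (RN N)) (u : RN N → ℝ) : posSet Ω u ⊆ Ω := fun _ h => h.1

theorem Admissible.pEnergy_posPair_wMeasure (H : Admissible Ω s p V g) {h : RN N → ℝ}
    (hm : AEMeasurable h (volume.restrict Ω)) (h0 : ∀ᵐ x ∂(volume.restrict Ω), 0 ≤ h x)
    (w : (RN N → ℝ) × (RN N → RN N)) :
    pEnergy p (wMeasure (posSet Ω w.1) h) (posPair w).1
      = pEnergy p (wMeasure Ω h) (posPair w).1 := by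
  have hsub := posSet_subset Ω w.1
  rw [← pForm_self H.p_gt, ← pForm_self H.p_gt, pForm_wMeasure hm h0, pForm_wMeasure
    (hm.mono_measure (Measure.restrict_mono hsub le_rfl))
    (ae_restrict_of_ae_restrict_of_subset hsub h0)]
  symm
  refine setIntegral_eq_of_subset_of_forall_sdiff_eq_zero H.isOpen.measurableSet hsub ?_
  rintro x ⟨hx, hx'⟩
  have : w.1 x ≤ 0 := not_lt.1 fun h => hx' ⟨hx, h⟩
  simp [posPair_fst, max_eq_right this]

theorem Admissible.opEnergy_posPair (H : Admissible Ω s p V g)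
    (w : (RN N → ℝ) × (RN N → RN N)) :
    opEnergy (posSet Ω w.1) s p V (posPair w) = opEnergy Ω s p V (posPair w) := by
  have hp := H.p_gt
  have e : pEnergy p (volume.restrict (posSet Ω w.1)) (posPair w).2
      = pEnergy p (volume.restrict Ω) (posPair w).2 := by
    symm
    refine setIntegral_eq_of_subset_of_forall_sdiff_eq_zero H.isOpen.measurableSet
      (posSet_subset Ω w.1) ?_
    rintro x ⟨hx, hx'⟩
    have : w.1 x ≤ 0 := not_lt.1 fun h => hx' ⟨hx, h⟩
    rw [posPair_snd_of_nonpos this, norm_zero, Real.zero_rpow (by linarith)]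
  rw [opEnergy, opEnergy, e, H.pEnergy_posPair_wMeasure H.memV.1.aemeasurable H.V_nonneg]

theorem Admissible.exists_isFirstEigenvalue_lt (H : Admissible Ω s p V g) {lam : ℝ}
    {w : (RN N → ℝ) × (RN N → RN N)} {T : Set ((RN N → ℝ) × (RN N → RN N))}
    (hT : IsEnergySpace Ω (posSet Ω w.1) p T) (hpT : posPair w ∈ T)
    (hpos : ¬ (posPair w).1 =ᵐ[volume] 0)
    (hlt : opEnergy Ω s p V (posPair w) < lam * pEnergy p (wMeasure Ω g) (posPair w).1) :
    ∃ μ, IsFirstEigenvalue T (posSet Ω w.1) s p V g μ ∧ μ < lam := by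
  obtain ⟨μ, hμ, hle⟩ := H.exists_isFirstEigenvalue (posSet_subset Ω w.1) hT hpT hpos
  refine ⟨μ, hμ, ?_⟩
  have h1 := hle _ hpT
  rw [H.opEnergy_posPair, H.pEnergy_posPair_wMeasure H.memg.1.aemeasurable
    (H.g_pos.mono fun _ h => h.le)] at h1
  exact lt_of_mul_lt_mul_right (h1.trans_lt hlt) (pEnergy_nonneg _)

/-- The weighted Sobolev inequality on a set of finite measure. -/
theorem exists_pEnergy_wMeasure_le (hs0 : 0 < s) (hs1 : s < 1) (hp : 1 < p) (hpN : p < N) :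
    ∃ S : ℝ, 0 < S ∧ ∀ (Ω A : Set (RN N)) (g : RN N → ℝ) (w : (RN N → ℝ) × (RN N → RN N)),
      volume A ≠ ⊤ → A ⊆ Ω → MemLp g (ENNReal.ofReal (N / (p * s))) (volume.restrict Ω) →
      MemX Ω p w →
      pEnergy p (wMeasure A g) w.1
        ≤ (eLpNorm g (ENNReal.ofReal (N / (p * s))) (volume.restrict Ω)).toReal
          * (volume A).toReal ^ ((p - p * s) / N) * S * pEnergy p volume w.2 := by
  have hp0 : 0 < p := by linarith
  have hN0 : (0 : ℝ) < N := by linarith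
  have hps : p * s < p := by nlinarith
  have hps0 : 0 < p * s := by positivity
  have hNps : 0 < (N : ℝ) - p * s := by linarith
  have hNp : 0 < (N : ℝ) - p := by linarith
  obtain ⟨S, hS, hSob⟩ := exists_sobolev hp hpN
  refine ⟨S ^ p, by positivity, fun Ω A g w hA hAΩ hg hw => ?_⟩
  have hle : volume.restrict A ≤ volume.restrict Ω := Measure.restrict_mono hAΩ le_rfl
  have hgA := hg.1.mono_measure hle
  have hconj : ((N : ℝ) / (p * s)).HolderConjugate (N / (N - p * s)) := by
    rw [Real.holderConjugate_iff]
    refine ⟨by rw [lt_div_iff₀ hps0]; linarith, ?_⟩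
    field_simp; ring
  have hum := hw.memLp.1
  have h1 := (eLpNorm_wMeasure_rpow_le hp (subset_refl A) hgA hum).trans
    (lintegral_enorm_mul_rpow_le hp hconj hgA hum.restrict)
  -- Hölder on `A`, from the exponent `Np/(N-ps)` up to the Sobolev exponent `Np/(N-p)`, costs the
  -- power `(1-s)/N` of the measure, the difference of the reciprocals.
  have h2 : eLpNorm w.1 (ENNReal.ofReal (p * (N / (N - p * s)))) (volume.restrict A)
      ≤ ENNReal.ofReal S * eLpNorm w.2 (ENNReal.ofReal p) volume
        * volume A ^ ((1 - s) / N) := by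
    have hexp : ENNReal.ofReal (p * (N / (N - p * s))) ≤ ENNReal.ofReal (N * p / (N - p)) := by
      refine ENNReal.ofReal_le_ofReal ?_
      rw [mul_div_assoc', mul_comm p]
      gcongr
    refine (eLpNorm_le_eLpNorm_mul_rpow_measure_univ hexp hum.restrict).trans ?_
    rw [Measure.restrict_apply_univ, ENNReal.toReal_ofReal (by positivity),
      ENNReal.toReal_ofReal (by positivity)]
    have : 1 / (p * (N / (N - p * s))) - 1 / (N * p / (N - p)) = (1 - s) / N := by
      field_simp; ring
    rw [this]
    gcongr
    exact (eLpNorm_restrict_le _ _ _ _).trans (hSob Ω w hw)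
  have h3 : eLpNorm w.1 (ENNReal.ofReal p) (wMeasure A g) ^ p
      ≤ eLpNorm g (ENNReal.ofReal (N / (p * s))) (volume.restrict Ω)
        * (ENNReal.ofReal S * eLpNorm w.2 (ENNReal.ofReal p) volume
        * volume A ^ ((1 - s) / N)) ^ p :=
    h1.trans (mul_le_mul' (eLpNorm_mono_measure _ hle) (ENNReal.rpow_le_rpow h2 hp0.le))
  have hfin : eLpNorm g (ENNReal.ofReal (N / (p * s))) (volume.restrict Ω)
        * (ENNReal.ofReal S * eLpNorm w.2 (ENNReal.ofReal p) volume
        * volume A ^ ((1 - s) / N)) ^ p ≠ ⊤ := by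
    refine ENNReal.mul_ne_top hg.2.ne (ENNReal.rpow_ne_top_of_nonneg hp0.le
      (ENNReal.mul_ne_top (ENNReal.mul_ne_top ENNReal.ofReal_ne_top hw.memLp_grad.2.ne)
        (ENNReal.rpow_ne_top_of_nonneg (div_nonneg (by linarith) hN0.le) hA)))
  have h4 := ENNReal.toReal_mono hfin h3
  rw [pEnergy_eq_toReal_rpow hp (hum.mono_ac (wMeasure_absolutelyContinuous g)),
    pEnergy_eq_toReal_rpow hp hw.memLp_grad.1]
  simp only [ENNReal.toReal_mul, ← ENNReal.toReal_rpow, ENNReal.toReal_ofReal hS.le] at h4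
  refine h4.trans_eq ?_
  rw [Real.mul_rpow (by positivity) (by positivity), Real.mul_rpow hS.le (by positivity),
    ← Real.rpow_mul ENNReal.toReal_nonneg, show (1 - s) / N * p = (p - p * s) / N by ring]
  ring

/-- As `s < 1`, `q > N/(sp) > N/p`, and the Lebesgue spaces on the bounded set `Ω` are nested. -/
theorem Admissible.of_memLp {q : ℝ} (hs0 : 0 < s) (hs1 : s < 1) (hp : 1 < p) (hpN : p < N)
    (hΩ : IsOpen Ω) (hb : Bornology.IsBounded Ω) (hq : (N : ℝ) / (s * p) < q)
    (hV : MemLp V (ENNReal.ofReal q) (volume.restrict Ω))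
    (hg : MemLp g (ENNReal.ofReal q) (volume.restrict Ω))
    (hV0 : ∀ᵐ x ∂(volume.restrict Ω), 0 ≤ V x) (hg0 : ∀ᵐ x ∂(volume.restrict Ω), 0 < g x) :
    Admissible Ω s p V g := by
  have hp0 : 0 < p := by linarith
  have hN0 : (0 : ℝ) < N := by linarith
  have : IsFiniteMeasure (volume.restrict Ω) := ⟨by simpa using hb.measure_lt_top⟩
  have h : ENNReal.ofReal (N / p) ≤ ENNReal.ofReal q := by
    refine ENNReal.ofReal_le_ofReal (le_trans ?_ hq.le)
    exact div_le_div_of_nonneg_left hN0.le (by positivity) (by nlinarith)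
  exact ⟨hs0, hs1, hp, hpN, hΩ, hb, hV.mono_exponent h, hg.mono_exponent h, hV0, hg0⟩

/-- The assertions of the main theorem for the positivity set. -/
theorem Admissible.posSet_assertions (H : Admissible Ω s p V g) {S : ℝ} (hS : 0 < S)
    (hSob : ∀ (Ω A : Set (RN N)) (g : RN N → ℝ) (w : (RN N → ℝ) × (RN N → RN N)),
      volume A ≠ ⊤ → A ⊆ Ω → MemLp g (ENNReal.ofReal (N / (p * s))) (volume.restrict Ω) →
      MemX Ω p w →
      pEnergy p (wMeasure A g) w.1
        ≤ (eLpNorm g (ENNReal.ofReal (N / (p * s))) (volume.restrict Ω)).toReal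
          * (volume A).toReal ^ ((p - p * s) / N) * S * pEnergy p volume w.2)
    (hg : MemLp g (ENNReal.ofReal (N / (p * s))) (volume.restrict Ω)) {lam : ℝ}
    {w : (RN N → ℝ) × (RN N → RN N)} (hw : w ∈ spaceX0 Ω p) (hne : ¬ w.1 =ᵐ[volume] 0)
    (hE : ∀ z ∈ spaceX0 Ω p, weakForm Ω s p V g lam w z = 0)
    (hfirst : ¬ IsFirstEigenvalue (spaceX0 Ω p) Ω s p V g lam) :
    (∃ μ, IsFirstEigenvalue (spaceX0On Ω (posSet Ω w.1) p) (posSet Ω w.1) s p V g μ ∧ μ < lam) ∧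
    (ContinuousOn w.1 Ω → ∃ μ,
      IsFirstEigenvalue (spaceX0 (posSet Ω w.1) p) (posSet Ω w.1) s p V g μ ∧ μ < lam) ∧
    S⁻¹ / (eLpNorm g (ENNReal.ofReal (N / (p * s))) (volume.restrict Ω)).toReal
      * (volume (posSet Ω w.1)).toReal ^ (-((p - p * s) / (N : ℝ))) ≤ lam := by
  have hp := H.p_gt
  have hX := (mem_spaceX0_iff hp H.isOpen).1 hw
  have hsub := posSet_subset Ω w.1
  have hneg : ¬ ∀ᵐ x, 0 ≤ w.1 x := fun h =>
    hfirst (H.isFirstEigenvalue_of_nonneg hw h hne hE)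
  -- If `u⁺` vanished, `-u` would be a nonnegative eigenfunction for the same eigenvalue, which
  -- would then be the first.
  have hpos : ¬ (posPair w).1 =ᵐ[volume] 0 := fun h => by
    have hm : (-w) ∈ spaceX0 Ω p := by
      have := (mem_spaceX0_iff hp H.isOpen).2 (hX.smul hp (-1))
      rwa [neg_one_smul] at this
    refine hfirst (H.isFirstEigenvalue_of_nonneg hm ?_ (fun h0 => hne ?_) fun z hz => ?_)
    · filter_upwards [h] with x hx
      rw [posPair_fst, Pi.zero_apply, max_eq_right_iff] at hx
      simpa using hx
    · filter_upwards [h0] with x hx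
      simpa using hx
    · rw [H.weakForm_neg subset_rfl, hE z hz, neg_zero]
  have hlt := H.opEnergy_posPair_lt hX hpos hneg hE
  have hpX := hX.posPair hp H.isOpen
  have hpOn : posPair w ∈ spaceX0On Ω (posSet Ω w.1) p := by
    refine ⟨(mem_spaceX0_iff hp H.isOpen).2 hpX, ?_⟩
    filter_upwards [hw.2.2] with x hx hxA
    rw [posPair_fst, max_eq_right_iff]
    by_cases hxΩ : x ∈ Ω
    · exact not_lt.1 fun h => hxA ⟨hxΩ, h⟩
    · exact (hx hxΩ).le
  have hTOn := isEnergySpace_spaceX0On hp H.isOpen (posSet Ω w.1)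
  refine ⟨H.exists_isFirstEigenvalue_lt hTOn hpOn hpos hlt, fun hc => ?_, ?_⟩
  · have hA := isOpen_posSet H.isOpen hc
    exact H.exists_isFirstEigenvalue_lt (isEnergySpace_spaceX0 hp hA hsub)
      ((mem_spaceX0_iff hp hA).2 (hX.posPair_of_continuousOn hp H.isOpen hc)) hpos hlt
  · have hAfin : volume (posSet Ω w.1) ≠ ⊤ := (H.bounded.subset hsub).measure_lt_top.ne
    have h1 := hSob Ω (posSet Ω w.1) g (posPair w) hAfin hsub hg hpX
    have hR := H.weight_pos hsub hTOn hpOn hpos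
    rw [← H.opEnergy_posPair, ← H.pEnergy_posPair_wMeasure H.memg.1.aemeasurable
      (H.g_pos.mono fun _ h => h.le)] at hlt
    have h2 : pEnergy p volume (posPair w).2 ≤ opEnergy (posSet Ω w.1) s p V (posPair w) := by
      refine le_trans (le_of_eq ?_) (pEnergy_grad_le_opEnergy _)
      rw [pEnergy_eq_toReal_rpow hp hpX.memLp_grad.1,
        pEnergy_eq_toReal_rpow hp hpX.memLp_grad.1.restrict,
        hTOn.eLpNorm_grad_restrict hp H.isOpen H.bounded hsub hpOn]
    set R := pEnergy p (wMeasure (posSet Ω w.1) g) (posPair w).1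
    set γ := (eLpNorm g (ENNReal.ofReal (N / (p * s))) (volume.restrict Ω)).toReal
    have hγ : 0 ≤ γ := ENNReal.toReal_nonneg
    rw [Real.rpow_neg ENNReal.toReal_nonneg]
    set a := (volume (posSet Ω w.1)).toReal ^ ((p - p * s) / (N : ℝ))
    have ha : 0 ≤ a := Real.rpow_nonneg ENNReal.toReal_nonneg _
    have h3 : R ≤ γ * a * S * (lam * R) :=
      h1.trans (mul_le_mul_of_nonneg_left (h2.trans hlt.le) (by positivity))
    have h4 : 1 ≤ γ * a * S * lam := by
      refine le_of_mul_le_mul_right ?_ hR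
      linarith
    -- The inequality `1 ≤ γ a S lam` excludes a zero norm or a zero measure, so the divisions in
    -- the bound are genuine.
    have hpr : 0 < γ * a := by
      refine lt_of_le_of_ne (by positivity) fun h => ?_
      rw [← h] at h4
      norm_num at h4
    have hγ0 : γ ≠ 0 := left_ne_zero_of_mul hpr.ne'
    have ha0 : a ≠ 0 := right_ne_zero_of_mul hpr.ne'
    have e : S⁻¹ / γ * a⁻¹ = 1 / (γ * a * S) := by field_simp
    rw [e, div_le_iff₀ (by positivity)]
    linarith

theorem negSet_eq_posSet_neg (Ω : Set (RN N)) (u : RN N → ℝ) : negSet Ω u = posSet Ω (-u) := by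
  ext x; simp [negSet, posSet]

end Splitting

end MixedEigen

theorem mainTheorem10 (N : ℕ) (s p : ℝ) (hs0 : 0 < s) (hs1 : s < 1) (hp1 : 1 < p)
    (hpN : p < (N : ℝ)) :
    ∃ C : ℝ, 0 < C ∧
      ∀ (Ω : Set (MixedEigen.RN N)) (V g : MixedEigen.RN N → ℝ) (q : ℝ),
        IsOpen Ω → Bornology.IsBounded Ω → (N : ℝ) / (s * p) < q →
        MemLp V (ENNReal.ofReal q) (volume.restrict Ω) →
        MemLp g (ENNReal.ofReal q) (volume.restrict Ω) →
        (∀ᵐ x ∂(volume.restrict Ω), 0 ≤ V x) →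
        (∀ᵐ x ∂(volume.restrict Ω), 0 < g x) →
        ∀ (ν : ℝ) (u : MixedEigen.RN N → ℝ),
          MixedEigen.IsEigenfunction (MixedEigen.spaceX0 Ω p) Ω s p V g ν u →
          ¬ MixedEigen.IsFirstEigenvalue (MixedEigen.spaceX0 Ω p) Ω s p V g ν →
          ∀ A : Set (MixedEigen.RN N),
            (A = MixedEigen.posSet Ω u ∨ A = MixedEigen.negSet Ω u) →
            (∃ μ : ℝ,
              MixedEigen.IsFirstEigenvalue (MixedEigen.spaceX0On Ω A p) A s p V g μ ∧ μ < ν) ∧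
            (ContinuousOn u Ω → ∃ μ : ℝ,
              MixedEigen.IsFirstEigenvalue (MixedEigen.spaceX0 A p) A s p V g μ ∧ μ < ν) ∧
            C / (eLpNorm g (ENNReal.ofReal ((N : ℝ) / (p * s))) (volume.restrict Ω)).toReal
              * (volume A).toReal ^ (-((p - p * s) / (N : ℝ))) ≤ ν := by
  obtain ⟨S, hS, hSob⟩ := MixedEigen.exists_pEnergy_wMeasure_le hs0 hs1 hp1 hpN
  -- `S` is the `p`-th power of the Sobolev constant, fixed before any of the data is introduced.
  refine ⟨S⁻¹, inv_pos.2 hS, fun Ω V g q hΩ hb hq hV hg hV0 hg0 ν u hu hfirst A hA => ?_⟩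
  have H := MixedEigen.Admissible.of_memLp hs0 hs1 hp1 hpN hΩ hb hq hV hg hV0 hg0
  have : IsFiniteMeasure (volume.restrict Ω) := ⟨by simpa using hb.measure_lt_top⟩
  have hg' : MemLp g (ENNReal.ofReal ((N : ℝ) / (p * s))) (volume.restrict Ω) :=
    hg.mono_exponent (ENNReal.ofReal_le_ofReal (by rw [mul_comm p s]; exact hq.le))
  obtain ⟨G, hw, hne, hE⟩ := hu
  rcases hA with rfl | rfl
  · exact H.posSet_assertions hS hSob hg' (w := (u, G)) hw hne hE hfirst
  -- The equation is odd, so `-u` is an eigenfunction for the same `ν`.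
  · rw [MixedEigen.negSet_eq_posSet_neg]
    have hw' : -(u, G) ∈ MixedEigen.spaceX0 Ω p := by
      have := (MixedEigen.mem_spaceX0_iff hp1 hΩ).2
        (((MixedEigen.mem_spaceX0_iff hp1 hΩ).1 hw).smul hp1 (-1))
      rwa [neg_one_smul] at this
    have key := H.posSet_assertions hS hSob hg' (w := -(u, G)) hw'
      (fun h0 => hne (by filter_upwards [h0] with x hx; simpa using hx))
      (fun z hz => by rw [H.weakForm_neg subset_rfl, hE z hz, neg_zero]) hfirst
    exact ⟨key.1, fun hc => key.2.1 hc.neg, key.2.2⟩
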